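/- Let $\eta<\xi$ and $0<\theta<1$ be real numbers, and let $f:[\eta,\xi]\to\mathbb{R}$ be twice continuously differentiable, with $|f''|\ge m$ on $[\eta,\xi]$ for some $m>0$ and $f''\in\mathrm{Lip}_\theta([\eta,\xi])$, that is, $|f''(x)-f''(y)|\le L|x-y|^\theta$ for some $L$ and all $x,y\in[\eta,\xi]$. Write $\|x\|=\min_{n\in\mathbb{Z}}|x-n|$, and for real $Q\ge 1$ and $0<\delta<\frac12$ put $$\widetilde N(Q,\delta)=\#\{(a,q)\in\mathbb{Z}\times\mathbb{N}: Q<q\le 2Q,\ \eta q<a\le \xi q,\ \|q f(a/q)\|<\delta\}$$ and $$E(Q,\delta)=\widetilde N(Q,\delta)-3(\xi-\eta)\delta Q^2 ,\qquad T(Q)=Q^{\frac{1-2\theta}{2-\theta}}(\log Q)^{-\frac{5-\theta}{2-\theta}} .$$ Then for every $\varepsilon>0$ and every $c>0$ there is a constant $C>0$, depending only on $\eta,\xi,f,\theta,\varepsilon,c$, such that for all real $Q\ge1$ and $\delta$ with $Q^{-\frac{1+\theta}{3-\theta}+\varepsilon}\le\delta<\frac12$: $$|E(Q,\delta)|\le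 C\,\delta^{2/3}Q^{5/3}(\log Q)^{2/3}\quad\text{if } \delta\ge c\,T(Q),$$ $$|E(Q,\delta)|\le C\,\delta^{\frac{2}{5-\theta}}Q^{\frac{3(3-\theta)}{5-\theta}}\quad\text{if } \delta\le c\,T(Q).$$ -/

import Mathlib

open scoped NNReal

/-- The distance `‖x‖` from a real number to the nearest integer. -/
noncomputable def distInt (x : ℝ) : ℝ := |x - round x|

/-- `distInt x` is the minimum of `|x - m|` over the integers `m`. -/
theorem distInt_isLeast (x : ℝ) : IsLeast (Set.range fun m : ℤ => |x - m|) (distInt x) := by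
  refine ⟨⟨round x, rfl⟩, ?_⟩
  rintro _ ⟨m, rfl⟩
  exact round_le x m

/-- The second derivative of `f` on the interval `[η, ξ]` (one-sided at the end points). -/
noncomputable def secondDeriv (η ξ : ℝ) (f : ℝ → ℝ) : ℝ → ℝ :=
  iteratedDerivWithin 2 f (Set.Icc η ξ)

/-- The pairs `(a, q)` of integers with `Q < q ≤ 2Q`, `η q < a ≤ ξ q` and `‖q f(a/q)‖ < δ`. -/
def nearPoints (η ξ : ℝ) (f : ℝ → ℝ) (Q δ : ℝ) : Set (ℤ × ℕ) :=
  {p | Q < (p.2 : ℝ) ∧ (p.2 : ℝ) ≤ 2 * Q ∧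
    η * (p.2 : ℝ) < (p.1 : ℝ) ∧ (p.1 : ℝ) ≤ ξ * (p.2 : ℝ) ∧
    distInt ((p.2 : ℝ) * f ((p.1 : ℝ) / (p.2 : ℝ))) < δ}

/-- The set of counted pairs is finite, so that `Set.ncard` is its true cardinality. -/
theorem nearPoints_finite (η ξ : ℝ) (f : ℝ → ℝ) (Q δ : ℝ) : (nearPoints η ξ f Q δ).Finite := by
  have hB : ∀ p ∈ nearPoints η ξ f Q δ,
      p ∈ (Set.Icc (-⌈|η| * (2 * Q)⌉) ⌈|ξ| * (2 * Q)⌉ ×ˢ Set.Iic ⌊2 * Q⌋₊ : Set (ℤ × ℕ)) := by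
    rintro ⟨a, q⟩ ⟨-, h2, h3, h4, -⟩
    simp only at h2 h3 h4
    have hq : (0 : ℝ) ≤ q := Nat.cast_nonneg q
    refine ⟨⟨?_, ?_⟩, Nat.le_floor h2⟩
    · have h5 : -(|η| * (2 * Q)) ≤ (a : ℝ) := by
        have h6 := mul_le_mul_of_nonneg_left h2 (abs_nonneg η)
        have h7 := mul_le_mul_of_nonneg_right (neg_abs_le η) hq
        linarith
      have h8 := Int.le_ceil (|η| * (2 * Q))
      have h9 : ((-⌈|η| * (2 * Q)⌉ : ℤ) : ℝ) ≤ (a : ℝ) := by push_cast; linarith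
      exact_mod_cast h9
    · have h5 : (a : ℝ) ≤ |ξ| * (2 * Q) := by
        have h6 := mul_le_mul_of_nonneg_left h2 (abs_nonneg ξ)
        have h7 := mul_le_mul_of_nonneg_right (le_abs_self ξ) hq
        linarith
      have h9 : (a : ℝ) ≤ ((⌈|ξ| * (2 * Q)⌉ : ℤ) : ℝ) := h5.trans (Int.le_ceil _)
      exact_mod_cast h9
  exact ((Set.finite_Icc _ _).prod (Set.finite_Iic _)).subset hB

/-- The number `Ñ(Q, δ)` of these pairs. -/
noncomputable def countNear (η ξ : ℝ) (f : ℝ → ℝ) (Q δ : ℝ) : ℕ :=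
  (nearPoints η ξ f Q δ).ncard

/-- The error `E(Q, δ) = Ñ(Q, δ) - 3 (ξ - η) δ Q ^ 2`. -/
noncomputable def errorNear (η ξ : ℝ) (f : ℝ → ℝ) (Q δ : ℝ) : ℝ :=
  (countNear η ξ f Q δ : ℝ) - 3 * (ξ - η) * δ * Q ^ 2

/-- The size of `δ` at which the two error bounds change places. -/
noncomputable def threshold (θ Q : ℝ) : ℝ :=
  Q ^ ((1 - 2 * θ) / (2 - θ)) * Real.log Q ^ (-((5 - θ) / (2 - θ)))

/-! The indicator of `‖y‖ < δ` is squeezed between periodic trapezoids whose ramps have width `κδ`,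
and the indicator of `η < a/q ≤ ξ` between smooth weights `W` whose ramps have width `κ`. The mean
values of the trapezoids produce the main term `3(ξ - η)δQ²` up to `O(κδQ²)`. What remains is to
show that the nonzero frequencies `j` also contribute `O(κδQ²)`, that is, to bound `∑_q ∑_a W(a/q)
e(j q f(a/q))` on average over dyadic blocks `j ~ J`.

Since `f''` has constant sign and `‖-y‖ = ‖y‖`, one may take `f` convex and extend it to the whole
line. Poisson summation in `a` turns the inner sum into integrals of `e(q(j f(x) - t x)) W(x)`. For
large `t` there is no stationary point and repeated integration by parts gives decay like `t⁻²`. For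
the other `t` the stationary point is `G(t/j)`, with `G` the inverse of `f'`, and the phase there is
`-q j g(t/j)`, with `g` the Legendre dual of `f`. This phase is linear in `q`, so the sum over `q`
is essentially geometric and is `≪ √Q min(Q, 1/‖j g(t/j)‖)`. Summing over `j` and `t` is then again
a count of rational points `t/j` close to a convex curve, the graph of `g`.

That count needs only an upper bound, Huxley's `J^(1+ε)` for points within `J⁻²` of the curve
(`exists_card_nearPoints_le`), proved by induction on the size of the denominators. Cut the curve
into arcs of length about `1/J`. An integrality argument with a determinant shows that all points
with large denominators over one arc are collinear. If an arc carries `ρ` of them with distinct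
abscissas, `ρ` large, then the slope and the intercept of their line form a rational point close to
the dual curve, with denominator at most `J/ρ`. The induction hypothesis for `g` bounds the number
of such arcs by a summable function of `ρ`. Hence the statement must be proved for `f` and `g`
together.

The smoothness assumption enters through stationary phase. With `f''` only Hölder of order `θ`, the
substitution `u = √ψ` reduces the integral to a Fresnel integral plus an integral whose amplitude is
`O(y^θ)` at the stationary point, so the error is `O(λ^(-(1+θ)/2))`
(`exists_half_stationary_phase`).

Up to factors `Q^ε`, a block of frequencies contributes `J^(1/2) Q^(1/2) (Q + J) + (QJ)^((3-θ)/2) +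
κ⁻¹ QJ`. The Fourier coefficients are at most about `min(δ, 1/(κδJ²))`, so the critical size is `J =
δ⁻¹κ^(-1/2)`. With `κ` the larger of `(δQ)^(-1/3)` and `(δ^(3-θ)Q^(1+θ))^(-1/(5-θ))` everything is
`O(κδQ²)` with a power of `Q` to spare, which absorbs the `Q^ε`. The two candidates for `κ` give the
two bounds of the theorem, the first even without its logarithm, and the threshold is the value of
`δ` at which the two bounds coincide. -/

/-! ### Legendre duality for uniformly convex functions -/

/-- `F` and `G` are mutually inverse derivatives of the uniformly convex functions `f` and `g`,
which are Legendre duals of each other. -/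
structure IsDualPair (c : ℝ) (f F g G : ℝ → ℝ) : Prop where
  one_le : 1 ≤ c
  right_inv : ∀ s, F (G s) = s
  left_inv : ∀ x, G (F x) = x
  legendre : ∀ x, g (F x) = x * F x - f x
  lower : ∀ x y, (y - x) ^ 2 / (2 * c) ≤ f y - f x - F x * (y - x)
  upper : ∀ x y, f y - f x - F x * (y - x) ≤ c / 2 * (y - x) ^ 2
  lower_dual : ∀ x y, (y - x) ^ 2 / (2 * c) ≤ g y - g x - G x * (y - x)
  upper_dual : ∀ x y, g y - g x - G x * (y - x) ≤ c / 2 * (y - x) ^ 2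

namespace IsDualPair

variable {c : ℝ} {f F g G : ℝ → ℝ}

theorem legendre' (h : IsDualPair c f F g G) (s : ℝ) : g s = G s * s - f (G s) := by
  have := h.legendre (G s)
  rwa [h.right_inv] at this

theorem symm (h : IsDualPair c f F g G) : IsDualPair c g G f F where
  one_le := h.one_le
  right_inv := h.left_inv
  left_inv := h.right_inv
  legendre s := by rw [h.legendre' s]; ring
  lower := h.lower_dual
  upper := h.upper_dual
  lower_dual := h.lower
  upper_dual := h.upper

theorem translate (h : IsDualPair c f F g G) (τ : ℝ) :
    IsDualPair c (fun x => f x + τ) F (fun s => g s - τ) G where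
  one_le := h.one_le
  right_inv := h.right_inv
  left_inv := h.left_inv
  legendre x := by rw [h.legendre]; ring
  lower x y := (h.lower x y).trans (by linarith)
  upper x y := le_trans (by linarith) (h.upper x y)
  lower_dual x y := (h.lower_dual x y).trans (by linarith)
  upper_dual x y := le_trans (by linarith) (h.upper_dual x y)

/-- Adding the lower bounds based at `x` and at `y` cancels the values of `f` and leaves strong
monotonicity of `F`. -/
theorem sq_le_mul (h : IsDualPair c f F g G) (x y : ℝ) :
    (y - x) ^ 2 ≤ c * ((F y - F x) * (y - x)) := by
  have hc := h.one_le
  have h1 := h.lower x y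
  have h2 := h.lower y x
  rw [div_le_iff₀ (by linarith)] at h1 h2
  nlinarith

theorem abs_sub_le (h : IsDualPair c f F g G) (x y : ℝ) : |y - x| ≤ c * |F y - F x| := by
  have h1 := h.sq_le_mul x y
  have hc := h.one_le
  rcases eq_or_ne y x with rfl | hxy
  · simp
  · have h2 : 0 < |y - x| := abs_pos.2 (sub_ne_zero.2 hxy)
    have h3 : (F y - F x) * (y - x) ≤ |F y - F x| * |y - x| := by
      rw [← abs_mul]; exact le_abs_self _
    have h4 : |y - x| * |y - x| ≤ (c * |F y - F x|) * |y - x| := by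
      rw [abs_mul_abs_self]
      nlinarith
    exact le_of_mul_le_mul_right h4 h2

theorem mono (h : IsDualPair c f F g G) {x y : ℝ} (hxy : x ≤ y) : F x ≤ F y := by
  have h1 := h.sq_le_mul x y
  have hc := h.one_le
  rcases hxy.eq_or_lt with rfl | hxy
  · simp
  · by_contra! h2
    have : c * ((F y - F x) * (y - x)) < 0 :=
      mul_neg_of_pos_of_neg (by linarith) (mul_neg_of_neg_of_pos (by linarith) (by linarith))
    nlinarith [sq_nonneg (y - x)]

theorem slope_le (h : IsDualPair c f F g G) (x y : ℝ) : |F y - F x| ≤ c * |y - x| := by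
  have := h.symm.abs_sub_le (F x) (F y)
  rwa [h.left_inv, h.left_inv] at this

/-- Uniform convexity at an intermediate point. -/
theorem three_points (h : IsDualPair c f F g G) {x₁ x₂ x₃ η₀ s t : ℝ} (h12 : x₁ < x₂)
    (h23 : x₂ < x₃) (h1 : |f x₁ - (s * x₁ - t)| ≤ η₀) (h2 : |f x₂ - (s * x₂ - t)| ≤ η₀)
    (h3 : |f x₃ - (s * x₃ - t)| ≤ η₀) : (x₂ - x₁) * (x₃ - x₂) ≤ 4 * c * η₀ := by
  have hc := h.one_le
  have e1 := h.lower x₂ x₁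
  have e3 := h.lower x₂ x₃
  rw [div_le_iff₀ (by linarith)] at e1 e3
  rw [abs_le] at h1 h2 h3
  have k1 := mul_le_mul_of_nonneg_left e1 (sub_nonneg.2 h23.le)
  have k3 := mul_le_mul_of_nonneg_left e3 (sub_nonneg.2 h12.le)
  have hlt : 0 < x₃ - x₁ := by linarith
  have p1 : (x₃ - x₂) * (f x₁ - (s * x₁ - t)) ≤ (x₃ - x₂) * η₀ :=
    mul_le_mul_of_nonneg_left h1.2 (by linarith)
  have p3 : (x₂ - x₁) * (f x₃ - (s * x₃ - t)) ≤ (x₂ - x₁) * η₀ :=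
    mul_le_mul_of_nonneg_left h3.2 (by linarith)
  have p2 : (x₃ - x₁) * (-η₀) ≤ (x₃ - x₁) * (f x₂ - (s * x₂ - t)) :=
    mul_le_mul_of_nonneg_left h2.1 (by linarith)
  -- The weights `x₃ - x₂` at `x₁`, `x₂ - x₁` at `x₃` and `-(x₃ - x₁)` at `x₂` annihilate every
  -- affine function. The tangent at `x₂` and the line `s x - t` therefore drop out, and only the
  -- three errors `η₀` survive.
  have q : (x₃ - x₂) * (f x₁ - f x₂ - F x₂ * (x₁ - x₂)) +
      (x₂ - x₁) * (f x₃ - f x₂ - F x₂ * (x₃ - x₂)) ≤ 2 * η₀ * (x₃ - x₁) := by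
    nlinarith
  have r : (x₂ - x₁) * (x₃ - x₂) * (x₃ - x₁) ≤ 4 * c * η₀ * (x₃ - x₁) := by
    have := mul_le_mul_of_nonneg_left q (by linarith : (0:ℝ) ≤ 2 * c)
    nlinarith
  exact le_of_mul_le_mul_right r hlt

/-- A line that is close to the graph at two points is close to being a tangent. -/
theorem slope_near (h : IsDualPair c f F g G) {x x' η₀ s t : ℝ} (hx : x < x')
    (h1 : |f x - (s * x - t)| ≤ η₀) (h2 : |f x' - (s * x' - t)| ≤ η₀) :
    |F x - s| ≤ 2 * η₀ / (x' - x) + c / 2 * (x' - x) := by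
  have hc := h.one_le
  have hw : 0 < x' - x := by linarith
  have e1 := h.lower x x'
  have e2 := h.upper x x'
  have e0 : 0 ≤ f x' - f x - F x * (x' - x) := le_trans (by positivity) e1
  rw [abs_le] at h1 h2
  have : 2 * η₀ / (x' - x) + c / 2 * (x' - x) =
    (2 * η₀ + c / 2 * (x' - x) ^ 2) / (x' - x) := by
    field_simp
  rw [this, le_div_iff₀ hw]
  rw [← abs_of_pos hw, ← abs_mul, abs_of_pos hw, abs_le]
  have : 0 ≤ c / 2 * (x' - x) ^ 2 := by positivity
  constructor <;> nlinarith

/-- The tangent of slope `s` touches the graph at `G s` and has intercept `-g s`. As `F` expands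
distances by at least `1 / c`, the point `x` lies within `c * μ` of `G s`, so the graph at `x`
deviates from this tangent by at most `c / 2 * (c * μ) ^ 2`. -/
theorem intercept_near (h : IsDualPair c f F g G) {x η₀ s t μ : ℝ}
    (h1 : |f x - (s * x - t)| ≤ η₀) (h2 : |F x - s| ≤ μ) :
    |g s - t| ≤ η₀ + c ^ 3 / 2 * μ ^ 2 := by
  have hc := h.one_le
  have e := h.abs_sub_le (G s) x
  rw [h.right_inv] at e
  have e1 : 0 ≤ f x - f (G s) - F (G s) * (x - G s) := le_trans (by positivity) (h.lower (G s) x)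
  have e2 := h.upper (G s) x
  rw [h.right_inv] at e1 e2
  have e3 : (x - G s) ^ 2 ≤ (c * μ) ^ 2 := by
    rw [← sq_abs (x - G s)]
    apply pow_le_pow_left₀ (abs_nonneg _)
    exact e.trans (mul_le_mul_of_nonneg_left h2 (by linarith))
  have e4 : c / 2 * (x - G s) ^ 2 ≤ c / 2 * (c * μ) ^ 2 :=
    mul_le_mul_of_nonneg_left e3 (by linarith)
  have e5 : c / 2 * (c * μ) ^ 2 = c ^ 3 / 2 * μ ^ 2 := by ring
  have hg := h.legendre' s
  rw [abs_le] at h1 ⊢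
  constructor <;> nlinarith

end IsDualPair

/-! ### Elementary counting: level sets and gaps -/

/-- Layer-cake summation: the sum of the `n i` is the sum over `ρ ≥ 1` of the number of `i` with `n
i ≥ ρ`. The first `K` levels are bounded trivially, the others by the assumed decay. -/
theorem Finset.sum_le_of_card_level_le {ι : Type*} (s : Finset ι) (n : ι → ℕ) (K : ℕ) (B e τ : ℝ)
    (hB : 0 ≤ B) (h : ∀ ρ : ℕ, K < ρ → ((s.filter (fun i => ρ ≤ n i)).card : ℝ) ≤ B * (ρ : ℝ) ^ (-(1 + e)))
    (hτ : ∀ R : ℕ, ∑ ρ ∈ Finset.Ioc K R, (ρ : ℝ) ^ (-(1 + e)) ≤ τ) :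
    ((∑ i ∈ s, n i : ℕ) : ℝ) ≤ K * s.card + B * τ := by
  obtain ⟨R, hR⟩ : ∃ R, ∀ i ∈ s, n i ≤ R := ⟨s.sup n, fun i hi => Finset.le_sup hi⟩
  have h1 : ∀ i ∈ s, n i ≤ K + ∑ ρ ∈ Finset.Ioc K R, if ρ ≤ n i then 1 else 0 := by
    intro i hi
    rw [← Finset.sum_filter, Finset.sum_const, smul_eq_mul, mul_one]
    have : Finset.Ioc K (n i) ⊆ (Finset.Ioc K R).filter (fun ρ => ρ ≤ n i) := by
      intro ρ hρ
      have := hR i hi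
      simp only [Finset.mem_Ioc, Finset.mem_filter] at hρ ⊢
      omega
    have := Finset.card_le_card this
    rw [Nat.card_Ioc] at this
    omega
  have h2 : ∑ i ∈ s, n i ≤ K * s.card + ∑ ρ ∈ Finset.Ioc K R, (s.filter (fun i => ρ ≤ n i)).card := by
    refine (Finset.sum_le_sum h1).trans ?_
    rw [Finset.sum_add_distrib, Finset.sum_comm, Finset.sum_const, smul_eq_mul, mul_comm]
    simp only [Finset.card_filter, le_refl]
  have h3 : ((∑ i ∈ s, n i : ℕ) : ℝ) ≤
      K * s.card + ∑ ρ ∈ Finset.Ioc K R, ((s.filter (fun i => ρ ≤ n i)).card : ℝ) := by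
    exact_mod_cast h2
  refine h3.trans (add_le_add_right ?_ _)
  calc _ ≤ ∑ ρ ∈ Finset.Ioc K R, B * (ρ : ℝ) ^ (-(1 + e)) :=
        Finset.sum_le_sum fun ρ hρ => h ρ (Finset.mem_Ioc.1 hρ).1
    _ = B * ∑ ρ ∈ Finset.Ioc K R, (ρ : ℝ) ^ (-(1 + e)) := by rw [Finset.mul_sum]
    _ ≤ _ := mul_le_mul_of_nonneg_left (hτ R) hB

/-- The tail can be made as small as desired at the price of a larger `K`. This smallness is what
closes the induction in Huxley's bound, where `K` only affects the constant. -/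
theorem exists_tail_rpow_le {e τ : ℝ} (he : 0 < e) (hτ : 0 < τ) (K₀ : ℕ) :
    ∃ K : ℕ, K₀ ≤ K ∧ ∀ R : ℕ, ∑ ρ ∈ Finset.Ioc K R, (ρ : ℝ) ^ (-(1 + e)) ≤ τ := by
  have hs : Summable fun ρ : ℕ => (ρ : ℝ) ^ (-(1 + e)) := Real.summable_nat_rpow.2 (by linarith)
  obtain ⟨s, hs'⟩ := summable_iff_vanishing_norm.1 hs τ hτ
  refine ⟨max K₀ (s.sup id), le_max_left _ _, fun R => ?_⟩
  refine (le_abs_self _).trans (hs' _ ?_).le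
  rw [Finset.disjoint_left]
  intro ρ hρ hρs
  have : ρ ≤ s.sup id := Finset.le_sup (f := id) hρs
  have h2 := (Finset.mem_Ioc.1 hρ).1
  have := le_max_right K₀ (s.sup id)
  omega

theorem Finset.card_sub_one_mul_le (s : Finset ℝ) (g : ℝ) (hg : 0 ≤ g)
    (h : ∀ x ∈ s, ∀ y ∈ s, x < y → g ≤ y - x) :
    ∀ a b : ℝ, a ≤ b → (∀ x ∈ s, a ≤ x ∧ x ≤ b) → ((s.card : ℝ) - 1) * g ≤ b - a := by
  induction s using Finset.induction_on_max with
  | empty => intro a b hab _; simp; linarith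
  | insert y s hy ih =>
    intro a b hab hs
    rw [Finset.card_insert_of_notMem fun hmem => lt_irrefl _ (hy y hmem)]
    have hyb := hs y (Finset.mem_insert_self _ _)
    rcases s.eq_empty_or_nonempty with rfl | ⟨z, hz⟩
    · simp; linarith
    · have hza := hs z (Finset.mem_insert_of_mem hz)
      have hzy := h z (Finset.mem_insert_of_mem hz) y (Finset.mem_insert_self _ _) (hy z hz)
      have := ih (fun x hx w hw => h x (Finset.mem_insert_of_mem hx) w (Finset.mem_insert_of_mem hw))
        a (y - g) (by linarith) (fun x hx => ⟨(hs x (Finset.mem_insert_of_mem hx)).1, by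
          have := h x (Finset.mem_insert_of_mem hx) y (Finset.mem_insert_self _ _) (hy x hx)
          linarith⟩)
      push_cast
      linarith

/-- Among finitely many reals, two are close together. -/
theorem Finset.exists_close_pair (s : Finset ℝ) (hs : 2 ≤ s.card) {a b : ℝ}
    (hab : ∀ x ∈ s, a ≤ x ∧ x ≤ b) :
    ∃ x ∈ s, ∃ y ∈ s, x < y ∧ (y - x) * ((s.card : ℝ) - 1) ≤ b - a := by
  classical
  set P := (s ×ˢ s).filter fun p => p.1 < p.2 with hP
  have hne : P.Nonempty := by
    obtain ⟨x, hx, y, hy, hxy⟩ := Finset.one_lt_card.1 (by omega : 1 < s.card)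
    rcases lt_or_gt_of_ne hxy with h | h
    · exact ⟨(x, y), by simp [hP, hx, hy, h]⟩
    · exact ⟨(y, x), by simp [hP, hx, hy, h]⟩
  obtain ⟨p, hp, hmin⟩ := P.exists_min_image (fun p => p.2 - p.1) hne
  simp only [hP, Finset.mem_filter, Finset.mem_product] at hp hmin
  refine ⟨p.1, hp.1.1, p.2, hp.1.2, hp.2, ?_⟩
  have := s.card_sub_one_mul_le (p.2 - p.1) (by linarith) (fun x hx y hy hxy => hmin (x, y) ⟨⟨hx, hy⟩, hxy⟩)
    a b ((hab _ hp.1.1).1.trans (hab _ hp.1.1).2) hab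
  linarith

/-- The elements below `min + m` lie in a window of length `m`. So do the others, since otherwise
the minimum, the least of the others and one more element would be three points with gaps at least
`m`. -/
theorem Finset.card_le_of_no_three_far (s : Finset ℤ) (m : ℕ)
    (h : ∀ x ∈ s, ∀ y ∈ s, ∀ z ∈ s, x + m ≤ y → y + m ≤ z → False) : s.card ≤ 2 * m := by
  rcases s.eq_empty_or_nonempty with rfl | hne
  · simp
  set x := s.min' hne
  have hx : x ∈ s := s.min'_mem hne
  have key : ∀ (t : Finset ℤ) (a : ℤ), (∀ y ∈ t, a ≤ y ∧ y < a + m) → t.card ≤ m := by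
    intro t a ht
    have : t ⊆ Finset.Ico a (a + m) := fun y hy => Finset.mem_Ico.2 (ht y hy)
    simpa using Finset.card_le_card this
  have hA : (s.filter (fun y => y < x + m)).card ≤ m :=
    key _ x fun y hy => ⟨s.min'_le _ (Finset.mem_filter.1 hy).1, (Finset.mem_filter.1 hy).2⟩
  have hB : (s.filter (fun y => ¬ y < x + m)).card ≤ m := by
    rcases (s.filter (fun y => ¬ y < x + m)).eq_empty_or_nonempty with h0 | h0
    · rw [h0]; simp
    · set y := (s.filter (fun y => ¬ y < x + m)).min' h0
      have hy := Finset.min'_mem _ h0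
      refine key _ y fun z hz => ⟨Finset.min'_le _ _ hz, ?_⟩
      by_contra hzy
      rw [Finset.mem_filter] at hy hz
      exact h x hx y hy.1 z hz.1 (not_lt.1 hy.2) (not_lt.1 hzy)
  have := Finset.card_filter_add_card_filter_not (s := s) (fun y => y < x + (m : ℤ))
  omega

/-! ### Huxley's bound for rational points near a convex curve -/

/-- The abscissa `a / q` of the rational point `(a / q, b / q)` given by `p = (q, a, b)`. -/
noncomputable def abscissa (p : ℤ × ℤ × ℤ) : ℝ := (p.2.1 : ℝ) / p.1

/-- `p = (q, a, b)` with `1 ≤ q ≤ Z` is a rational point within `q⁻²` of the graph of `f`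
over `[u, u + 1)`. -/
structure IsNearPoint (f : ℝ → ℝ) (u Z : ℝ) (p : ℤ × ℤ × ℤ) : Prop where
  one_le : 1 ≤ p.1
  le : (p.1 : ℝ) ≤ Z
  left : u ≤ abscissa p
  right : abscissa p < u + 1
  near : |p.1 * f (abscissa p) - p.2.2| ≤ 1 / p.1

theorem IsNearPoint.cast_pos {f : ℝ → ℝ} {u Z : ℝ} {p : ℤ × ℤ × ℤ} (h : IsNearPoint f u Z p) :
    (1 : ℝ) ≤ p.1 := by exact_mod_cast h.one_le

theorem IsNearPoint.abscissa_mul {f : ℝ → ℝ} {u Z : ℝ} {p : ℤ × ℤ × ℤ} (h : IsNearPoint f u Z p) :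
    abscissa p * p.1 = p.2.1 := by
  have := h.cast_pos
  rw [abscissa, div_mul_cancel₀]
  positivity

/-- Base case of the induction on `Z`. Subtracting `⌊q u⌋` from `a` and `⌊q f(a/q)⌋` from `b` places
every triple in a fixed box of `5 * 6 * 4` elements. -/
theorem card_nearPoints_le_of_le_five {f : ℝ → ℝ} {u Z : ℝ} (hZ : Z ≤ 5) (S : Finset (ℤ × ℤ × ℤ))
    (hS : ∀ p ∈ S, IsNearPoint f u Z p) : (S.card : ℝ) ≤ 120 := by
  have : S.card ≤ (Finset.Icc (1:ℤ) 5 ×ˢ Finset.Icc (0:ℤ) 5 ×ˢ Finset.Icc (-1:ℤ) 2).card := by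
    refine Finset.card_le_card_of_injOn
      (fun p => (p.1, p.2.1 - ⌊p.1 * u⌋, p.2.2 - ⌊p.1 * f (abscissa p)⌋)) ?_ ?_
    · intro p hp
      have h := hS p hp
      have h1 := h.cast_pos
      have h5 : (p.1 : ℝ) ≤ 5 := h.le.trans hZ
      have e1 := h.left
      have e2 := h.right
      rw [← mul_le_mul_iff_left₀ (by linarith : (0:ℝ) < p.1), h.abscissa_mul] at e1
      rw [← mul_lt_mul_iff_left₀ (by linarith : (0:ℝ) < p.1), h.abscissa_mul] at e2
      have e3 := h.near
      have e4 : 1 / (p.1 : ℝ) ≤ 1 := by rw [div_le_iff₀ (by linarith)]; linarith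
      rw [abs_le] at e3
      have f1 := Int.floor_le ((p.1 : ℝ) * u)
      have f2 := Int.lt_floor_add_one ((p.1 : ℝ) * u)
      have f3 := Int.floor_le ((p.1 : ℝ) * f (abscissa p))
      have f4 := Int.lt_floor_add_one ((p.1 : ℝ) * f (abscissa p))
      simp only [Finset.coe_product, Finset.coe_Icc, Set.mem_prod, Set.mem_Icc]
      refine ⟨⟨h.one_le, by exact_mod_cast h5⟩, ⟨?_, ?_⟩, ?_, ?_⟩
      · have : (⌊(p.1 : ℝ) * u⌋ : ℝ) ≤ p.2.1 := by linarith
        have : ⌊(p.1 : ℝ) * u⌋ ≤ p.2.1 := by exact_mod_cast this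
        omega
      · have : (p.2.1 : ℝ) < ⌊(p.1 : ℝ) * u⌋ + 6 := by linarith
        have : p.2.1 < ⌊(p.1 : ℝ) * u⌋ + 6 := by exact_mod_cast this
        omega
      · have : (⌊(p.1 : ℝ) * f (abscissa p)⌋ : ℝ) - 1 ≤ p.2.2 := by linarith
        have : ⌊(p.1 : ℝ) * f (abscissa p)⌋ - 1 ≤ p.2.2 := by exact_mod_cast this
        omega
      · have : (p.2.2 : ℝ) < ⌊(p.1 : ℝ) * f (abscissa p)⌋ + 3 := by linarith
        have : p.2.2 < ⌊(p.1 : ℝ) * f (abscissa p)⌋ + 3 := by exact_mod_cast this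
        omega
    · rintro ⟨q, a, b⟩ - ⟨q', a', b'⟩ - h
      simp only [Prod.mk.injEq] at h
      obtain ⟨rfl, h2, h3⟩ := h
      have h2 : a = a' := by linarith
      subst h2
      have h4 : abscissa (q, a, b) = abscissa (q, a, b') := rfl
      rw [h4] at h3
      have h3 : b = b' := by linarith
      rw [h3]
  have h2 : (Finset.Icc (1:ℤ) 5 ×ˢ Finset.Icc (0:ℤ) 5 ×ˢ Finset.Icc (-1:ℤ) 2).card = 120 := by
    simp
  rw [h2] at this
  exact_mod_cast this

/-- Many near points with the same abscissa and large denominators yield a near point with that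
abscissa and a small denominator. -/
theorem exists_nearPoint_of_same_abscissa {f : ℝ → ℝ} {u Z x : ℝ} (hZ : 5 ≤ Z) {ρ : ℕ} (hρ : 3 ≤ ρ)
    (T : Finset (ℤ × ℤ × ℤ)) (hT : ∀ p ∈ T, IsNearPoint f u Z p ∧ Z / 2 < p.1 ∧ abscissa p = x)
    (hcard : ρ ≤ T.card) : ∃ p, IsNearPoint f u (Z / ρ) p ∧ abscissa p = x := by
  classical
  have hnear : ∀ p ∈ T, |p.1 * f x - p.2.2| ≤ 2 / Z := by
    intro p hp
    obtain ⟨h1, h2, h3⟩ := hT p hp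
    have := h1.near
    rw [h3] at this
    refine this.trans ?_
    rw [div_le_div_iff₀ (by linarith) (by linarith)]
    linarith
  have ha : ∀ p ∈ T, (p.2.1 : ℝ) = x * p.1 := by
    intro p hp
    obtain ⟨h1, h2, h3⟩ := hT p hp
    rw [← h1.abscissa_mul, h3]
  -- The denominator determines the triple: `a = x q`, and `b` is within `2 / Z < 1 / 2` of `q
  -- f(x)`. The last inequality uses `5 ≤ Z`.
  have hinj : Set.InjOn (fun p : ℤ × ℤ × ℤ => (p.1 : ℝ)) T := by
    rintro ⟨q, a, b⟩ hp ⟨q', a', b'⟩ hp' h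
    simp only [Int.cast_inj] at h
    subst h
    have e1 := ha _ hp
    have e2 := ha _ hp'
    simp only at e1 e2
    have e3 : a = a' := by exact_mod_cast e1.trans e2.symm
    subst e3
    have n1 := hnear _ hp
    have n2 := hnear _ hp'
    simp only at n1 n2
    have hz : 2 / Z < 1 / 2 := by rw [div_lt_div_iff₀ (by linarith) (by norm_num)]; linarith
    rw [abs_le] at n1 n2
    have : |(b : ℝ) - b'| < 1 := by rw [abs_lt]; constructor <;> linarith
    have : |b - b'| < 1 := by exact_mod_cast this
    have : b = b' := by rw [Int.abs_lt_one_iff] at this; omega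
    rw [this]
  have hc : (T.image fun p : ℤ × ℤ × ℤ => (p.1 : ℝ)).card = T.card := Finset.card_image_of_injOn hinj
  obtain ⟨y, hy, z, hz, hyz, hle⟩ := (T.image fun p : ℤ × ℤ × ℤ => (p.1 : ℝ)).exists_close_pair
    (a := Z / 2) (b := Z) (by omega) (by
      intro y hy
      obtain ⟨p, hp, rfl⟩ := Finset.mem_image.1 hy
      exact ⟨(hT p hp).2.1.le, (hT p hp).1.le⟩)
  obtain ⟨p, hp, rfl⟩ := Finset.mem_image.1 hy
  obtain ⟨p', hp', rfl⟩ := Finset.mem_image.1 hz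
  rw [hc] at hle
  have hρ' : (3 : ℝ) ≤ ρ := by exact_mod_cast hρ
  have hcard' : (ρ : ℝ) ≤ T.card := by exact_mod_cast hcard
  have hpos : (0 : ℝ) < (p'.1 : ℝ) - p.1 := by linarith
  have hle2 : ((p'.1 : ℝ) - p.1) * (ρ - 1) ≤ Z / 2 := by
    refine le_trans ?_ (hle.trans (by linarith))
    exact mul_le_mul_of_nonneg_left (by linarith) hpos.le
  -- The point sought is the difference of the two triples with closest denominators. The errors add
  -- up to at most `4 / Z`. The new denominator is at most `Z / (2 (ρ - 1))`, hence at most `Z / ρ`,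
  -- and also at most `Z / 4` because `ρ ≥ 3`, so that `4 / Z` does not exceed its reciprocal.
  have habs : abscissa (p' - p) = x := by
    have e1 := ha _ hp
    have e2 := ha _ hp'
    simp only [abscissa, Prod.fst_sub, Prod.snd_sub, Int.cast_sub]
    rw [e1, e2, div_eq_iff hpos.ne']
    ring
  have h1 : 1 ≤ p'.1 - p.1 := by
    have : p.1 < p'.1 := by exact_mod_cast hyz
    omega
  refine ⟨p' - p, ⟨h1, ?_, ?_, ?_, ?_⟩, habs⟩
  · rw [le_div_iff₀ (by linarith)]
    simp only [Prod.fst_sub, Int.cast_sub]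
    nlinarith
  · rw [habs, ← (hT p hp).2.2]; exact (hT p hp).1.left
  · rw [habs, ← (hT p hp).2.2]; exact (hT p hp).1.right
  · rw [habs]
    have n1 := hnear _ hp
    have n2 := hnear _ hp'
    have : |((p' - p).1 : ℝ) * f x - (p' - p).2.2| ≤ 4 / Z := by
      simp only [Prod.fst_sub, Prod.snd_sub, Int.cast_sub]
      have e : ((p'.1 : ℝ) - p.1) * f x - ((p'.2.2 : ℝ) - p.2.2) =
        (p'.1 * f x - p'.2.2) - (p.1 * f x - p.2.2) := by ring
      rw [e]
      refine (abs_sub _ _).trans ?_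
      have : 4 / Z = 2 / Z + 2 / Z := by ring
      linarith
    refine this.trans ?_
    simp only [Prod.fst_sub, Int.cast_sub]
    rw [div_le_div_iff₀ (by linarith) hpos]
    nlinarith

/-- Three near points in a short interval lie on a common line. -/
theorem IsDualPair.det_eq_zero {c : ℝ} {f F g G : ℝ → ℝ} (h : IsDualPair c f F g G) {u Z l d : ℝ}
    (hZ : 5 ≤ Z) (hd : 64 * c * Z * d = 1) {p p' p'' : ℤ × ℤ × ℤ}
    (hp : IsNearPoint f u Z p ∧ Z / 2 < p.1 ∧ l ≤ abscissa p ∧ abscissa p ≤ l + d)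
    (hp' : IsNearPoint f u Z p' ∧ Z / 2 < p'.1 ∧ l ≤ abscissa p' ∧ abscissa p' ≤ l + d)
    (hp'' : IsNearPoint f u Z p'' ∧ Z / 2 < p''.1 ∧ l ≤ abscissa p'' ∧ abscissa p'' ≤ l + d) :
    (p.1 * p'.2.1 - p'.1 * p.2.1) * p''.2.2 - (p.1 * p'.2.2 - p'.1 * p.2.2) * p''.2.1 +
      (p.2.1 * p'.2.2 - p'.2.1 * p.2.2) * p''.1 = 0 := by
  have hc := h.one_le
  have hdpos : 0 < d := by
    by_contra! hd0
    have : 64 * c * Z * d ≤ 0 := mul_nonpos_of_nonneg_of_nonpos (by positivity) hd0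
    linarith
  -- local coordinates
  have key : ∀ r : ℤ × ℤ × ℤ, IsNearPoint f u Z r ∧ Z / 2 < r.1 ∧ l ≤ abscissa r ∧ abscissa r ≤ l + d →
      ∃ e : ℝ, |e| ≤ 4 / Z ^ 2 ∧ (r.2.2 : ℝ) = r.1 * (f (abscissa r) + e) ∧
        (r.2.1 : ℝ) = r.1 * abscissa r := by
    rintro r ⟨h1, h2, -, -⟩
    have hq : (0 : ℝ) < r.1 := by linarith
    refine ⟨r.2.2 / r.1 - f (abscissa r), ?_, by field_simp; ring, by rw [← h1.abscissa_mul]; ring⟩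
    have e : (r.2.2 : ℝ) / r.1 - f (abscissa r) = -(r.1 * f (abscissa r) - r.2.2) / r.1 := by
      field_simp; ring
    rw [e, abs_div, abs_neg, abs_of_pos hq]
    have := h1.near
    rw [div_le_div_iff₀ hq (by positivity)]
    rw [le_div_iff₀ hq] at this
    have : |r.1 * f (abscissa r) - r.2.2| ≤ 2 / Z := by
      rw [le_div_iff₀ (by linarith)]
      nlinarith [abs_nonneg ((r.1 : ℝ) * f (abscissa r) - r.2.2)]
    rw [le_div_iff₀ (by linarith)] at this
    nlinarith [abs_nonneg ((r.1 : ℝ) * f (abscissa r) - r.2.2)]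
  obtain ⟨e, he, hb, ha⟩ := key p hp
  obtain ⟨e', he', hb', ha'⟩ := key p' hp'
  obtain ⟨e'', he'', hb'', ha''⟩ := key p'' hp''
  set x := abscissa p
  set x' := abscissa p'
  set x'' := abscissa p''
  have hx' : |x' - x| ≤ d := by rw [abs_le]; constructor <;> linarith [hp.2.2.1, hp.2.2.2, hp'.2.2.1, hp'.2.2.2]
  have hx'' : |x'' - x| ≤ d := by rw [abs_le]; constructor <;> linarith [hp.2.2.1, hp.2.2.2, hp''.2.2.1, hp''.2.2.2]
  have rest : ∀ y, |y - x| ≤ d → |f y - f x - F x * (y - x)| ≤ c / 2 * d ^ 2 := by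
    intro y hy
    rw [abs_of_nonneg (le_trans (by positivity) (h.lower x y))]
    refine (h.upper x y).trans (mul_le_mul_of_nonneg_left ?_ (by linarith))
    rw [← sq_abs]
    exact pow_le_pow_left₀ (abs_nonneg _) hy 2
  have r' := rest x' hx'
  have r'' := rest x'' hx''
  set δ := 4 / Z ^ 2 with hδ
  have hδ0 : 0 < δ := by positivity
  set D : ℤ := (p.1 * p'.2.1 - p'.1 * p.2.1) * p''.2.2 - (p.1 * p'.2.2 - p'.1 * p.2.2) * p''.2.1 +
      (p.2.1 * p'.2.2 - p'.2.1 * p.2.2) * p''.1 with hD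
  -- `D` is the determinant of three integer vectors. Subtracting the tangent at `x` leaves only
  -- second-order Taylor remainders and the errors `e`, and the choice `d = 1 / (64 c Z)` makes the
  -- result smaller than `1`, hence zero.
  have hDr : (D : ℝ) = p.1 * p'.1 * p''.1 *
      ((x' - x) * ((f x'' - f x - F x * (x'' - x)) + (e'' - e)) -
        (x'' - x) * ((f x' - f x - F x * (x' - x)) + (e' - e))) := by
    rw [hD]; push_cast; rw [ha, ha', ha'', hb, hb', hb'']; ring
  have hsmall : |(x' - x) * ((f x'' - f x - F x * (x'' - x)) + (e'' - e)) -
        (x'' - x) * ((f x' - f x - F x * (x' - x)) + (e' - e))| ≤ 2 * (d * (c / 2 * d ^ 2 + 2 * δ)) := by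
    refine (abs_sub _ _).trans ?_
    rw [abs_mul, abs_mul, two_mul]
    have b1 : |(f x'' - f x - F x * (x'' - x)) + (e'' - e)| ≤ c / 2 * d ^ 2 + 2 * δ :=
      (abs_add_le _ _).trans (add_le_add r'' ((abs_sub _ _).trans (by linarith)))
    have b2 : |(f x' - f x - F x * (x' - x)) + (e' - e)| ≤ c / 2 * d ^ 2 + 2 * δ :=
      (abs_add_le _ _).trans (add_le_add r' ((abs_sub _ _).trans (by linarith)))
    exact add_le_add (mul_le_mul hx' b1 (abs_nonneg _) hdpos.le)
      (mul_le_mul hx'' b2 (abs_nonneg _) hdpos.le)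
  have hq : (0 : ℝ) < p.1 := by linarith [hp.2.1]
  have hq' : (0 : ℝ) < p'.1 := by linarith [hp'.2.1]
  have hq'' : (0 : ℝ) < p''.1 := by linarith [hp''.2.1]
  have hqqq : (p.1 : ℝ) * p'.1 * p''.1 ≤ Z * Z * Z :=
    mul_le_mul (mul_le_mul hp.1.le hp'.1.le hq'.le (by linarith)) hp''.1.le hq''.le (by positivity)
  have hlt : |(D : ℝ)| < 1 := by
    rw [hDr, abs_mul, abs_of_pos (by positivity)]
    have hle := mul_le_mul hqqq hsmall (abs_nonneg _) (by positivity)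
    refine hle.trans_lt ?_
    have hZd : Z * d ≤ 1 / 64 := by
      have : Z * d * 64 * 1 ≤ Z * d * 64 * c := mul_le_mul_of_nonneg_left hc (by positivity)
      nlinarith
    have hcZd : c * (Z * d) = 1 / 64 := by linarith
    have e1 : Z * Z * Z * (2 * (d * (c / 2 * d ^ 2 + 2 * δ))) =
        (c * (Z * d)) * (Z * d) ^ 2 + 16 * (Z * d) := by
      rw [hδ]; field_simp; ring
    rw [e1, hcZd]
    -- The two summands are now at most `(1 / 64) ^ 3` and `16 / 64`.
    have h0 : 0 ≤ Z * d := by positivity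
    have h2 : (Z * d) ^ 2 ≤ (1 / 64) ^ 2 := pow_le_pow_left₀ h0 hZd 2
    linarith
  have : |D| < 1 := by exact_mod_cast hlt
  exact Int.abs_lt_one_iff.1 this

set_option maxHeartbeats 1000000 in
/-- Many near points with distinct abscissas in a short interval yield a near point for the
dual function, with a small denominator. -/
theorem IsDualPair.exists_dual_nearPoint {c : ℝ} {f F g G : ℝ → ℝ} (h : IsDualPair c f F g G)
    {u Z l d : ℝ} (hZ : 5 ≤ Z) (hd : 64 * c * Z * d = 1) {ρ : ℕ} (hρ : 2 + 10 * c ^ 2 ≤ ρ)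
    (V : Finset (ℤ × ℤ × ℤ)) (hinj : Set.InjOn abscissa (V : Set (ℤ × ℤ × ℤ)))
    (hV : ∀ p ∈ V, IsNearPoint f u Z p ∧ Z / 2 < p.1 ∧ l ≤ abscissa p ∧ abscissa p ≤ l + d)
    (hcard : ρ ≤ V.card) :
    ∃ p : ℤ × ℤ × ℤ, (∃ x, l ≤ x ∧ x ≤ l + d ∧
        |f x - (abscissa p * x - (p.2.2 : ℝ) / p.1)| ≤ 4 / Z ^ 2) ∧
      F u - 2 ≤ abscissa p ∧ abscissa p ≤ F u + c + 2 ∧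
      ∀ v, v ≤ abscissa p → abscissa p < v + 1 → IsNearPoint g v (Z / ρ) p := by
  classical
  have hc := h.one_le
  have hc2 : 1 ≤ c ^ 2 := one_le_pow₀ hc
  have hdpos : 0 < d := by
    by_contra! hd0
    have : 64 * c * Z * d ≤ 0 := mul_nonpos_of_nonneg_of_nonpos (by positivity) hd0
    linarith
  have hZd : Z * d ≤ 1 / 64 := by
    have : Z * d * 64 * 1 ≤ Z * d * 64 * c := mul_le_mul_of_nonneg_left hc (by positivity)
    nlinarith
  set W : Finset ℝ := V.image abscissa with hW
  have hWc : W.card = V.card := Finset.card_image_of_injOn hinj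
  have hρr : (ρ : ℝ) ≤ W.card := by rw [hWc]; exact_mod_cast hcard
  have hW2 : 2 ≤ W.card := by
    have : (2 : ℝ) ≤ W.card := by nlinarith
    exact_mod_cast this
  have hne : W.Nonempty := Finset.card_pos.1 (by omega)
  set xm := W.min' hne with hxm
  set xM := W.max' hne with hxM
  -- The closest pair is measured against the actual spread `w = xM - xm`, not against the cell
  -- length `d`. The denominator `j` below is then at most `Z ^ 2 * w / N`, and this factor `w`
  -- cancels the `1 / w` in the error of the slope.
  obtain ⟨xa, hxa, xb, hxb, hab, hgap⟩ := W.exists_close_pair hW2 (a := xm) (b := xM)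
    fun x hx => ⟨W.min'_le x hx, W.le_max' x hx⟩
  obtain ⟨p, hp, hpx⟩ := Finset.mem_image.1 hxa
  obtain ⟨p', hp', hpx'⟩ := Finset.mem_image.1 hxb
  obtain ⟨pm, hpm, hpxm⟩ := Finset.mem_image.1 (W.min'_mem hne)
  obtain ⟨pM, hpM, hpxM⟩ := Finset.mem_image.1 (W.max'_mem hne)
  change abscissa pm = xm at hpxm
  change abscissa pM = xM at hpxM
  set w := xM - xm with hw
  have hwlt : xb - xa ≤ w := by
    have := W.min'_le xa hxa
    have := W.le_max' xb hxb
    linarith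
  have hw0 : 0 < w := by linarith
  have hwd : w ≤ d := by
    have h1 := (hV pm hpm).2.2.1
    have h2 := (hV pM hpM).2.2.2
    rw [hpxm] at h1
    rw [hpxM] at h2
    linarith
  have hq : (0 : ℝ) < p.1 := by linarith [(hV p hp).2.1]
  have hq' : (0 : ℝ) < p'.1 := by linarith [(hV p' hp').2.1]
  -- The line through the closest pair is `y = (hh / j) x - k / j`. Its slope and minus its
  -- intercept form the rational point `(hh / j, k / j)`. It should lie near the graph of `g`, since
  -- `g` sends the slope of a tangent to minus its intercept.
  set j : ℤ := p.1 * p'.2.1 - p'.1 * p.2.1 with hj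
  set hh : ℤ := p.1 * p'.2.2 - p'.1 * p.2.2 with hhh
  set k : ℤ := p.2.1 * p'.2.2 - p'.2.1 * p.2.2 with hk
  have hjr : (j : ℝ) = p.1 * p'.1 * (xb - xa) := by
    have e1 := (hV p hp).1.abscissa_mul
    have e2 := (hV p' hp').1.abscissa_mul
    rw [hj]; push_cast
    rw [← e1, ← e2, hpx, hpx']; ring
  have hjpos : (0 : ℝ) < j := by
    rw [hjr]; exact mul_pos (mul_pos hq hq') (by linarith)
  have hj1 : 1 ≤ j := by
    have : 0 < j := by exact_mod_cast hjpos
    omega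
  have hj1r : (1 : ℝ) ≤ j := by exact_mod_cast hj1
  have hcZd : c * (Z * d) = 1 / 64 := by linarith
  clear_value j hh k w xm xM
  set N : ℝ := (W.card : ℝ) - 1 with hN
  have hN10 : 1 + 10 * c ^ 2 ≤ N := by linarith
  have hNpos : 0 < N := by linarith
  clear_value N
  have hjN : j * N ≤ Z ^ 2 * w := by
    rw [hjr]
    have : (p.1 : ℝ) * p'.1 ≤ Z * Z := mul_le_mul (hV p hp).1.le (hV p' hp').1.le hq'.le (by linarith)
    calc (p.1 : ℝ) * p'.1 * (xb - xa) * N = (p.1 * p'.1) * ((xb - xa) * N) := by ring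
      _ ≤ (Z * Z) * w := mul_le_mul this hgap (mul_nonneg (by linarith) hNpos.le) (by positivity)
      _ = _ := by ring
  set T : ℤ × ℤ × ℤ := (j, hh, k) with hT
  set s := abscissa T with hs
  set t : ℝ := (k : ℝ) / j with ht
  have hsj : s * j = hh := by
    rw [hs, abscissa, hT]; field_simp
  have htj : t * j = k := by
    rw [ht]; field_simp
  have hline : ∀ r ∈ V, |f (abscissa r) - (s * abscissa r - t)| ≤ 4 / Z ^ 2 := by
    intro r hr
    have hdet := h.det_eq_zero hZ hd (hV p hp) (hV p' hp') (hV r hr)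
    obtain ⟨h1, h2, -, -⟩ := hV r hr
    have hqr : (0 : ℝ) < r.1 := by linarith
    rw [← hj, ← hhh, ← hk] at hdet
    have hdet' : (j : ℝ) * r.2.2 - hh * r.2.1 + k * r.1 = 0 := by exact_mod_cast hdet
    rw [← hsj, ← htj, ← h1.abscissa_mul] at hdet'
    have hb : (r.2.2 : ℝ) = r.1 * (s * abscissa r - t) := by
      have : (j : ℝ) * (r.2.2 - r.1 * (s * abscissa r - t)) = 0 := by linarith
      rcases mul_eq_zero.1 this with h0 | h0
      · exact absurd h0 hjpos.ne'
      · linarith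
    have hn := h1.near
    rw [hb, ← mul_sub, abs_mul, abs_of_pos hqr, le_div_iff₀ hqr] at hn
    rw [le_div_iff₀ (by positivity)]
    have h3 : Z / 2 * (Z / 2) ≤ (r.1 : ℝ) * r.1 := mul_self_le_mul_self (by linarith) h2.le
    have h4 := mul_le_mul_of_nonneg_left h3 (abs_nonneg (f (abscissa r) - (s * abscissa r - t)))
    linarith
  have hlm := hline pm hpm
  have hlM := hline pM hpM
  rw [hpxm] at hlm
  rw [hpxM] at hlM
  have hsn := h.slope_near (by linarith : xm < xM) hlm hlM
  rw [← hw] at hsn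
  set μ := 2 * (4 / Z ^ 2) / w + c / 2 * w with hμ
  have hμ0 : 0 ≤ μ := by positivity
  have hjμ : j * μ * N ≤ 9 := by
    calc j * μ * N = (j * N) * μ := by ring
      _ ≤ (Z ^ 2 * w) * μ := mul_le_mul_of_nonneg_right hjN hμ0
      _ = 8 + c / 2 * (Z * w) ^ 2 := by rw [hμ]; field_simp; ring
      _ ≤ 9 := by
        have h1 : Z * w ≤ Z * d := mul_le_mul_of_nonneg_left hwd (by linarith)
        have h2 : 0 ≤ Z * w := by positivity
        have h3 : c * (Z * w) ≤ 1 / 64 :=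
          (mul_le_mul_of_nonneg_left h1 (by linarith)).trans_eq hcZd
        have h4 : (c * (Z * w)) * (Z * w) ≤ (1 / 64) * (1 / 64) :=
          mul_le_mul h3 (h1.trans hZd) h2 (by norm_num)
        have h5 : c / 2 * (Z * w) ^ 2 = (c * (Z * w)) * (Z * w) / 2 := by ring
        linarith
  have hjNZ : j * N ≤ Z / 64 := by
    calc (j : ℝ) * N ≤ Z ^ 2 * w := hjN
      _ = Z * (Z * w) := by ring
      _ ≤ Z * (Z * d) := by
        apply mul_le_mul_of_nonneg_left _ (by linarith)
        exact mul_le_mul_of_nonneg_left hwd (by linarith)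
      _ ≤ Z * (1 / 64) := mul_le_mul_of_nonneg_left hZd (by linarith)
      _ = _ := by ring
  have hint := h.intercept_near hlm hsn
  have hnear : |T.1 * g s - T.2.2| ≤ 1 / T.1 := by
    change |(j : ℝ) * g s - k| ≤ 1 / j
    rw [← htj, mul_comm t, ← mul_sub, abs_mul, abs_of_pos hjpos, le_div_iff₀ hjpos]
    have e1 : (j : ℝ) * |g s - t| * j ≤ j * (4 / Z ^ 2 + c ^ 3 / 2 * μ ^ 2) * j :=
      mul_le_mul_of_nonneg_right (mul_le_mul_of_nonneg_left hint hjpos.le) hjpos.le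
    refine e1.trans ?_
    have hN2 : (0:ℝ) < N ^ 2 := by positivity
    rw [← mul_le_mul_iff_left₀ hN2]
    have e2 : (j : ℝ) * (4 / Z ^ 2 + c ^ 3 / 2 * μ ^ 2) * j * N ^ 2 =
      4 / Z ^ 2 * (j * N) ^ 2 + c ^ 3 / 2 * (j * μ * N) ^ 2 := by ring
    rw [e2]
    have e3 : 4 / Z ^ 2 * (j * N) ^ 2 ≤ 4 / Z ^ 2 * (Z / 64) ^ 2 :=
      mul_le_mul_of_nonneg_left (pow_le_pow_left₀ (by positivity) hjNZ 2) (by positivity)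
    have e4 : 4 / Z ^ 2 * (Z / 64) ^ 2 ≤ 1 := by field_simp; norm_num
    have e5 : c ^ 3 / 2 * (j * μ * N) ^ 2 ≤ c ^ 3 / 2 * 9 ^ 2 :=
      mul_le_mul_of_nonneg_left (pow_le_pow_left₀ (by positivity) hjμ 2) (by positivity)
    -- The inequality needed is `1 + (81 / 2) * c ^ 3 ≤ N ^ 2`, and it follows from `1 + 10 * c ^ 2
    -- ≤ N`. This is the origin of the hypothesis `2 + 10 * c ^ 2 ≤ ρ`.
    have e6 : c ^ 3 ≤ c ^ 4 := pow_le_pow_right₀ hc (by norm_num)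
    have e7 : (1 + 10 * c ^ 2) ^ 2 ≤ N ^ 2 := pow_le_pow_left₀ (by positivity) hN10 2
    have e8 : (1 + 10 * c ^ 2) ^ 2 = 1 + 20 * c ^ 2 + 100 * c ^ 4 := by ring
    have e9 : 0 ≤ c ^ 4 := by positivity
    linarith
  -- Because `1 ≤ j`, the spread cannot be too small: `N ≤ Z ^ 2 * w`. This keeps the `1 / w` term
  -- of the slope error bounded and confines the dual abscissas to a window of bounded length.
  have hFs : |F xm - s| ≤ 2 := by
    have h1 : N ≤ Z ^ 2 * w := le_trans (le_mul_of_one_le_left hNpos.le hj1r) hjN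
    have h2 : 2 * (4 / Z ^ 2) / w ≤ 1 := by
      rw [div_le_one hw0, mul_div_assoc', div_le_iff₀ (by positivity)]
      linarith
    have h3 : c / 2 * w ≤ 1 := by
      have h4 : c * (Z * w) ≤ 1 / 64 :=
        (mul_le_mul_of_nonneg_left (mul_le_mul_of_nonneg_left hwd (by linarith))
          (by linarith)).trans_eq hcZd
      have h5 : c * w * 1 ≤ c * w * Z := mul_le_mul_of_nonneg_left (by linarith) (by positivity)
      linarith
    linarith
  have hux : u ≤ xm ∧ xm < u + 1 := by
    rw [← hpxm]; exact ⟨(hV pm hpm).1.left, (hV pm hpm).1.right⟩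
  have hF1 := h.mono hux.1
  have hF2 : F xm ≤ F u + c := by
    have h1 := h.slope_le u xm
    rw [abs_of_nonneg (by linarith : 0 ≤ F xm - F u), abs_of_nonneg (by linarith : 0 ≤ xm - u)] at h1
    have h2 : c * (xm - u) ≤ c * 1 := mul_le_mul_of_nonneg_left (by linarith) (by linarith)
    linarith
  rw [abs_le] at hFs
  refine ⟨T, ⟨xm, ?_, ?_, hlm⟩, by linarith, by linarith, fun v hv1 hv2 => ⟨hj1, ?_, hv1, hv2, hnear⟩⟩
  · rw [← hpxm]; exact (hV pm hpm).2.2.1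
  · rw [← hpxm]; exact (hV pm hpm).2.2.2
  · have hρ0 : (0 : ℝ) < ρ := by linarith
    rw [le_div_iff₀ hρ0]
    change (j : ℝ) * ρ ≤ Z
    have h1 : (j : ℝ) * ρ ≤ j * (2 * N) := mul_le_mul_of_nonneg_left (by linarith) hjpos.le
    linarith

/-- The number of cells containing many near points is controlled by the number of near points
for the dual function. -/
theorem IsDualPair.card_heavy_cells_le {c : ℝ} {f F g G : ℝ → ℝ} (h : IsDualPair c f F g G)
    {u Z d N : ℝ} (hZ : 5 ≤ Z) (hd : 64 * c * Z * d = 1) {ρ : ℕ} (hρ : 2 + 10 * c ^ 2 ≤ ρ)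
    (V : Finset (ℤ × ℤ × ℤ)) (hinj : Set.InjOn abscissa (V : Set (ℤ × ℤ × ℤ)))
    (hV : ∀ p ∈ V, IsNearPoint f u Z p ∧ Z / 2 < p.1)
    (hN : ∀ (v : ℝ) (S : Finset (ℤ × ℤ × ℤ)), (∀ p ∈ S, IsNearPoint g v (Z / ρ) p) → (S.card : ℝ) ≤ N)
    (I : Finset ℤ)
    (hI : ∀ i ∈ I, ρ ≤ (V.filter fun p => ⌊(abscissa p - u) / d⌋ = i).card) :
    (I.card : ℝ) ≤ (2 * (⌈257 * c ^ 2⌉₊ + 1) : ℕ) * ((⌈c⌉₊ + 5 : ℕ) * N) := by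
  classical
  have hc := h.one_le
  have hdpos : 0 < d := by
    by_contra! hd0
    have : 64 * c * Z * d ≤ 0 := mul_nonpos_of_nonneg_of_nonpos (by positivity) hd0
    linarith
  have hcell : ∀ (i : ℤ) (x : ℝ), ⌊(x - u) / d⌋ = i ↔ u + i * d ≤ x ∧ x < u + i * d + d := by
    intro i x
    rw [Int.floor_eq_iff, le_div_iff₀ hdpos, div_lt_iff₀ hdpos]
    constructor <;> rintro ⟨h1, h2⟩ <;> constructor <;> linarith
  have hex : ∀ i : ℤ, ∃ p : ℤ × ℤ × ℤ, i ∈ I → (∃ x, u + i * d ≤ x ∧ x ≤ u + i * d + d ∧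
        |f x - (abscissa p * x - (p.2.2 : ℝ) / p.1)| ≤ 4 / Z ^ 2) ∧
      F u - 2 ≤ abscissa p ∧ abscissa p ≤ F u + c + 2 ∧
      ∀ v, v ≤ abscissa p → abscissa p < v + 1 → IsNearPoint g v (Z / ρ) p := by
    intro i
    by_cases hi : i ∈ I
    · obtain ⟨p, hp⟩ := h.exists_dual_nearPoint (l := u + i * d) hZ hd hρ
        (V.filter fun p => ⌊(abscissa p - u) / d⌋ = i)
        (hinj.mono (Finset.coe_subset.2 (Finset.filter_subset _ _))) (fun p hp => by
          obtain ⟨h1, h2⟩ := Finset.mem_filter.1 hp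
          rw [hcell] at h2
          exact ⟨(hV p h1).1, (hV p h1).2, h2.1, h2.2.le⟩) (hI i hi)
      exact ⟨p, fun _ => hp⟩
    · exact ⟨0, fun h => absurd h hi⟩
  choose φ hφ using hex
  -- One dual point belongs to boundedly many cells, since its line is close to the graph in each of
  -- them and uniform convexity forbids three such places far apart. The number 257 comes from `257
  -- ^ 2 > 16 * 64 ^ 2`.
  have hfib : ∀ p ∈ I.image φ, (I.filter fun i => φ i = p).card ≤ 2 * (⌈257 * c ^ 2⌉₊ + 1) := by
    intro p _
    apply Finset.card_le_of_no_three_far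
    intro i hi j hj k hk hij hjk
    rw [Finset.mem_filter] at hi hj hk
    obtain ⟨⟨x, hx1, hx2, hx3⟩, -⟩ := hφ i hi.1
    obtain ⟨⟨y, hy1, hy2, hy3⟩, -⟩ := hφ j hj.1
    obtain ⟨⟨z, hz1, hz2, hz3⟩, -⟩ := hφ k hk.1
    rw [hi.2] at hx3
    rw [hj.2] at hy3
    rw [hk.2] at hz3
    have hm := Nat.le_ceil (257 * c ^ 2)
    have hij' : (i : ℝ) + (⌈257 * c ^ 2⌉₊ + 1) ≤ j := by exact_mod_cast hij
    have hjk' : (j : ℝ) + (⌈257 * c ^ 2⌉₊ + 1) ≤ k := by exact_mod_cast hjk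
    have g1 : 257 * c ^ 2 * d ≤ y - x := by
      have := mul_le_mul_of_nonneg_right (by linarith : 257 * c ^ 2 + 1 + i ≤ (j : ℝ)) hdpos.le
      linarith
    have g2 : 257 * c ^ 2 * d ≤ z - y := by
      have := mul_le_mul_of_nonneg_right (by linarith : 257 * c ^ 2 + 1 + j ≤ (k : ℝ)) hdpos.le
      linarith
    have hpos : 0 < 257 * c ^ 2 * d := by positivity
    have h3 := h.three_points (by linarith) (by linarith) hx3 hy3 hz3
    have h4 := (mul_le_mul g1 g2 hpos.le (by linarith)).trans h3
    have h5 : 4 * c * (4 / Z ^ 2) = 16 * c * (64 * c * d) ^ 2 := by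
      have : 64 * c * d = 1 / Z := by
        rw [eq_div_iff (by linarith)]; linarith
      rw [this]; field_simp; ring
    rw [h5] at h4
    have h6 : 65536 * (c ^ 3 * d ^ 2) ≤ 65536 * (c ^ 4 * d ^ 2) :=
      mul_le_mul_of_nonneg_left (mul_le_mul_of_nonneg_right
        (pow_le_pow_right₀ hc (by norm_num)) (by positivity)) (by norm_num)
    have h7 : 0 < c ^ 4 * d ^ 2 := by positivity
    have h8 : 257 * c ^ 2 * d * (257 * c ^ 2 * d) = 66049 * (c ^ 4 * d ^ 2) := by ring
    have h9 : 16 * c * (64 * c * d) ^ 2 = 65536 * (c ^ 3 * d ^ 2) := by ring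
    linarith
  have h1 : I.card ≤ 2 * (⌈257 * c ^ 2⌉₊ + 1) * (I.image φ).card := Finset.card_le_mul_card_image _ _ hfib
  have h2 : ((I.image φ).card : ℝ) ≤ (⌈c⌉₊ + 5 : ℕ) * N := by
    set T := I.image φ with hT
    have hmap : ∀ p ∈ T, ⌊abscissa p - (F u - 2)⌋₊ ∈ Finset.range (⌈c⌉₊ + 5) := by
      intro p hp
      obtain ⟨i, hi, rfl⟩ := Finset.mem_image.1 hp
      obtain ⟨-, h1, h2, -⟩ := hφ i hi
      rw [Finset.mem_range, Nat.floor_lt (by linarith)]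
      push_cast
      have := Nat.le_ceil c
      linarith
    rw [Finset.card_eq_sum_card_fiberwise hmap]
    push_cast
    refine (Finset.sum_le_sum (g := fun _ => N) fun i hi => ?_).trans_eq ?_
    · refine hN (F u - 2 + i) _ fun p hp => ?_
      obtain ⟨hp1, hp2⟩ := Finset.mem_filter.1 hp
      obtain ⟨i', hi', rfl⟩ := Finset.mem_image.1 hp1
      obtain ⟨-, h1, h2, h3⟩ := hφ i' hi'
      rw [Nat.floor_eq_iff (by linarith)] at hp2
      exact h3 _ (by linarith) (by linarith)
    · rw [Finset.sum_const, Finset.card_range, nsmul_eq_mul]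
      push_cast
      ring
  calc (I.card : ℝ) ≤ ((2 * (⌈257 * c ^ 2⌉₊ + 1) * (I.image φ).card : ℕ) : ℝ) := by exact_mod_cast h1
    _ = (2 * (⌈257 * c ^ 2⌉₊ + 1) : ℕ) * ((I.image φ).card : ℝ) := by push_cast; ring
    _ ≤ _ := mul_le_mul_of_nonneg_left h2 (Nat.cast_nonneg _)

/-- There are at most `64 c Z + 1` cells of length `d`. Cells with more than `K` points are handled
by duality: with the dual count at `Z / ρ` bounded by `A (Z / ρ)^(1+e)`, the number of cells holding
at least `ρ` points is `≪ ρ^(-(1+e))`, which sums to a small tail. -/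
theorem IsDualPair.card_abscissas_le {c : ℝ} {f F g G : ℝ → ℝ} (h : IsDualPair c f F g G)
    {u Z A e τ : ℝ} (hZ : 5 ≤ Z) (hA : 0 ≤ A) {K : ℕ} (hK : 2 + 10 * c ^ 2 ≤ K)
    (hτ : ∀ R : ℕ, ∑ ρ ∈ Finset.Ioc K R, (ρ : ℝ) ^ (-(1 + e)) ≤ τ)
    (V : Finset (ℤ × ℤ × ℤ)) (hinj : Set.InjOn abscissa (V : Set (ℤ × ℤ × ℤ)))
    (hV : ∀ p ∈ V, IsNearPoint f u Z p ∧ Z / 2 < p.1)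
    (hN : ∀ ρ : ℕ, 2 ≤ ρ → ∀ (v : ℝ) (S : Finset (ℤ × ℤ × ℤ)), (∀ p ∈ S, IsNearPoint g v (Z / ρ) p) →
      (S.card : ℝ) ≤ A * (Z / ρ) ^ (1 + e)) :
    (V.card : ℝ) ≤ K * (64 * c * Z + 1) +
      ((2 * (⌈257 * c ^ 2⌉₊ + 1) : ℕ) * (⌈c⌉₊ + 5 : ℕ)) * A * Z ^ (1 + e) * τ := by
  classical
  have hc := h.one_le
  have hc2 : 1 ≤ c ^ 2 := one_le_pow₀ hc
  set d := 1 / (64 * c * Z) with hd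
  have hd1 : 64 * c * Z * d = 1 := by rw [hd]; field_simp
  have hdpos : 0 < d := by positivity
  set idx : ℤ × ℤ × ℤ → ℤ := fun p => ⌊(abscissa p - u) / d⌋ with hidx
  rw [Finset.card_eq_sum_card_image idx V]
  have hlev := Finset.sum_le_of_card_level_le (V.image idx) (fun i => (V.filter fun p => idx p = i).card)
    K (((2 * (⌈257 * c ^ 2⌉₊ + 1) : ℕ) * (⌈c⌉₊ + 5 : ℕ)) * A * Z ^ (1 + e)) e τ (by positivity) (by
      intro ρ hρ
      have hρ' : (K : ℝ) < ρ := by exact_mod_cast hρ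
      have hρ2 : 2 ≤ ρ := by
        have : (2 : ℝ) ≤ ρ := by linarith
        exact_mod_cast this
      refine (h.card_heavy_cells_le hZ hd1 (by linarith) V hinj hV (hN ρ hρ2) _ fun i hi =>
        (Finset.mem_filter.1 hi).2).trans_eq ?_
      rw [Real.div_rpow (by linarith) (Nat.cast_nonneg _), Real.rpow_neg (Nat.cast_nonneg _)]
      ring) hτ
  refine hlev.trans (add_le_add_left (mul_le_mul_of_nonneg_left ?_ (Nat.cast_nonneg _)) _)
  have hsub : V.image idx ⊆ Finset.Ico (0 : ℤ) (⌊64 * c * Z⌋ + 1) := by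
    intro i hi
    obtain ⟨p, hp, rfl⟩ := Finset.mem_image.1 hi
    obtain ⟨h1, h2⟩ := hV p hp
    rw [Finset.mem_Ico, Int.lt_add_one_iff]
    have hl := h1.left
    have hr := h1.right
    refine ⟨Int.floor_nonneg.2 (div_nonneg (by linarith) hdpos.le), Int.floor_le_floor ?_⟩
    rw [div_le_iff₀ hdpos, hd1]
    linarith
  have := Finset.card_le_card hsub
  rw [Int.card_Ico] at this
  have h0 : 0 ≤ ⌊64 * c * Z⌋ := Int.floor_nonneg.2 (by positivity)
  have h1 : ((V.image idx).card : ℤ) ≤ ⌊64 * c * Z⌋ + 1 := by omega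
  have h2 : ((V.image idx).card : ℝ) ≤ (⌊64 * c * Z⌋ : ℝ) + 1 := by exact_mod_cast h1
  linarith [Int.floor_le (64 * c * Z)]

/-- Huxley's bound for the number of rational points very close to a convex curve. -/
theorem exists_card_nearPoints_le {c e : ℝ} (hc : 1 ≤ c) (he : 0 < e) :
    ∃ A : ℝ, 0 < A ∧ ∀ f F g G : ℝ → ℝ, IsDualPair c f F g G → ∀ u Z : ℝ, 0 ≤ Z →
      ∀ S : Finset (ℤ × ℤ × ℤ), (∀ p ∈ S, IsNearPoint f u Z p) → (S.card : ℝ) ≤ A * Z ^ (1 + e) := by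
  classical
  obtain ⟨K₁, hK₁, hτ₁⟩ := exists_tail_rpow_le he (by norm_num : (0:ℝ) < 1 / 8) 3
  set B : ℝ := ((2 * (⌈257 * c ^ 2⌉₊ + 1) : ℕ) * (⌈c⌉₊ + 5 : ℕ)) with hB
  have hBpos : 0 < B := by rw [hB]; positivity
  have hK₁' : (3 : ℝ) ≤ K₁ := by exact_mod_cast hK₁
  -- `K₁` bounds the typical multiplicity of an abscissa, and `K₂` the typical number of abscissas
  -- in a cell. The tail belonging to `K₂` must also defeat the factor `K₁`, so `K₂` is chosen last.
  set τ : ℝ := 1 / (8 * K₁ * B) with hτdef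
  have hτpos : 0 < τ := by rw [hτdef]; positivity
  obtain ⟨K₂, hK₂, hτ₂⟩ := exists_tail_rpow_le he hτpos ⌈2 + 10 * c ^ 2⌉₊
  have hK₂' : 2 + 10 * c ^ 2 ≤ K₂ := (Nat.le_ceil _).trans (by exact_mod_cast hK₂)
  -- Of `A * Z ^ (1 + e)`, one half is reserved for denominators at most `Z / 2`, one eighth for
  -- abscissas of high multiplicity, one eighth for crowded cells and one quarter for everything
  -- else. The summand 120 covers `Z ≤ 5`.
  set A : ℝ := 120 + 4 * (K₁ * (K₂ * (64 * c + 1))) with hA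
  have hApos : 0 < A := by rw [hA]; positivity
  refine ⟨A, hApos, ?_⟩
  -- The induction runs over an integer bound for `Z` and over all dual pairs with constant `c` at
  -- once, because the inductive step passes from `f` to `g`.
  suffices H : ∀ n : ℕ, ∀ f F g G : ℝ → ℝ, IsDualPair c f F g G → ∀ u Z : ℝ, 0 ≤ Z → Z < n →
      ∀ S : Finset (ℤ × ℤ × ℤ), (∀ p ∈ S, IsNearPoint f u Z p) → (S.card : ℝ) ≤ A * Z ^ (1 + e) by
    intro f F g G h u Z hZ
    obtain ⟨n, hn⟩ := exists_nat_gt Z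
    exact H n f F g G h u Z hZ hn
  intro n
  induction n with
  | zero => intro f F g G h u Z hZ hZ0; norm_num at hZ0; linarith
  | succ n ih =>
    intro f F g G h u Z hZ0 hZn S hS
    rcases S.eq_empty_or_nonempty with rfl | ⟨p₀, hp₀⟩
    · simpa using mul_nonneg hApos.le (Real.rpow_nonneg hZ0 _)
    have hZ1 : 1 ≤ Z := (hS p₀ hp₀).cast_pos.trans (hS p₀ hp₀).le
    have hZle : Z ≤ Z ^ (1 + e) := by
      simpa using Real.rpow_le_rpow_of_exponent_le hZ1 (by linarith : (1 : ℝ) ≤ 1 + e)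
    rcases le_or_gt Z 5 with hZ5 | hZ5
    · refine (card_nearPoints_le_of_le_five hZ5 S hS).trans ?_
      have : 120 * 1 ≤ A * Z ^ (1 + e) := by
        refine mul_le_mul ?_ (hZ1.trans hZle) zero_le_one hApos.le
        have : 0 ≤ (K₁ : ℝ) * (K₂ * (64 * c + 1)) := by positivity
        linarith
      linarith
    have hn : Z / 2 < n := by
      push_cast at hZn
      have : (5 : ℝ) < n + 1 := hZ5.trans hZn
      linarith
    have hρZ : ∀ ρ : ℕ, 2 ≤ ρ → 0 ≤ Z / ρ ∧ Z / ρ < n := by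
      intro ρ hρ
      have hρ' : (2 : ℝ) ≤ ρ := by exact_mod_cast hρ
      refine ⟨by positivity, lt_of_le_of_lt ?_ hn⟩
      exact div_le_div_of_nonneg_left hZ0 (by norm_num) hρ'
    -- points with small denominator
    have hsmall : ((S.filter fun p => ¬ Z / 2 < (p.1 : ℝ)).card : ℝ) ≤ A * Z ^ (1 + e) / 2 := by
      refine (ih f F g G h u (Z / 2) (by linarith) hn _ fun p hp => ?_).trans ?_
      · obtain ⟨h1, h2⟩ := Finset.mem_filter.1 hp
        exact { hS p h1 with le := not_lt.1 h2 }
      · rw [Real.div_rpow hZ0 (by norm_num), mul_div_assoc']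
        refine div_le_div_of_nonneg_left (by positivity) (by norm_num) ?_
        simpa using Real.rpow_le_rpow_of_exponent_le (by norm_num : (1:ℝ) ≤ 2)
          (by linarith : (1 : ℝ) ≤ 1 + e)
    set S' := S.filter fun p => Z / 2 < (p.1 : ℝ) with hS'
    have hS'mem : ∀ p ∈ S', IsNearPoint f u Z p ∧ Z / 2 < p.1 := fun p hp =>
      ⟨hS p (Finset.mem_filter.1 hp).1, (Finset.mem_filter.1 hp).2⟩
    set X := S'.image abscissa with hX
    -- one representative for every abscissa
    have hrep : ∃ V : Finset (ℤ × ℤ × ℤ), V ⊆ S' ∧ Set.InjOn abscissa (V : Set (ℤ × ℤ × ℤ)) ∧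
        V.image abscissa = X := by
      obtain ⟨V, h1, h2, h3⟩ := Finset.exists_subset_injOn_image_eq_of_surjOn S' (t := X) (f := abscissa)
        (by rw [hX, Finset.coe_image]; exact Set.surjOn_image _ _)
      exact ⟨V, h1, h2, h3⟩
    obtain ⟨V, hVS, hinj, hVX⟩ := hrep
    have hXV : X.card = V.card := by rw [← hVX, Finset.card_image_of_injOn hinj]
    have hV := h.card_abscissas_le hZ5.le hApos.le hK₂' hτ₂ V hinj (fun p hp => hS'mem p (hVS hp))
      (fun ρ hρ v T hT => ih g G f F h.symm v (Z / ρ) (hρZ ρ hρ).1 (hρZ ρ hρ).2 T hT)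
    rw [← hB, ← hXV] at hV
    have hlev := Finset.sum_le_of_card_level_le X (fun x => (S'.filter fun p => abscissa p = x).card)
      K₁ (A * Z ^ (1 + e)) e (1 / 8) (by positivity) (by
        intro ρ hρ
        have hρ3 : 3 ≤ ρ := by omega
        have hex : ∀ x : ℝ, ∃ p : ℤ × ℤ × ℤ,
            x ∈ X.filter (fun x => ρ ≤ (S'.filter fun p => abscissa p = x).card) →
            IsNearPoint f u (Z / ρ) p ∧ abscissa p = x := by
          intro x
          by_cases hx : ρ ≤ (S'.filter fun p => abscissa p = x).card
          · obtain ⟨p, hp⟩ := exists_nearPoint_of_same_abscissa hZ5.le hρ3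
              (S'.filter fun p => abscissa p = x) (fun p hp => by
                obtain ⟨h1, h2⟩ := Finset.mem_filter.1 hp
                exact ⟨(hS'mem p h1).1, (hS'mem p h1).2, h2⟩) hx
            exact ⟨p, fun _ => hp⟩
          · exact ⟨0, fun h => absurd (Finset.mem_filter.1 h).2 hx⟩
        choose φ hφ using hex
        have hcard := Finset.card_image_of_injOn (f := φ)
          (s := X.filter (fun x => ρ ≤ (S'.filter fun p => abscissa p = x).card)) (by
            intro x hx y hy hxy
            rw [← (hφ x hx).2, ← (hφ y hy).2, hxy])
        rw [← hcard]
        refine (ih f F g G h u (Z / ρ) (hρZ ρ (by omega)).1 (hρZ ρ (by omega)).2 _ fun p hp => ?_).trans_eq ?_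
        · obtain ⟨x, hx, rfl⟩ := Finset.mem_image.1 hp
          exact (hφ x hx).1
        · rw [Real.div_rpow (by linarith) (Nat.cast_nonneg _), Real.rpow_neg (Nat.cast_nonneg _)]
          ring) hτ₁
    rw [← Finset.card_eq_sum_card_image abscissa S'] at hlev
    have hsplit := Finset.card_filter_add_card_filter_not (s := S) (fun p => Z / 2 < (p.1 : ℝ))
    have hsplit' : (S.card : ℝ) = S'.card + (S.filter fun p => ¬ Z / 2 < (p.1 : ℝ)).card := by
      rw [← hsplit]; push_cast; rfl
    have h5 : (K₁ : ℝ) * X.card ≤ K₁ * (K₂ * (64 * c + 1)) * Z ^ (1 + e) + A * Z ^ (1 + e) / 8 := by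
      have e1 : (K₂ : ℝ) * (64 * c * Z + 1) ≤ K₂ * (64 * c + 1) * Z ^ (1 + e) := by
        rw [mul_assoc (K₂ : ℝ)]
        refine mul_le_mul_of_nonneg_left ?_ (Nat.cast_nonneg _)
        have := mul_le_mul_of_nonneg_left hZle (by positivity : 0 ≤ 64 * c)
        linarith
      have e2 : K₁ * (B * A * Z ^ (1 + e) * τ) = A * Z ^ (1 + e) / 8 := by
        rw [hτdef]; field_simp
      have e3 := mul_le_mul_of_nonneg_left (hV.trans (add_le_add_left e1 _)) (Nat.cast_nonneg K₁)
      rw [mul_add, e2] at e3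
      linarith
    have h6 : (K₁ : ℝ) * (K₂ * (64 * c + 1)) * Z ^ (1 + e) ≤ A / 4 * Z ^ (1 + e) :=
      mul_le_mul_of_nonneg_right (by rw [hA]; linarith) (by positivity)
    rw [hsplit']
    linarith

/-- The neighbourhood is cut into `O(1 + Δ J)` strips of height `1 / (4 J ^ 2)`, each following a
vertical translate of the curve. Since denominators are at most `2 J`, a strip lies within `q⁻²` of
its translate, and translates keep the same constant `c`. -/
theorem exists_card_nearPoints_le_of_width {c e : ℝ} (hc : 1 ≤ c) (he : 0 < e) :
    ∃ A : ℝ, 0 < A ∧ ∀ f F g G : ℝ → ℝ, IsDualPair c f F g G → ∀ u J Δ : ℝ, 1 ≤ J → 0 ≤ Δ →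
      ∀ S : Finset (ℤ × ℤ × ℤ), (∀ p ∈ S, J ≤ p.1 ∧ (p.1 : ℝ) ≤ 2 * J ∧ u ≤ abscissa p ∧
        abscissa p < u + 1 ∧ |p.1 * f (abscissa p) - p.2.2| ≤ Δ) →
      (S.card : ℝ) ≤ A * ((1 + Δ * J) * J ^ (1 + e)) := by
  classical
  obtain ⟨A, hA, H⟩ := exists_card_nearPoints_le hc he
  refine ⟨8 * A * 2 ^ (1 + e), by positivity, ?_⟩
  intro f F g G h u J Δ hJ hΔ S hS
  set n : ℤ × ℤ × ℤ → ℤ := fun p => ⌊((p.2.2 : ℝ) / p.1 - f (abscissa p)) * (4 * J ^ 2)⌋ with hn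
  set a := 4 * Δ * J with ha
  have ha0 : 0 ≤ a := by positivity
  have hmap : ∀ p ∈ S, n p ∈ Finset.Icc ⌊-a⌋ ⌊a⌋ := by
    intro p hp
    obtain ⟨h1, h2, h3, h4, h5⟩ := hS p hp
    have hq : (0 : ℝ) < p.1 := by linarith
    have e1 : |(p.2.2 : ℝ) / p.1 - f (abscissa p)| ≤ Δ / J := by
      have : (p.2.2 : ℝ) / p.1 - f (abscissa p) = -(p.1 * f (abscissa p) - p.2.2) / p.1 := by
        field_simp; ring
      rw [this, abs_div, abs_neg, abs_of_pos hq]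
      exact div_le_div₀ hΔ h5 (by linarith) h1
    have e2 : |((p.2.2 : ℝ) / p.1 - f (abscissa p)) * (4 * J ^ 2)| ≤ a := by
      rw [abs_mul, abs_of_pos (by positivity : 0 < 4 * J ^ 2)]
      refine (mul_le_mul_of_nonneg_right e1 (by positivity)).trans_eq ?_
      rw [ha]; field_simp
    rw [abs_le] at e2
    exact Finset.mem_Icc.2 ⟨Int.floor_le_floor e2.1, Int.floor_le_floor e2.2⟩
  have hfib : ∀ i ∈ Finset.Icc ⌊-a⌋ ⌊a⌋, ((S.filter fun p => n p = i).card : ℝ) ≤ A * (2 * J) ^ (1 + e) := by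
    intro i _
    refine H _ _ _ _ (h.translate ((i : ℝ) / (4 * J ^ 2))) u (2 * J) (by linarith) _ fun p hp => ?_
    obtain ⟨hp1, hp2⟩ := Finset.mem_filter.1 hp
    obtain ⟨h1, h2, h3, h4, h5⟩ := hS p hp1
    have hq : (0 : ℝ) < p.1 := by linarith
    refine ⟨?_, h2, h3, h4, ?_⟩
    · have : 0 < p.1 := by exact_mod_cast hq
      omega
    · rw [hn] at hp2
      simp only at hp2
      rw [Int.floor_eq_iff] at hp2
      have hJ2 : 0 < 4 * J ^ 2 := by positivity
      have e1 : (p.1 : ℝ) * (f (abscissa p) + i / (4 * J ^ 2)) - p.2.2 =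
          -(p.1 / (4 * J ^ 2)) * (((p.2.2 : ℝ) / p.1 - f (abscissa p)) * (4 * J ^ 2) - i) := by
        field_simp; ring
      rw [e1, abs_mul, abs_neg, abs_of_pos (by positivity)]
      have e2 : |((p.2.2 : ℝ) / p.1 - f (abscissa p)) * (4 * J ^ 2) - i| ≤ 1 := by
        rw [abs_le]; constructor <;> linarith
      refine (mul_le_mul_of_nonneg_left e2 (by positivity)).trans ?_
      rw [mul_one, div_le_div_iff₀ hJ2 hq]
      nlinarith
  have hcard : (S.card : ℝ) ≤ (Finset.Icc ⌊-a⌋ ⌊a⌋).card * (A * (2 * J) ^ (1 + e)) := by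
    rw [Finset.card_eq_sum_card_fiberwise hmap]
    push_cast
    refine (Finset.sum_le_sum hfib).trans_eq ?_
    rw [Finset.sum_const, nsmul_eq_mul]
  refine hcard.trans ?_
  have hc2 : ((Finset.Icc ⌊-a⌋ ⌊a⌋).card : ℝ) ≤ 8 * (1 + Δ * J) := by
    rw [Int.card_Icc]
    have h0 : ⌊-a⌋ ≤ ⌊a⌋ := Int.floor_le_floor (by linarith)
    have h1 : (((⌊a⌋ + 1 - ⌊-a⌋).toNat : ℤ) : ℝ) = (⌊a⌋ : ℝ) + 1 - ⌊-a⌋ := by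
      rw [Int.toNat_of_nonneg (by omega)]; push_cast; ring
    have h2 : (((⌊a⌋ + 1 - ⌊-a⌋).toNat : ℕ) : ℝ) = (⌊a⌋ : ℝ) + 1 - ⌊-a⌋ := by exact_mod_cast h1
    rw [h2]
    have := Int.floor_le a
    have := Int.lt_floor_add_one (-a)
    rw [ha] at *
    linarith
  refine (mul_le_mul_of_nonneg_right hc2 (by positivity)).trans_eq ?_
  rw [Real.mul_rpow (by norm_num) (by linarith)]
  ring

/-- Huxley's bound in terms of pairs `(q, a)` over an interval of length `M`. -/
theorem exists_card_pairs_le {c e : ℝ} (hc : 1 ≤ c) (he : 0 < e) :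
    ∃ A : ℝ, 0 < A ∧ ∀ f F g G : ℝ → ℝ, IsDualPair c f F g G → ∀ (u : ℝ) (M : ℕ) (J Δ : ℝ),
      1 ≤ J → 0 ≤ Δ → ∀ S : Finset (ℤ × ℤ), (∀ p ∈ S, J ≤ p.1 ∧ (p.1 : ℝ) ≤ 2 * J ∧
        u ≤ (p.2 : ℝ) / p.1 ∧ (p.2 : ℝ) / p.1 < u + M ∧ distInt (p.1 * f ((p.2 : ℝ) / p.1)) ≤ Δ) →
      (S.card : ℝ) ≤ A * (M * ((1 + Δ * J) * J ^ (1 + e))) := by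
  classical
  obtain ⟨A, hA, H⟩ := exists_card_nearPoints_le_of_width hc he
  refine ⟨A, hA, ?_⟩
  intro f F g G h u M J Δ hJ hΔ S hS
  have hmap : ∀ p ∈ S, ⌊(p.2 : ℝ) / p.1 - u⌋₊ ∈ Finset.range M := by
    intro p hp
    obtain ⟨-, -, h1, h2, -⟩ := hS p hp
    rw [Finset.mem_range, Nat.floor_lt (by linarith)]
    linarith
  rw [Finset.card_eq_sum_card_fiberwise hmap]
  push_cast
  refine (Finset.sum_le_sum (g := fun _ => A * ((1 + Δ * J) * J ^ (1 + e))) fun i hi => ?_).trans_eq ?_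
  · set φ : ℤ × ℤ → ℤ × ℤ × ℤ := fun p => (p.1, p.2, round (p.1 * f ((p.2 : ℝ) / p.1))) with hφ
    have hinj : Function.Injective φ := by
      rintro ⟨q, a⟩ ⟨q', a'⟩ hpp
      simp only [hφ, Prod.mk.injEq] at hpp
      rw [hpp.1, hpp.2.1]
    rw [← Finset.card_image_of_injective _ hinj]
    refine H f F g G h (u + i) J Δ hJ hΔ _ fun p hp => ?_
    obtain ⟨r, hr, rfl⟩ := Finset.mem_image.1 hp
    obtain ⟨hr1, hr2⟩ := Finset.mem_filter.1 hr
    obtain ⟨h1, h2, h3, h4, h5⟩ := hS r hr1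
    rw [Nat.floor_eq_iff (by linarith)] at hr2
    exact ⟨h1, h2, by change _ ≤ (r.2 : ℝ) / r.1; linarith, by change (r.2 : ℝ) / r.1 < _; linarith, h5⟩
  · rw [Finset.sum_const, Finset.card_range, nsmul_eq_mul]
    ring

/-- The hypotheses on `v` say that `v ≤ min(Q, 1/‖·‖)`. Where `v` is about `2 ^ i`, the distance is
at most `2 ^ (-i)`, so Huxley's bound allows `M (1 + 2 ^ (-i) J) J^(1+e)` such points. Multiplying
by `2 ^ i` and summing over `2 ^ i ≤ Q` gives `Q` from the first term and `J log Q` from the second,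
with `log Q` absorbed by `Q ^ e`. -/
theorem exists_sum_reciprocal_distInt_le {c e : ℝ} (hc : 1 ≤ c) (he : 0 < e) :
    ∃ A : ℝ, 0 < A ∧ ∀ f F g G : ℝ → ℝ, IsDualPair c f F g G → ∀ (u : ℝ) (M : ℕ) (J Q : ℝ),
      1 ≤ J → 1 ≤ Q → ∀ (S : Finset (ℤ × ℤ)) (v : ℤ × ℤ → ℝ), (∀ p ∈ S, J ≤ p.1 ∧ (p.1 : ℝ) ≤ 2 * J ∧
        u ≤ (p.2 : ℝ) / p.1 ∧ (p.2 : ℝ) / p.1 < u + M) →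
        (∀ p ∈ S, v p ≤ Q ∧ v p * distInt (p.1 * f ((p.2 : ℝ) / p.1)) ≤ 1) →
      ∑ p ∈ S, v p ≤ A * (M * (J ^ (1 + e) * (Q + Q ^ e * J))) := by
  classical
  obtain ⟨A, hA, H⟩ := exists_card_pairs_le hc he
  refine ⟨A * (4 + 2 * (1 + 1 / (e * Real.log 2))), by positivity, ?_⟩
  intro f F g G h u M J Q hJ hQ S v hS hv
  set I := Nat.log 2 ⌊Q⌋₊ with hI
  have hfl : 1 ≤ ⌊Q⌋₊ := Nat.one_le_floor_iff _ |>.2 hQ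
  have hI1 : (2 : ℝ) ^ I ≤ Q := by
    have h1 : 2 ^ I ≤ ⌊Q⌋₊ := Nat.pow_log_le_self 2 (by omega)
    have h2 : ((2 ^ I : ℕ) : ℝ) ≤ ⌊Q⌋₊ := by exact_mod_cast h1
    push_cast at h2
    exact h2.trans (Nat.floor_le (by linarith))
  have hkey : ∀ p ∈ S, v p ≤ ∑ i ∈ Finset.range (I + 1),
      if distInt (p.1 * f ((p.2 : ℝ) / p.1)) ≤ (1 / 2) ^ i then (2 : ℝ) ^ (i + 1) else 0 := by
    intro p hp
    obtain ⟨hv1, hv2⟩ := hv p hp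
    have hnn : ∀ i ∈ Finset.range (I + 1), (0:ℝ) ≤
        if distInt (p.1 * f ((p.2 : ℝ) / p.1)) ≤ (1 / 2) ^ i then (2 : ℝ) ^ (i + 1) else 0 := by
      intro i _; split_ifs <;> positivity
    -- Small values, including negative ones, are charged to `i = 0`, where the condition on the
    -- distance is void.
    rcases le_or_gt (v p) 2 with h2 | h2
    · refine le_trans ?_ (Finset.single_le_sum hnn (Finset.mem_range.2 (Nat.succ_pos I)))
      have : distInt (p.1 * f ((p.2 : ℝ) / p.1)) ≤ (1 / 2) ^ 0 := by
        have := abs_sub_round ((p.1 : ℝ) * f ((p.2 : ℝ) / p.1))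
        rw [distInt]; norm_num at this ⊢; linarith
      rw [if_pos this]; simpa using h2
    · set i := Nat.log 2 ⌊v p⌋₊ with hi
      have hfv : ⌊v p⌋₊ ≠ 0 := (Nat.floor_pos.2 (by linarith)).ne'
      have hiI : i ≤ I := Nat.log_mono_right (Nat.floor_le_floor hv1)
      have h3 : (2 : ℝ) ^ i ≤ v p := by
        have h1 : 2 ^ i ≤ ⌊v p⌋₊ := Nat.pow_log_le_self 2 hfv
        have h2 : ((2 ^ i : ℕ) : ℝ) ≤ ⌊v p⌋₊ := by exact_mod_cast h1
        push_cast at h2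
        exact h2.trans (Nat.floor_le (by linarith))
      have h4 : v p ≤ (2 : ℝ) ^ (i + 1) := by
        have h1 : ⌊v p⌋₊ < 2 ^ (i + 1) := Nat.lt_pow_succ_log_self (by norm_num) _
        have h2 : v p < ((2 ^ (i + 1) : ℕ) : ℝ) := (Nat.floor_lt (by linarith)).1 h1
        push_cast at h2
        exact h2.le
      refine le_trans ?_ (Finset.single_le_sum hnn (Finset.mem_range.2 (Nat.lt_succ_of_le hiI)))
      have : distInt (p.1 * f ((p.2 : ℝ) / p.1)) ≤ (1 / 2) ^ i := by
        rw [div_pow, one_pow, le_div_iff₀ (by positivity)]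
        refine le_trans ?_ hv2
        rw [mul_comm]
        exact mul_le_mul_of_nonneg_right h3 (by rw [distInt]; positivity)
      rw [if_pos this]
      exact h4
  refine (Finset.sum_le_sum hkey).trans ?_
  rw [Finset.sum_comm]
  have hterm : ∀ i ∈ Finset.range (I + 1), (∑ p ∈ S,
      if distInt (p.1 * f ((p.2 : ℝ) / p.1)) ≤ (1 / 2) ^ i then (2 : ℝ) ^ (i + 1) else 0) ≤
      A * (M * J ^ (1 + e)) * (2 * 2 ^ i + 2 * J) := by
    intro i _
    rw [← Finset.sum_filter, Finset.sum_const, nsmul_eq_mul]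
    have := H f F g G h u M J ((1 / 2) ^ i) hJ (by positivity)
      (S.filter fun p => distInt (p.1 * f ((p.2 : ℝ) / p.1)) ≤ (1 / 2) ^ i) (fun p hp => by
        obtain ⟨h1, h2⟩ := Finset.mem_filter.1 hp
        obtain ⟨h3, h4, h5, h6⟩ := hS p h1
        exact ⟨h3, h4, h5, h6, h2⟩)
    refine (mul_le_mul_of_nonneg_right this (by positivity)).trans_eq ?_
    have e1 : ((1 : ℝ) / 2) ^ i * 2 ^ i = 1 := by rw [← mul_pow]; norm_num
    rw [pow_succ]
    linear_combination 2 * A * M * J ^ (1 + e) * J * e1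
  refine (Finset.sum_le_sum hterm).trans ?_
  rw [← Finset.mul_sum, Finset.sum_add_distrib, ← Finset.mul_sum, Finset.sum_const,
    Finset.card_range, nsmul_eq_mul]
  have hgeom : ∑ i ∈ Finset.range (I + 1), (2 : ℝ) ^ i ≤ 2 * Q := by
    rw [geom_sum_eq (by norm_num)]
    rw [pow_succ]; linarith
  have hQe : 1 ≤ Q ^ e := Real.one_le_rpow hQ he.le
  have hIlog : (I : ℝ) ≤ 1 / (e * Real.log 2) * Q ^ e := by
    have h1 := Real.log_le_log (by positivity) hI1
    rw [Real.log_pow] at h1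
    have h2 := Real.log_le_rpow_div (by linarith : 0 ≤ Q) he
    have hl2 : 0 < Real.log 2 := Real.log_pos (by norm_num)
    have h3 : (I : ℝ) ≤ Q ^ e / e / Real.log 2 := by
      rw [le_div_iff₀ hl2]; linarith
    refine h3.trans_eq ?_
    field_simp
  have hl2 : 0 < Real.log 2 := Real.log_pos (by norm_num)
  set D := 1 / (e * Real.log 2) with hD
  have hDpos : 0 < D := by positivity
  have hAM : 0 ≤ A * (M * J ^ (1 + e)) := by positivity
  have hfinal : 2 * ∑ i ∈ Finset.range (I + 1), (2 : ℝ) ^ i + ((I + 1 : ℕ) : ℝ) * (2 * J) ≤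
      (4 + 2 * (1 + D)) * (Q + Q ^ e * J) := by
    push_cast
    have e1 : ((I : ℝ) + 1) * (2 * J) ≤ ((D + 1) * Q ^ e) * (2 * J) :=
      mul_le_mul_of_nonneg_right (by linarith) (by linarith)
    have e2 : 0 ≤ Q ^ e * J := by positivity
    have e3 : 0 ≤ D * Q := by positivity
    linarith
  refine (mul_le_mul_of_nonneg_left hfinal hAM).trans_eq ?_
  ring

/-! ### Convex curves with Hölder continuous second derivative -/

/-- `F` is twice differentiable on the line, with derivatives `F₁` and `F₂`, where `m ≤ F₂ ≤ M` and
`F₂` is Hölder continuous. -/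
structure IsCurve (m M L θ : ℝ) (F F₁ F₂ : ℝ → ℝ) : Prop where
  pos : 0 < m
  hasDerivAt : ∀ x, HasDerivAt F (F₁ x) x
  hasDerivAt₁ : ∀ x, HasDerivAt F₁ (F₂ x) x
  continuous : Continuous F₂
  le : ∀ x, m ≤ F₂ x
  ge : ∀ x, F₂ x ≤ M
  holder : ∀ x y, |F₂ x - F₂ y| ≤ L * |x - y| ^ θ

namespace IsCurve

variable {m M L θ : ℝ} {F F₁ F₂ : ℝ → ℝ}

theorem reflect (h : IsCurve m M L θ F F₁ F₂) :
    IsCurve m M L θ (fun x => F (-x)) (fun x => -F₁ (-x)) (fun x => F₂ (-x)) where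
  pos := h.pos
  hasDerivAt x := by
    exact ((h.hasDerivAt (-x)).comp x (hasDerivAt_neg x)).congr_deriv (by ring)
  hasDerivAt₁ x := by
    exact ((h.hasDerivAt₁ (-x)).comp x (hasDerivAt_neg x)).neg.congr_deriv (by ring)
  continuous := h.continuous.comp continuous_neg
  le x := h.le _
  ge x := h.ge _
  holder x y := by
    have := h.holder (-x) (-y)
    rwa [← abs_neg (-x - -y), show -(-x - -y) = x - y by ring] at this

/-- Translation of the curve by `x₀`, normalised so that the function and its derivative vanish
at the origin. -/
theorem centre (h : IsCurve m M L θ F F₁ F₂) (x₀ : ℝ) :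
    IsCurve m M L θ (fun y => F (x₀ + y) - F x₀ - F₁ x₀ * y) (fun y => F₁ (x₀ + y) - F₁ x₀)
      (fun y => F₂ (x₀ + y)) where
  pos := h.pos
  hasDerivAt y := by
    have h1 := (h.hasDerivAt (x₀ + y)).comp_const_add x₀ y
    have h2 := (h1.sub_const (F x₀)).sub ((hasDerivAt_id y).const_mul (F₁ x₀))
    exact h2.congr_deriv (by ring)
  hasDerivAt₁ y := ((h.hasDerivAt₁ (x₀ + y)).comp_const_add x₀ y).sub_const _
  continuous := h.continuous.comp (continuous_const.add continuous_id)
  le y := h.le _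
  ge y := h.ge _
  holder x y := by
    have := h.holder (x₀ + x) (x₀ + y)
    rwa [show x₀ + x - (x₀ + y) = x - y by ring] at this

theorem deriv_bounds (h : IsCurve m M L θ F F₁ F₂) {x y : ℝ} (hxy : x ≤ y) :
    m * (y - x) ≤ F₁ y - F₁ x ∧ F₁ y - F₁ x ≤ M * (y - x) := by
  rcases hxy.eq_or_lt with rfl | hlt
  · simp
  obtain ⟨z, -, hz⟩ := exists_hasDerivAt_eq_slope F₁ F₂ hlt
    (fun x _ => (h.hasDerivAt₁ x).continuousAt.continuousWithinAt) (fun x _ => h.hasDerivAt₁ x)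
  rw [eq_div_iff (by linarith)] at hz
  rw [← hz]
  exact ⟨mul_le_mul_of_nonneg_right (h.le z) (by linarith),
    mul_le_mul_of_nonneg_right (h.ge z) (by linarith)⟩

theorem bounds_of_nonneg (h : IsCurve m M L θ F F₁ F₂) {y : ℝ} (hy : 0 ≤ y) :
    m / 2 * y ^ 2 ≤ F y - F 0 - F₁ 0 * y ∧ F y - F 0 - F₁ 0 * y ≤ M / 2 * y ^ 2 := by
  have hlow : MonotoneOn (fun z => F z - F 0 - F₁ 0 * z - m / 2 * z ^ 2) (Set.Ici 0) := by
    refine monotoneOn_of_hasDerivWithinAt_nonneg (f' := fun z => F₁ z - F₁ 0 - m * z)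
      (convex_Ici 0) ?_ ?_ ?_
    · intro z _
      have : ContinuousAt F z := (h.hasDerivAt z).continuousAt
      exact ContinuousAt.continuousWithinAt (by fun_prop)
    · intro z _
      have h2 := (((h.hasDerivAt z).sub_const (F 0)).sub ((hasDerivAt_id z).const_mul (F₁ 0))).sub
        ((hasDerivAt_pow 2 z).const_mul (m / 2))
      refine (h2.congr_deriv ?_).hasDerivWithinAt
      simp; ring
    · intro z hz
      rw [interior_Ici] at hz
      have := (h.deriv_bounds (le_of_lt hz)).1
      linarith
  have hupp : MonotoneOn (fun z => M / 2 * z ^ 2 - (F z - F 0 - F₁ 0 * z)) (Set.Ici 0) := by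
    refine monotoneOn_of_hasDerivWithinAt_nonneg (f' := fun z => M * z - (F₁ z - F₁ 0))
      (convex_Ici 0) ?_ ?_ ?_
    · intro z _
      have : ContinuousAt F z := (h.hasDerivAt z).continuousAt
      exact ContinuousAt.continuousWithinAt (by fun_prop)
    · intro z _
      have h2 := ((hasDerivAt_pow 2 z).const_mul (M / 2)).sub
        (((h.hasDerivAt z).sub_const (F 0)).sub ((hasDerivAt_id z).const_mul (F₁ 0)))
      refine (h2.congr_deriv ?_).hasDerivWithinAt
      simp; ring
    · intro z hz
      rw [interior_Ici] at hz
      have := (h.deriv_bounds (le_of_lt hz)).2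
      linarith
  have h1 := hlow Set.self_mem_Ici hy hy
  have h2 := hupp Set.self_mem_Ici hy hy
  simp only at h1 h2
  constructor <;> nlinarith

theorem bounds (h : IsCurve m M L θ F F₁ F₂) (x y : ℝ) :
    m / 2 * (y - x) ^ 2 ≤ F y - F x - F₁ x * (y - x) ∧
      F y - F x - F₁ x * (y - x) ≤ M / 2 * (y - x) ^ 2 := by
  have key : ∀ {F F₁ F₂ : ℝ → ℝ}, IsCurve m M L θ F F₁ F₂ → ∀ x z : ℝ, 0 ≤ z →
      m / 2 * z ^ 2 ≤ F (x + z) - F x - F₁ x * z ∧ F (x + z) - F x - F₁ x * z ≤ M / 2 * z ^ 2 := by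
    intro F F₁ F₂ h x z hz
    have := (h.centre x).bounds_of_nonneg hz
    simpa using this
  rcases le_total x y with hxy | hxy
  · have := key h x (y - x) (by linarith)
    rwa [add_sub_cancel] at this
  · have := key h.reflect (-x) (x - y) (by linarith)
    simp only [neg_add_rev, neg_neg] at this
    rw [show -(x - y) + x = y by ring] at this
    constructor <;> nlinarith

theorem le_max (h : IsCurve m M L θ F F₁ F₂) : m ≤ M := (h.le 0).trans (h.ge 0)

theorem surjective (h : IsCurve m M L θ F F₁ F₂) : Function.Surjective F₁ := by
  have hcont : Continuous F₁ := continuous_iff_continuousAt.2 fun x => (h.hasDerivAt₁ x).continuousAt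
  have hm := h.pos
  refine hcont.surjective ?_ ?_
  · refine Filter.tendsto_atTop_mono' _ (f₁ := fun x => m * x + F₁ 0) ?_ ?_
    · filter_upwards [Filter.eventually_ge_atTop 0] with x hx
      have := (h.deriv_bounds hx).1
      linarith
    · exact Filter.tendsto_atTop_add_const_right _ _ (Filter.tendsto_id.const_mul_atTop hm)
  · refine Filter.tendsto_atBot_mono' _ (f₁ := fun x => m * x + F₁ 0) ?_ ?_
    · filter_upwards [Filter.eventually_le_atBot 0] with x hx
      have := (h.deriv_bounds hx).1
      linarith
    · exact Filter.tendsto_atBot_add_const_right _ _ (Filter.tendsto_id.const_mul_atBot hm)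

/-- The defect of `g` from its tangent equals the defect of `F` between the corresponding points
with their roles exchanged. The quadratic bounds for `F` therefore carry over to `g`, up to the
bi-Lipschitz distortion of `G`, whose square `c ^ 2` turns `c` into `c ^ 3`. -/
theorem exists_isDualPair (h : IsCurve m M L θ F F₁ F₂) :
    ∃ (c : ℝ) (g G : ℝ → ℝ), IsDualPair c F F₁ g G := by
  obtain ⟨G, hG⟩ := h.surjective.hasRightInverse
  have hm := h.pos
  have hM : 0 < M := hm.trans_le h.le_max
  have hmono : ∀ x y, m * |y - x| ≤ |F₁ y - F₁ x| ∧ |F₁ y - F₁ x| ≤ M * |y - x| := by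
    have key : ∀ x y, x ≤ y → m * |y - x| ≤ |F₁ y - F₁ x| ∧ |F₁ y - F₁ x| ≤ M * |y - x| := by
      intro x y hxy
      have := h.deriv_bounds hxy
      have h0 : 0 ≤ m * (y - x) := mul_nonneg hm.le (by linarith)
      rw [abs_of_nonneg (by linarith : 0 ≤ y - x), abs_of_nonneg (by linarith : 0 ≤ F₁ y - F₁ x)]
      exact this
    intro x y
    rcases le_total x y with hxy | hxy
    · exact key x y hxy
    · have := key y x hxy
      rwa [abs_sub_comm x, abs_sub_comm (F₁ x)] at this
  have hinj : ∀ x, G (F₁ x) = x := by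
    intro x
    have h1 := (hmono x (G (F₁ x))).1
    rw [hG (F₁ x), sub_self, abs_zero] at h1
    have : |G (F₁ x) - x| ≤ 0 := by
      by_contra! h2
      nlinarith
    linarith [abs_nonpos_iff.1 this]
  set c := max 1 (max (1 / m) M) with hc
  have hc1 : 1 ≤ c := le_max_left _ _
  have hcm : 1 / m ≤ c := (le_max_left _ _).trans (le_max_right _ _)
  have hcM : M ≤ c := (le_max_right _ _).trans (le_max_right _ _)
  have hcm' : 1 / c ≤ m := by rw [div_le_iff₀ (by linarith)]; rw [div_le_iff₀ hm] at hcm; linarith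
  have hc3 : c ≤ c ^ 3 := le_self_pow₀ hc1 (by norm_num)
  have hlo : ∀ x y, (y - x) ^ 2 / (2 * c) ≤ F y - F x - F₁ x * (y - x) := by
    intro x y
    refine le_trans ?_ (h.bounds x y).1
    have : (y - x) ^ 2 / (2 * c) = 1 / c / 2 * (y - x) ^ 2 := by field_simp
    rw [this]
    exact mul_le_mul_of_nonneg_right (by linarith) (sq_nonneg _)
  have hhi : ∀ x y, F y - F x - F₁ x * (y - x) ≤ c / 2 * (y - x) ^ 2 := fun x y =>
    (h.bounds x y).2.trans (mul_le_mul_of_nonneg_right (by linarith) (sq_nonneg _))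
  have hid : ∀ s t, (t * G t - F (G t)) - (s * G s - F (G s)) - G s * (t - s) =
      F (G s) - F (G t) - F₁ (G t) * (G s - G t) := by
    intro s t
    rw [hG t]; ring
  have hGs : ∀ s t, (t - s) ^ 2 ≤ c ^ 2 * (G s - G t) ^ 2 ∧ (G s - G t) ^ 2 ≤ c ^ 2 * (t - s) ^ 2 := by
    intro s t
    obtain ⟨h1, h2⟩ := hmono (G s) (G t)
    rw [hG s, hG t] at h1 h2
    have e1 : |t - s| ≤ c * |G t - G s| := h2.trans (mul_le_mul_of_nonneg_right hcM (abs_nonneg _))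
    have e2 : |G t - G s| ≤ c * |t - s| := by
      have h3 : 1 / c * |G t - G s| ≤ |t - s| :=
        (mul_le_mul_of_nonneg_right hcm' (abs_nonneg _)).trans h1
      rw [div_mul_eq_mul_div, one_mul, div_le_iff₀ (by linarith)] at h3
      linarith
    have e3 := pow_le_pow_left₀ (abs_nonneg _) e1 2
    have e4 := pow_le_pow_left₀ (abs_nonneg _) e2 2
    rw [mul_pow, sq_abs, sq_abs] at e3 e4
    have : (G s - G t) ^ 2 = (G t - G s) ^ 2 := by ring
    rw [this]
    exact ⟨e3, e4⟩
  refine ⟨c ^ 3, fun s => s * G s - F (G s), G, ?_⟩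
  refine ⟨hc1.trans hc3, hG, hinj, fun x => by simp only [hinj]; ring, ?_, ?_, ?_, ?_⟩
  · intro x y
    refine le_trans ?_ (hlo x y)
    exact div_le_div_of_nonneg_left (sq_nonneg _) (by linarith) (by linarith)
  · intro x y
    exact (hhi x y).trans (mul_le_mul_of_nonneg_right (by linarith) (sq_nonneg _))
  · intro s t
    simp only [hid]
    refine le_trans ?_ (hlo (G t) (G s))
    rw [div_le_div_iff₀ (by positivity) (by linarith)]
    have := mul_le_mul_of_nonneg_right (hGs s t).1 (by linarith : 0 ≤ 2 * c)
    refine this.trans_eq (by ring)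
  · intro s t
    simp only [hid]
    refine (hhi (G t) (G s)).trans ?_
    have := mul_le_mul_of_nonneg_left (hGs s t).2 (by linarith : 0 ≤ c / 2)
    refine this.trans_eq (by ring)

end IsCurve

/-! ### The additive character and the Fresnel integral -/

/-- The additive character `e(x) = exp(2πix)`. -/
noncomputable def expTau (x : ℝ) : ℂ := Complex.exp (2 * Real.pi * x * Complex.I)

theorem norm_expTau (x : ℝ) : ‖expTau x‖ = 1 := by
  rw [expTau, show (2 * Real.pi * x * Complex.I : ℂ) = ((2 * Real.pi * x : ℝ) : ℂ) * Complex.I by push_cast; ring]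
  exact Complex.norm_exp_ofReal_mul_I _

theorem expTau_add (x y : ℝ) : expTau (x + y) = expTau x * expTau y := by
  rw [expTau, expTau, expTau, ← Complex.exp_add]; push_cast; ring_nf

theorem expTau_int (n : ℤ) : expTau n = 1 := by
  rw [expTau, Complex.exp_eq_one_iff]
  exact ⟨n, by push_cast; ring⟩

theorem continuous_expTau : Continuous expTau := by
  unfold expTau; fun_prop

theorem hasDerivAt_expTau (x : ℝ) : HasDerivAt expTau (2 * Real.pi * Complex.I * expTau x) x := by
  have h1 : HasDerivAt (fun x : ℝ => (2 * Real.pi * x * Complex.I : ℂ)) (2 * Real.pi * Complex.I) x := by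
    have := ((hasDerivAt_id x).ofReal_comp.const_mul (2 * Real.pi : ℂ)).mul_const Complex.I
    exact this.congr_deriv (by simp)
  exact h1.cexp.congr_deriv (by rw [expTau]; ring)

theorem HasDerivAt.expTau_comp {φ : ℝ → ℝ} {φ' x : ℝ} (h : HasDerivAt φ φ' x) :
    HasDerivAt (fun y => expTau (φ y)) (2 * Real.pi * Complex.I * φ' * expTau (φ x)) x := by
  have := (hasDerivAt_expTau (φ x)).scomp x h
  exact this.congr_deriv (by rw [Complex.real_smul]; ring)

theorem norm_two_pi_I : ‖(2 * Real.pi * Complex.I : ℂ)‖ = 2 * Real.pi := by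
  simp [abs_of_pos Real.pi_pos]

section Fresnel

/-- Integration by parts against `expTau (u ^ 2) / u`: the boundary terms and the integral of `u⁻²`
together give `2 / R`, and the factor `4π` leaves room to spare. -/
theorem norm_integral_expTau_sq_le {R S : ℝ} (hR : 0 < R) (hRS : R ≤ S) :
    ‖∫ u in R..S, expTau (u ^ 2)‖ ≤ 1 / R := by
  have hpos : ∀ u ∈ Set.uIcc R S, 0 < u := by
    intro u hu; rw [Set.uIcc_of_le hRS] at hu; exact hR.trans_le hu.1
  have hd : ∀ u ∈ Set.uIcc R S, HasDerivAt (fun u : ℝ => expTau (u ^ 2) * ((u⁻¹ : ℝ) : ℂ))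
      (4 * Real.pi * Complex.I * expTau (u ^ 2) - expTau (u ^ 2) * ((u ^ 2)⁻¹ : ℝ)) u := by
    intro u hu
    have hu0 := (hpos u hu).ne'
    have h1 := (hasDerivAt_pow 2 u).expTau_comp
    have h2 := (hasDerivAt_inv hu0).ofReal_comp
    refine (h1.mul h2).congr_deriv ?_
    have : (u : ℂ) ≠ 0 := by exact_mod_cast hu0
    push_cast
    field_simp
    ring
  have hc1 : ContinuousOn (fun u : ℝ => expTau (u ^ 2)) (Set.uIcc R S) :=
    (continuous_expTau.comp (continuous_pow 2)).continuousOn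
  have hc2 : ContinuousOn (fun u : ℝ => expTau (u ^ 2) * ((u ^ 2)⁻¹ : ℝ)) (Set.uIcc R S) := by
    refine hc1.mul (Complex.continuous_ofReal.comp_continuousOn ?_)
    exact (continuousOn_pow 2).inv₀ fun u hu => pow_ne_zero _ (hpos u hu).ne'
  have hFTC := intervalIntegral.integral_eq_sub_of_hasDerivAt hd
    ((hc1.intervalIntegrable.const_mul _).sub hc2.intervalIntegrable)
  rw [intervalIntegral.integral_sub (hc1.intervalIntegrable.const_mul _) hc2.intervalIntegrable,
    intervalIntegral.integral_const_mul] at hFTC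
  have hS : 0 < S := hR.trans_le hRS
  have hb : ‖∫ u in R..S, expTau (u ^ 2) * ((u ^ 2)⁻¹ : ℝ)‖ ≤ 1 / R - 1 / S := by
    have hd2 : ∀ u ∈ Set.uIcc R S, HasDerivAt (fun u : ℝ => -u⁻¹) ((u ^ 2)⁻¹) u := by
      intro u hu
      exact (hasDerivAt_inv (hpos u hu).ne').neg.congr_deriv (by ring)
    have hi2 : IntervalIntegrable (fun u : ℝ => (u ^ 2)⁻¹) MeasureTheory.volume R S :=
      ((continuousOn_pow 2).inv₀ fun u hu => pow_ne_zero _ (hpos u hu).ne').intervalIntegrable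
    have h3 := intervalIntegral.integral_eq_sub_of_hasDerivAt hd2 hi2
    refine (intervalIntegral.norm_integral_le_of_norm_le hRS (g := fun u => (u ^ 2)⁻¹) ?_ hi2).trans_eq ?_
    · refine Filter.Eventually.of_forall fun u hu => ?_
      rw [norm_mul, norm_expTau, one_mul, Complex.norm_real, Real.norm_of_nonneg (by positivity)]
    · rw [h3]; ring
  have hval : (4 * Real.pi * Complex.I : ℂ) * ∫ u in R..S, expTau (u ^ 2) =
      expTau (S ^ 2) * ((S⁻¹ : ℝ) : ℂ) - expTau (R ^ 2) * ((R⁻¹ : ℝ) : ℂ) +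
        ∫ u in R..S, expTau (u ^ 2) * ((u ^ 2)⁻¹ : ℝ) := by
    rw [← hFTC]; ring
  have hn := congrArg norm hval
  rw [norm_mul] at hn
  have h4 : ‖(4 * Real.pi * Complex.I : ℂ)‖ = 4 * Real.pi := by simp [abs_of_pos Real.pi_pos]
  rw [h4] at hn
  have h5 : ‖expTau (S ^ 2) * ((S⁻¹ : ℝ) : ℂ) - expTau (R ^ 2) * ((R⁻¹ : ℝ) : ℂ)‖ ≤ 1 / S + 1 / R := by
    refine (norm_sub_le _ _).trans ?_
    rw [norm_mul, norm_mul, norm_expTau, norm_expTau, Complex.norm_real, Complex.norm_real,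
      Real.norm_of_nonneg (by positivity), Real.norm_of_nonneg (by positivity)]
    simp
  have h6 := (norm_add_le _ _).trans (add_le_add h5 hb)
  rw [← hn] at h6
  have hpi := Real.pi_gt_three
  have : 0 ≤ ‖∫ u in R..S, expTau (u ^ 2)‖ := norm_nonneg _
  have : 1 / S + 1 / R + (1 / R - 1 / S) = 2 * (1 / R) := by ring
  nlinarith [one_div_pos.2 hR]

/-- The incomplete Fresnel integral. -/
noncomputable def fresnel (R : ℝ) : ℂ := ∫ u in (0:ℝ)..R, expTau (u ^ 2)

theorem hasDerivAt_fresnel (R : ℝ) : HasDerivAt fresnel (expTau (R ^ 2)) R :=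
  (continuous_expTau.comp (continuous_pow 2)).integral_hasStrictDerivAt 0 R |>.hasDerivAt

/-- `Γ` is the improper Fresnel integral. Only its existence and the rate of convergence matter, so
it is never evaluated. -/
theorem exists_fresnel_limit : ∃ Γ : ℂ, ∀ R : ℝ, 0 < R → ‖fresnel R - Γ‖ ≤ 1 / R := by
  have hc : Continuous fun u : ℝ => expTau (u ^ 2) := continuous_expTau.comp (continuous_pow 2)
  have hsub : ∀ R S : ℝ, 0 < R → R ≤ S → ‖fresnel R - fresnel S‖ ≤ 1 / R := by
    intro R S hR hRS
    rw [fresnel, fresnel, norm_sub_rev, intervalIntegral.integral_interval_sub_left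
      (hc.intervalIntegrable _ _) (hc.intervalIntegrable _ _)]
    exact norm_integral_expTau_sq_le hR hRS
  have hcau : CauchySeq fun n : ℕ => fresnel ((n : ℝ) + 1) := by
    refine cauchySeq_of_le_tendsto_0 (fun n : ℕ => 2 * (1 / ((n : ℝ) + 1))) ?_ ?_
    · intro n k N hn hk
      have key : ∀ n : ℕ, N ≤ n → dist (fresnel ((n : ℝ) + 1)) (fresnel ((N : ℝ) + 1)) ≤ 1 / ((N : ℝ) + 1) := by
        intro n hn
        rw [dist_comm, dist_eq_norm]
        refine hsub _ _ (by positivity) ?_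
        have : (N : ℝ) ≤ n := by exact_mod_cast hn
        linarith
      have := dist_triangle_right (fresnel ((n : ℝ) + 1)) (fresnel ((k : ℝ) + 1)) (fresnel ((N : ℝ) + 1))
      linarith [key n hn, key k hk]
    · simpa using tendsto_one_div_add_atTop_nhds_zero_nat.const_mul (2:ℝ)
  obtain ⟨Γ, hΓ⟩ := cauchySeq_tendsto_of_complete hcau
  refine ⟨Γ, fun R hR => ?_⟩
  refine le_of_tendsto (tendsto_const_nhds.sub hΓ).norm ?_
  obtain ⟨N, hN⟩ := exists_nat_ge R
  filter_upwards [Filter.eventually_ge_atTop N] with n hn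
  refine hsub R _ hR ?_
  have : (N : ℝ) ≤ n := by exact_mod_cast hn
  linarith

end Fresnel

/-! ### Stationary phase -/

namespace IsCurve

variable {m M L θ : ℝ} {ψ ψ₁ ψ₂ : ℝ → ℝ}

/-- An oscillatory integral whose amplitude vanishes at the stationary point. -/
theorem norm_integral_le_of_vanishing (h : IsCurve m M L θ ψ ψ₁ ψ₂) (h1 : ψ₁ 0 = 0) {α E lam Y : ℝ}
    (hα0 : 0 < α) (hα1 : α < 1) (hE : 0 ≤ E) (hlam : 0 < lam) (hY : 0 ≤ Y) {w w' : ℝ → ℝ}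
    (hw : ∀ y, 0 < y → HasDerivAt w (w' y) y) (hw'c : ContinuousOn w' (Set.Ioi 0))
    (hwE : ∀ y, 0 < y → y ≤ Y → |w y| ≤ E * y ^ α)
    (hwE' : ∀ y, 0 < y → y ≤ Y → |w' y| ≤ E * y ^ (α - 1)) :
    ‖∫ y in (0:ℝ)..Y, expTau (lam * ψ y) * (w y : ℂ)‖ ≤
      (1 + 2 / m + (1 / m + M / m ^ 2) / (1 - α)) * E * lam ^ (-(1 + α) / 2) := by
  have hm := h.pos
  have hM : 0 < M := hm.trans_le h.le_max
  -- `ρ` is the width of the stationary region. Up to `ρ` the integral is bounded trivially by `E *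
  -- ρ ^ (1 + α)`, and beyond it one integration by parts against `w / ψ₁` gives `E * ρ ^ (α - 1) /
  -- lam`, which has the same order. The condition `α < 1` makes `y ^ (α - 2)` integrable at
  -- infinity with the right size.
  set ρ := lam ^ (-(1 / 2) : ℝ) with hρ
  have hρ0 : 0 < ρ := Real.rpow_pos_of_pos hlam _
  have hρα : ρ ^ α * ρ = lam ^ (-(1 + α) / 2) := by
    rw [hρ, ← Real.rpow_mul hlam.le, ← Real.rpow_add hlam]; congr 1; ring
  have hρα' : ρ ^ (α - 1) = lam * lam ^ (-(1 + α) / 2) := by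
    rw [hρ, ← Real.rpow_mul hlam.le]
    nth_rewrite 2 [← Real.rpow_one lam]
    rw [← Real.rpow_add hlam]; congr 1; ring
  set Λ := lam ^ (-(1 + α) / 2) with hΛ
  have hΛ0 : 0 < Λ := Real.rpow_pos_of_pos hlam _
  have hK0 : 0 ≤ 2 / m + (1 / m + M / m ^ 2) / (1 - α) := by
    have : 0 < 1 - α := by linarith
    positivity
  have near : ∀ Z, 0 ≤ Z → Z ≤ ρ → Z ≤ Y → ‖∫ y in (0:ℝ)..Z, expTau (lam * ψ y) * (w y : ℂ)‖ ≤ E * Λ := by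
    intro Z hZ hZρ hZY
    refine (intervalIntegral.norm_integral_le_of_norm_le_const (C := E * ρ ^ α) ?_).trans ?_
    · intro y hy
      rw [Set.uIoc_of_le hZ] at hy
      rw [norm_mul, norm_expTau, one_mul, Complex.norm_real, Real.norm_eq_abs]
      refine (hwE y hy.1 (hy.2.trans hZY)).trans (mul_le_mul_of_nonneg_left ?_ hE)
      exact Real.rpow_le_rpow hy.1.le (hy.2.trans hZρ) hα0.le
    · rw [sub_zero, abs_of_nonneg hZ, ← hρα, ← mul_assoc]
      exact mul_le_mul_of_nonneg_left hZρ (by positivity)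
  rcases le_or_gt Y ρ with hYρ | hYρ
  · refine (near Y hY hYρ le_rfl).trans ?_
    have : 0 ≤ (2 / m + (1 / m + M / m ^ 2) / (1 - α)) * (E * Λ) := by positivity
    linarith
  -- the part away from the stationary point
  have hpsi : ∀ y, 0 < y → m * y ≤ ψ₁ y := by
    intro y hy
    have := (h.deriv_bounds hy.le).1
    rw [h1] at this; linarith
  have hpsi0 : ∀ y, 0 < y → 0 < ψ₁ y := fun y hy => (mul_pos hm hy).trans_le (hpsi y hy)
  have hwc : ContinuousOn w (Set.Ioi 0) := fun y hy => (hw y hy).continuousAt.continuousWithinAt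
  have hψc : Continuous ψ := continuous_iff_continuousAt.2 fun y => (h.hasDerivAt y).continuousAt
  have hψ₁c : Continuous ψ₁ := continuous_iff_continuousAt.2 fun y => (h.hasDerivAt₁ y).continuousAt
  have hec : Continuous fun y => expTau (lam * ψ y) := continuous_expTau.comp (continuous_const.mul hψc)
  have hsubI : Set.uIcc ρ Y ⊆ Set.Ioi 0 := by
    rw [Set.uIcc_of_le hYρ.le]; intro y hy; exact hρ0.trans_le hy.1
  set D : ℝ → ℝ := fun y => (w' y * ψ₁ y - w y * ψ₂ y) / ψ₁ y ^ 2 with hD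
  have hDc : ContinuousOn D (Set.Ioi 0) :=
    ((hw'c.mul hψ₁c.continuousOn).sub (hwc.mul h.continuous.continuousOn)).div
      (hψ₁c.pow 2).continuousOn fun y hy => pow_ne_zero _ (hpsi0 y hy).ne'
  have hd : ∀ y ∈ Set.uIcc ρ Y, HasDerivAt (fun y => expTau (lam * ψ y) * ((w y / ψ₁ y : ℝ) : ℂ))
      (2 * Real.pi * Complex.I * lam * (expTau (lam * ψ y) * w y) + expTau (lam * ψ y) * (D y : ℝ)) y := by
    intro y hy
    have hy0 : 0 < y := hsubI hy
    have e1 := ((h.hasDerivAt y).const_mul lam).expTau_comp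
    have e2 := ((hw y hy0).div (h.hasDerivAt₁ y) (hpsi0 y hy0).ne').ofReal_comp
    refine (e1.mul e2).congr_deriv ?_
    have : (ψ₁ y : ℂ) ≠ 0 := by exact_mod_cast (hpsi0 y hy0).ne'
    rw [hD, Pi.div_apply]
    push_cast
    field_simp
  have hi1 : IntervalIntegrable (fun y => expTau (lam * ψ y) * (w y : ℂ)) MeasureTheory.volume ρ Y :=
    (hec.continuousOn.mul (Complex.continuous_ofReal.comp_continuousOn (hwc.mono hsubI))).intervalIntegrable
  have hi2 : IntervalIntegrable (fun y => expTau (lam * ψ y) * (D y : ℂ)) MeasureTheory.volume ρ Y :=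
    (hec.continuousOn.mul (Complex.continuous_ofReal.comp_continuousOn (hDc.mono hsubI))).intervalIntegrable
  have hFTC := intervalIntegral.integral_eq_sub_of_hasDerivAt hd ((hi1.const_mul _).add hi2)
  rw [intervalIntegral.integral_add (hi1.const_mul _) hi2, intervalIntegral.integral_const_mul] at hFTC
  have hDb : ∀ y, ρ < y → y ≤ Y → |D y| ≤ E * (1 / m + M / m ^ 2) * y ^ (α - 2) := by
    intro y hy hyY
    have hy0 : 0 < y := hρ0.trans hy
    have hp := hpsi y hy0
    have hp0 := hpsi0 y hy0
    have e0 : D y = w' y / ψ₁ y - w y * ψ₂ y / ψ₁ y ^ 2 := by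
      rw [hD]; simp only; field_simp
    rw [e0]
    refine (abs_sub _ _).trans ?_
    have e1 : |w' y / ψ₁ y| ≤ E * y ^ (α - 1) / (m * y) := by
      rw [abs_div, abs_of_pos hp0]
      exact div_le_div₀ (by positivity) (hwE' y hy0 hyY) (by positivity) hp
    have e2 : |w y * ψ₂ y / ψ₁ y ^ 2| ≤ E * y ^ α * M / (m * y) ^ 2 := by
      rw [abs_div, abs_mul, abs_of_pos (h.pos.trans_le (h.le y)), abs_of_pos (by positivity : 0 < ψ₁ y ^ 2)]
      refine div_le_div₀ (by positivity) ?_ (by positivity) (pow_le_pow_left₀ (by positivity) hp 2)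
      exact mul_le_mul (hwE y hy0 hyY) (h.ge y) (h.pos.trans_le (h.le y)).le (by positivity)
    refine (add_le_add e1 e2).trans_eq ?_
    have r1 : y ^ (α - 1) = y ^ (α - 2) * y := by
      nth_rewrite 3 [← Real.rpow_one y]
      rw [← Real.rpow_add hy0]; congr 1; ring
    have r2 : y ^ α = y ^ (α - 2) * y ^ 2 := by
      rw [← Real.rpow_natCast, ← Real.rpow_add hy0]; congr 1; norm_num
    rw [r1, r2]
    field_simp
  have h0notin : (0 : ℝ) ∉ Set.uIcc ρ Y := fun h0 => lt_irrefl (0 : ℝ) (hsubI h0)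
  have hirpow : IntervalIntegrable (fun y : ℝ => y ^ (α - 2)) MeasureTheory.volume ρ Y :=
    intervalIntegral.intervalIntegrable_rpow (Or.inr h0notin)
  have hDint : ‖∫ y in ρ..Y, expTau (lam * ψ y) * (D y : ℂ)‖ ≤
      E * (1 / m + M / m ^ 2) * (ρ ^ (α - 1) / (1 - α)) := by
    refine (intervalIntegral.norm_integral_le_of_norm_le hYρ.le
      (g := fun y => E * (1 / m + M / m ^ 2) * y ^ (α - 2)) ?_ (hirpow.const_mul _)).trans ?_
    · refine Filter.Eventually.of_forall fun y hy => ?_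
      rw [norm_mul, norm_expTau, one_mul, Complex.norm_real, Real.norm_eq_abs]
      exact hDb y hy.1 hy.2
    · rw [intervalIntegral.integral_const_mul, integral_rpow (Or.inr ⟨by linarith, h0notin⟩)]
      refine mul_le_mul_of_nonneg_left ?_ (by positivity)
      have e1 : α - 2 + 1 = α - 1 := by ring
      rw [e1, show (Y ^ (α - 1) - ρ ^ (α - 1)) / (α - 1) = (ρ ^ (α - 1) - Y ^ (α - 1)) / (1 - α) by
        rw [← neg_div_neg_eq]; ring_nf]
      have : 0 ≤ Y ^ (α - 1) := Real.rpow_nonneg hY _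
      exact div_le_div_of_nonneg_right (by linarith) (by linarith)
  have hbd : ∀ y, ρ ≤ y → y ≤ Y → ‖expTau (lam * ψ y) * ((w y / ψ₁ y : ℝ) : ℂ)‖ ≤ E / m * ρ ^ (α - 1) := by
    intro y hy hyY
    have hy0 : 0 < y := hρ0.trans_le hy
    rw [norm_mul, norm_expTau, one_mul, Complex.norm_real, Real.norm_eq_abs, abs_div, abs_of_pos (hpsi0 y hy0)]
    refine (div_le_div₀ (by positivity) (hwE y hy0 hyY) (by positivity) (hpsi y hy0)).trans ?_
    have r1 : y ^ α = y ^ (α - 1) * y := by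
      nth_rewrite 3 [← Real.rpow_one y]
      rw [← Real.rpow_add hy0]; congr 1; ring
    rw [r1, show E * (y ^ (α - 1) * y) / (m * y) = E / m * y ^ (α - 1) by field_simp]
    exact mul_le_mul_of_nonneg_left (Real.rpow_le_rpow_of_nonpos hρ0 hy (by linarith)) (by positivity)
  have hfar : ‖∫ y in ρ..Y, expTau (lam * ψ y) * (w y : ℂ)‖ ≤
      (2 / m + (1 / m + M / m ^ 2) / (1 - α)) * E * Λ := by
    have hval := eq_sub_of_add_eq hFTC
    have hn := congrArg norm hval
    have hlam' : ‖(2 * Real.pi * Complex.I * lam : ℂ)‖ = 2 * Real.pi * lam := by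
      rw [norm_mul, norm_two_pi_I, Complex.norm_real, Real.norm_of_nonneg hlam.le]
    rw [norm_mul, hlam'] at hn
    have hle := (norm_sub_le _ _).trans (add_le_add ((norm_sub_le _ _).trans
      (add_le_add (hbd Y hYρ.le le_rfl) (hbd ρ le_rfl hYρ.le))) hDint)
    rw [← hn] at hle
    have e2 : E / m * ρ ^ (α - 1) + E / m * ρ ^ (α - 1) + E * (1 / m + M / m ^ 2) * (ρ ^ (α - 1) / (1 - α)) =
        lam * ((2 / m + (1 / m + M / m ^ 2) / (1 - α)) * E * Λ) := by
      rw [hρα']; ring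
    rw [e2] at hle
    have hpi : 1 ≤ 2 * Real.pi := by linarith [Real.pi_gt_three]
    have e3 : lam * ‖∫ y in ρ..Y, expTau (lam * ψ y) * (w y : ℂ)‖ ≤
        2 * Real.pi * lam * ‖∫ y in ρ..Y, expTau (lam * ψ y) * (w y : ℂ)‖ :=
      mul_le_mul_of_nonneg_right (le_mul_of_one_le_left hlam.le hpi) (norm_nonneg _)
    exact le_of_mul_le_mul_left (e3.trans hle) hlam
  have hi0 : IntervalIntegrable (fun y => expTau (lam * ψ y) * (w y : ℂ)) MeasureTheory.volume 0 ρ := by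
    rw [intervalIntegrable_iff_integrableOn_Ioc_of_le hρ0.le]
    refine ⟨?_, .restrict_of_bounded (C := E * ρ ^ α) (by simp) ?_⟩
    · refine ContinuousOn.aestronglyMeasurable ?_ measurableSet_Ioc
      exact hec.continuousOn.mul (Complex.continuous_ofReal.comp_continuousOn
        (hwc.mono fun y hy => hy.1))
    · refine (MeasureTheory.ae_restrict_iff' measurableSet_Ioc).2 (Filter.Eventually.of_forall fun y hy => ?_)
      rw [norm_mul, norm_expTau, one_mul, Complex.norm_real, Real.norm_eq_abs]
      refine (hwE y hy.1 (hy.2.trans hYρ.le)).trans (mul_le_mul_of_nonneg_left ?_ hE)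
      exact Real.rpow_le_rpow hy.1.le hy.2 hα0.le
  rw [← intervalIntegral.integral_add_adjacent_intervals hi0 hi1]
  refine (norm_add_le _ _).trans ((add_le_add (near ρ hρ0.le le_rfl hYρ.le) hfar).trans_eq ?_)
  ring

end IsCurve

/-- For amplitudes such as `ψ₁ / (2√ψ)`, which have no usable formula at `0`, boundedness replaces
continuity at that end point. -/
theorem intervalIntegrable_of_continuousOn_Ioi {f : ℝ → ℂ} {Y C : ℝ} (hY : 0 ≤ Y)
    (hf : ContinuousOn f (Set.Ioi 0)) (hC : ∀ y, 0 < y → y ≤ Y → ‖f y‖ ≤ C) :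
    IntervalIntegrable f MeasureTheory.volume 0 Y := by
  rw [intervalIntegrable_iff_integrableOn_Ioc_of_le hY]
  refine ⟨?_, .restrict_of_bounded (C := C) (by simp) ?_⟩
  · exact (hf.mono fun y hy => hy.1).aestronglyMeasurable measurableSet_Ioc
  · exact (MeasureTheory.ae_restrict_iff' measurableSet_Ioc).2
      (Filter.Eventually.of_forall fun y hy => hC y hy.1 hy.2)

namespace IsCurve

variable {m M L θ : ℝ} {ψ ψ₁ ψ₂ : ℝ → ℝ}

theorem holder_at_zero (h : IsCurve m M L θ ψ ψ₁ ψ₂) (hL : 0 ≤ L) (hθ : 0 < θ) {z y : ℝ} (hz : 0 ≤ z)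
    (hzy : z ≤ y) : |ψ₂ z - ψ₂ 0| ≤ L * y ^ θ := by
  refine (h.holder z 0).trans (mul_le_mul_of_nonneg_left ?_ hL)
  rw [sub_zero, abs_of_nonneg hz]
  exact Real.rpow_le_rpow hz hzy hθ.le

/-- The derivative of `√ψ` is Hölder close to its value at the stationary point. -/
theorem comparison_sq_le (h : IsCurve m M L θ ψ ψ₁ ψ₂) (h0 : ψ 0 = 0) (h1 : ψ₁ 0 = 0)
    (hL : 0 ≤ L) (hθ : 0 < θ) {y : ℝ} (hy : 0 < y) :
    |1 - 2 / ψ₂ 0 * (ψ₁ y ^ 2 / (4 * ψ y))| ≤ 4 * M * L / m ^ 2 * y ^ θ := by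
  have hm := h.pos
  have hM : 0 < M := hm.trans_le h.le_max
  have hloc := fun z hz hzy => h.holder_at_zero hL hθ (z := z) (y := y) hz hzy
  set k := ψ₂ 0 with hk
  have hkm : m ≤ k := h.le 0
  have hkM : k ≤ M := h.ge 0
  have hk0 : 0 < k := hm.trans_le hkm
  have hyθ : 0 ≤ y ^ θ := Real.rpow_nonneg hy.le _
  obtain ⟨p1, p2⟩ := h.deriv_bounds hy.le
  obtain ⟨b1, b2⟩ := h.bounds_of_nonneg hy.le
  simp only [h0, h1, sub_zero, zero_mul] at p1 p2 b1 b2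
  set δ := L * y ^ θ with hδ
  have hδ0 : 0 ≤ δ := by positivity
  have t1 : ∀ z, 0 ≤ z → z ≤ y → |ψ₁ z - k * z| ≤ δ * z := by
    intro z hz hzy
    have := (convex_Icc (0:ℝ) z).norm_image_sub_le_of_norm_hasDerivWithin_le
      (f := fun t => ψ₁ t - k * t) (f' := fun t => ψ₂ t - k) (C := δ)
      (fun t _ => by
        have := (h.hasDerivAt₁ t).sub ((hasDerivAt_id t).const_mul k)
        exact (this.congr_deriv (by ring)).hasDerivWithinAt)
      (fun t ht => hloc t ht.1 (ht.2.trans hzy)) (Set.left_mem_Icc.2 hz) (Set.right_mem_Icc.2 hz)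
    simpa [h1, abs_of_nonneg hz] using this
  have t2 : |ψ y - k / 2 * y ^ 2| ≤ δ * y * y := by
    have := (convex_Icc (0:ℝ) y).norm_image_sub_le_of_norm_hasDerivWithin_le
      (f := fun t => ψ t - k / 2 * t ^ 2) (f' := fun t => ψ₁ t - k * t) (C := δ * y)
      (fun t _ => by
        have := (h.hasDerivAt t).sub ((hasDerivAt_pow 2 t).const_mul (k / 2))
        exact (this.congr_deriv (by push_cast; ring)).hasDerivWithinAt)
      (fun t ht => (t1 t ht.1 ht.2).trans (mul_le_mul_of_nonneg_left ht.2 hδ0))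
      (Set.left_mem_Icc.2 hy.le) (Set.right_mem_Icc.2 hy.le)
    simpa [h0, abs_of_nonneg hy.le] using this
  have hψ0 : 0 < ψ y := lt_of_lt_of_le (by positivity) b1
  -- For the exact quadratic `k / 2 * y ^ 2` this quantity is zero. The numerator is arranged so
  -- that it is controlled by the two Taylor errors `t1` and `t2`.
  have e1 : 1 - 2 / k * (ψ₁ y ^ 2 / (4 * ψ y)) =
      (2 * k * (ψ y - k / 2 * y ^ 2) - (ψ₁ y - k * y) * (ψ₁ y + k * y)) / (2 * k * ψ y) := by
    field_simp; ring
  rw [e1, abs_div, abs_of_pos (by positivity : 0 < 2 * k * ψ y), div_le_iff₀ (by positivity)]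
  have e2 : |2 * k * (ψ y - k / 2 * y ^ 2) - (ψ₁ y - k * y) * (ψ₁ y + k * y)| ≤
      2 * M * (δ * y * y) + δ * y * (2 * M * y) := by
    refine (abs_sub _ _).trans (add_le_add ?_ ?_)
    · rw [abs_mul, abs_of_pos (by positivity : 0 < 2 * k)]
      exact mul_le_mul (by linarith) t2 (abs_nonneg _) (by positivity)
    · rw [abs_mul]
      refine mul_le_mul (t1 y hy.le le_rfl) ?_ (abs_nonneg _) (by positivity)
      have : k * y ≤ M * y := mul_le_mul_of_nonneg_right hkM hy.le
      have : 0 ≤ k * y := by positivity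
      have : 0 ≤ ψ₁ y := le_trans (by positivity) p1
      rw [abs_of_nonneg (by linarith)]
      linarith
  refine e2.trans ?_
  have e3 : m ^ 2 * y ^ 2 ≤ 2 * k * ψ y := by
    have : m * (m * y ^ 2) ≤ k * (2 * ψ y) := mul_le_mul hkm (by linarith) (by positivity) hk0.le
    linarith
  have e4 := mul_le_mul_of_nonneg_left e3 (by positivity : 0 ≤ 4 * M * L / m ^ 2 * y ^ θ)
  refine le_trans (le_of_eq ?_) e4
  rw [hδ]; field_simp; ring

/-- With `v = (√ψ)'` the integral of `expTau (lam * ψ) * v` is exactly a Fresnel integral. The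
constant `b = √(2 / ψ₂ 0)` makes `b * v` tend to `1` at the stationary point, and Hölder continuity
of `ψ₂` gives `1 - b * v = O(y^θ)` with derivative `O(y^(θ-1))`. The remaining integral thus has a
vanishing amplitude and is `O(lam^(-(1+θ)/2))`. -/
theorem exists_half_stationary_phase {m M L θ : ℝ} (hm : 0 < m) (hmM : m ≤ M) (hL : 0 ≤ L) (hθ : 0 < θ)
    (hθ1 : θ < 1) : ∃ C : ℝ, 0 < C ∧ ∃ Γ : ℂ, ∀ ψ ψ₁ ψ₂ : ℝ → ℝ, IsCurve m M L θ ψ ψ₁ ψ₂ → ψ 0 = 0 →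
      ψ₁ 0 = 0 → ∀ lam Y : ℝ, 1 ≤ lam → 1 ≤ Y →
      ‖(∫ y in (0:ℝ)..Y, expTau (lam * ψ y)) - (Real.sqrt (2 / ψ₂ 0) * lam ^ (-(1 / 2) : ℝ) : ℝ) * Γ‖ ≤
        C * lam ^ (-(1 + θ) / 2) := by
  obtain ⟨Γ, hΓ⟩ := exists_fresnel_limit
  have hM : 0 < M := hm.trans_le hmM
  have h1θ : 0 < 1 - θ := by linarith
  set E₀ := 4 * M * L / m ^ 2 with hE₀
  set E := E₀ + (L + M * E₀) / m with hE
  have hE₀0 : 0 ≤ E₀ := by positivity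
  have hEpos : 0 ≤ E := by positivity
  refine ⟨(1 + 2 / m + (1 / m + M / m ^ 2) / (1 - θ)) * E + 2 / m, by positivity, Γ, ?_⟩
  intro ψ ψ₁ ψ₂ h h0 h1 lam Y hlam hY
  have hlam0 : 0 < lam := by linarith
  have hY0 : 0 ≤ Y := by linarith
  have hcmp := fun y hy => h.comparison_sq_le h0 h1 hL hθ (y := y) hy
  have hloc := fun y hy => h.holder_at_zero hL hθ (z := y) (y := y) hy le_rfl
  set k := ψ₂ 0 with hk
  have hkm : m ≤ k := h.le 0
  have hkM : k ≤ M := h.ge 0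
  have hk0 : 0 < k := hm.trans_le hkm
  have hψlo : ∀ y, 0 ≤ y → m / 2 * y ^ 2 ≤ ψ y := by
    intro y hy
    have := (h.bounds_of_nonneg hy).1
    simpa [h0, h1] using this
  have hψ0 : ∀ y, 0 < y → 0 < ψ y := fun y hy => lt_of_lt_of_le (by positivity) (hψlo y hy.le)
  have hψ₁0 : ∀ y, 0 < y → 0 ≤ ψ₁ y := by
    intro y hy
    have := (h.deriv_bounds hy.le).1
    rw [h1] at this
    have : 0 ≤ m * (y - 0) := mul_nonneg hm.le (by linarith)
    linarith
  set b := Real.sqrt (2 / k) with hb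
  have hb0 : 0 < b := Real.sqrt_pos.2 (by positivity)
  have hbsq : b ^ 2 = 2 / k := Real.sq_sqrt (by positivity)
  set v : ℝ → ℝ := fun y => ψ₁ y / (2 * Real.sqrt (ψ y)) with hv
  have hv0 : ∀ y, 0 < y → 0 ≤ v y := fun y hy => div_nonneg (hψ₁0 y hy) (by positivity)
  have hvsq : ∀ y, 0 < y → v y ^ 2 = ψ₁ y ^ 2 / (4 * ψ y) := by
    intro y hy
    rw [hv]; simp only
    rw [div_pow, mul_pow, Real.sq_sqrt (hψ0 y hy).le]; norm_num
  have hw1 : ∀ y, 0 < y → |1 - b ^ 2 * v y ^ 2| ≤ E₀ * y ^ θ := by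
    intro y hy
    rw [hbsq, hvsq y hy]
    exact hcmp y hy
  have hsqrt : ∀ y, 0 < y → Real.sqrt (m / 2) * y ≤ Real.sqrt (ψ y) := by
    intro y hy
    rw [← Real.sqrt_sq hy.le, ← Real.sqrt_mul (by positivity), Real.sqrt_sq hy.le]
    exact Real.sqrt_le_sqrt (hψlo y hy.le)
  have hψc : Continuous ψ := continuous_iff_continuousAt.2 fun y => (h.hasDerivAt y).continuousAt
  have hψ₁c : Continuous ψ₁ := continuous_iff_continuousAt.2 fun y => (h.hasDerivAt₁ y).continuousAt
  have hec : Continuous fun y => expTau (lam * ψ y) := continuous_expTau.comp (continuous_const.mul hψc)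
  have hsq_ne : ∀ y, 0 < y → Real.sqrt (ψ y) ≠ 0 := fun y hy => (Real.sqrt_pos.2 (hψ0 y hy)).ne'
  have hvc : ContinuousOn v (Set.Ioi 0) := by
    refine hψ₁c.continuousOn.div (by fun_prop) fun y hy => ?_
    exact mul_ne_zero two_ne_zero (hsq_ne y hy)
  set v' : ℝ → ℝ := fun y => (ψ₂ y - 2 * v y ^ 2) / (2 * Real.sqrt (ψ y)) with hv'
  have hsd : ∀ y, 0 < y → HasDerivAt (fun y => Real.sqrt (ψ y)) (v y) y := fun y hy =>
    (h.hasDerivAt y).sqrt (hψ0 y hy).ne'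
  have hvd : ∀ y, 0 < y → HasDerivAt v (v' y) y := by
    intro y hy
    have e := (h.hasDerivAt₁ y).div ((hsd y hy).const_mul 2) (mul_ne_zero two_ne_zero (hsq_ne y hy))
    refine e.congr_deriv ?_
    have h3 : ψ₁ y = v y * (2 * Real.sqrt (ψ y)) := by
      rw [hv]; simp only
      have := hsq_ne y hy
      field_simp
    rw [hv', h3]
    have := hsq_ne y hy
    field_simp
  have hv'c : ContinuousOn v' (Set.Ioi 0) := by
    refine (h.continuous.continuousOn.sub ((hvc.pow 2).const_mul 2)).div (by fun_prop) fun y hy => ?_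
    exact mul_ne_zero two_ne_zero (hsq_ne y hy)
  have hwE0 : ∀ y, 0 < y → |1 - b * v y| ≤ E₀ * y ^ θ := by
    intro y hy
    refine le_trans ?_ (hw1 y hy)
    have e : 1 - b ^ 2 * v y ^ 2 = (1 - b * v y) * (1 + b * v y) := by ring
    have : 0 ≤ b * v y := mul_nonneg hb0.le (hv0 y hy)
    rw [e, abs_mul]
    exact le_mul_of_one_le_right (abs_nonneg _) (by rw [abs_of_nonneg (by linarith)]; linarith)
  have hmain := h.norm_integral_le_of_vanishing h1 (E := E) hθ hθ1 hEpos hlam0 hY0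
    (w := fun y => 1 - b * v y) (w' := fun y => -(b * v' y))
    (fun y hy => (((hvd y hy).const_mul b).const_sub 1))
    ((hv'c.const_mul b).neg) (fun y hy _ => by
      refine (hwE0 y hy).trans (mul_le_mul_of_nonneg_right ?_ (Real.rpow_nonneg hy.le _))
      rw [hE]
      have : 0 ≤ (L + M * E₀) / m := by positivity
      linarith) (fun y hy _ => by
      have hyθ : 0 ≤ y ^ θ := Real.rpow_nonneg hy.le _
      have e1 : |ψ₂ y - 2 * v y ^ 2| ≤ (L + M * E₀) * y ^ θ := by
        -- The numerator of `v'` is split at the limiting value `k`. Both parts are `O(y^θ)`,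
        -- although `ψ₂` need not be differentiable.
        have : ψ₂ y - 2 * v y ^ 2 = (ψ₂ y - k) + k * (1 - b ^ 2 * v y ^ 2) := by
          rw [hbsq]; field_simp; ring
        rw [this]
        refine (abs_add_le _ _).trans ?_
        rw [abs_mul, abs_of_pos hk0, add_mul, mul_assoc M]
        exact add_le_add (hloc y hy.le) (mul_le_mul hkM (hw1 y hy) (abs_nonneg _) hM.le)
      have e2 : b ≤ Real.sqrt (2 / m) := Real.sqrt_le_sqrt (div_le_div_of_nonneg_left (by norm_num) hm hkm)
      rw [abs_neg, abs_mul, abs_of_pos hb0, hv', abs_div,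
        abs_of_pos (by have := Real.sqrt_pos.2 (hψ0 y hy); positivity : 0 < 2 * Real.sqrt (ψ y))]
      have e3 : |ψ₂ y - 2 * v y ^ 2| / (2 * Real.sqrt (ψ y)) ≤
          (L + M * E₀) * y ^ θ / (2 * (Real.sqrt (m / 2) * y)) := by
        have : 0 < Real.sqrt (m / 2) := Real.sqrt_pos.2 (by positivity)
        refine div_le_div₀ (by positivity) e1 (by positivity) ?_
        linarith [hsqrt y hy]
      refine (mul_le_mul e2 e3 (by positivity) (Real.sqrt_nonneg _)).trans ?_
      have e4 : Real.sqrt (2 / m) * Real.sqrt (m / 2) = 1 := by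
        rw [← Real.sqrt_mul (by positivity)]
        rw [show 2 / m * (m / 2) = 1 by field_simp, Real.sqrt_one]
      have e5 : Real.sqrt (m / 2) * Real.sqrt (m / 2) = m / 2 := Real.mul_self_sqrt (by positivity)
      have e6 : 0 < Real.sqrt (m / 2) := Real.sqrt_pos.2 (by positivity)
      have e7 : Real.sqrt (2 / m) = Real.sqrt (m / 2) * (2 / m) := by
        have : Real.sqrt (m / 2) * (Real.sqrt (m / 2) * (2 / m)) = 1 := by
          rw [← mul_assoc, e5]; field_simp
        exact mul_left_cancel₀ e6.ne' (by rw [this, mul_comm, e4])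
      have r1 : y ^ θ = y ^ (θ - 1) * y := by
        nth_rewrite 3 [← Real.rpow_one y]
        rw [← Real.rpow_add hy]; congr 1; ring
      rw [e7, r1]
      have e8 : Real.sqrt (m / 2) * (2 / m) * ((L + M * E₀) * (y ^ (θ - 1) * y) / (2 * (Real.sqrt (m / 2) * y))) =
          (L + M * E₀) / m * y ^ (θ - 1) := by
        field_simp
      rw [e8]
      exact mul_le_mul_of_nonneg_right (by rw [hE]; linarith) (Real.rpow_nonneg hy.le _))
  -- the comparison integral
  have hiv : IntervalIntegrable (fun y => expTau (lam * ψ y) * (v y : ℂ)) MeasureTheory.volume 0 Y := by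
    refine intervalIntegrable_of_continuousOn_Ioi (C := (1 + E₀ * Y ^ θ) / b) hY0
      (hec.continuousOn.mul (Complex.continuous_ofReal.comp_continuousOn hvc)) fun y hy hyY => ?_
    rw [norm_mul, norm_expTau, one_mul, Complex.norm_real, Real.norm_eq_abs, abs_of_nonneg (hv0 y hy),
      le_div_iff₀ hb0]
    have e1 := (abs_le.1 (hwE0 y hy)).1
    have e2 : E₀ * y ^ θ ≤ E₀ * Y ^ θ := mul_le_mul_of_nonneg_left (Real.rpow_le_rpow hy.le hyY hθ.le) hE₀0
    linarith
  set s := lam ^ (-(1 / 2) : ℝ) with hs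
  have hs0 : 0 < s := Real.rpow_pos_of_pos hlam0 _
  have hss : s = (Real.sqrt lam)⁻¹ := by rw [hs, Real.rpow_neg hlam0.le, Real.sqrt_eq_rpow]
  have hsl : 0 < Real.sqrt lam := Real.sqrt_pos.2 hlam0
  have hcomp : ∫ y in (0:ℝ)..Y, expTau (lam * ψ y) * (v y : ℂ) =
      (s : ℂ) * fresnel (Real.sqrt lam * Real.sqrt (ψ Y)) := by
    -- `√ψ` has a corner at `0`, so this form of the fundamental theorem is used, which asks for
    -- derivatives only in the open interval.
    have hFTC := intervalIntegral.integral_eq_sub_of_hasDerivAt_of_le hY0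
      (f := fun y => (s : ℂ) * fresnel (Real.sqrt lam * Real.sqrt (ψ y)))
      (f' := fun y => expTau (lam * ψ y) * (v y : ℂ)) ?_ ?_ hiv
    · rw [hFTC, h0]; simp [fresnel]
    · have hfc : Continuous fresnel := continuous_iff_continuousAt.2 fun R => (hasDerivAt_fresnel R).continuousAt
      exact (continuous_const.mul (hfc.comp (continuous_const.mul hψc.sqrt))).continuousOn
    · intro y hy
      have e1 := (hasDerivAt_fresnel (Real.sqrt lam * Real.sqrt (ψ y))).scomp y ((hsd y hy.1).const_mul (Real.sqrt lam))
      refine (e1.const_mul (s : ℂ)).congr_deriv ?_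
      rw [mul_pow, Real.sq_sqrt hlam0.le, Real.sq_sqrt (hψ0 y hy.1).le, Complex.real_smul, hss]
      have : (Real.sqrt lam : ℂ) ≠ 0 := by exact_mod_cast hsl.ne'
      push_cast
      field_simp
  have hsplit : ∫ y in (0:ℝ)..Y, expTau (lam * ψ y) =
      (∫ y in (0:ℝ)..Y, expTau (lam * ψ y) * ((1 - b * v y : ℝ) : ℂ)) +
        b * ∫ y in (0:ℝ)..Y, expTau (lam * ψ y) * (v y : ℂ) := by
    rw [← intervalIntegral.integral_const_mul, ← intervalIntegral.integral_add]
    · congr 1; ext y; push_cast; ring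
    · have := (hec.intervalIntegrable (μ := MeasureTheory.volume) 0 Y).sub (hiv.const_mul (b : ℂ))
      refine this.congr ?_
      intro y _
      simp only
      push_cast; ring
    · exact hiv.const_mul _
  rw [hsplit, hcomp]
  have hR : 0 < Real.sqrt lam * Real.sqrt (ψ Y) := mul_pos hsl (Real.sqrt_pos.2 (hψ0 Y (by linarith)))
  have hfres := hΓ _ hR
  have hlast : ‖(b : ℂ) * (s * fresnel (Real.sqrt lam * Real.sqrt (ψ Y))) - ((b * s : ℝ) : ℂ) * Γ‖ ≤
      2 / m * lam ^ (-(1 + θ) / 2) := by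
    have e1 : (b : ℂ) * (s * fresnel (Real.sqrt lam * Real.sqrt (ψ Y))) - ((b * s : ℝ) : ℂ) * Γ =
        ((b * s : ℝ) : ℂ) * (fresnel (Real.sqrt lam * Real.sqrt (ψ Y)) - Γ) := by push_cast; ring
    rw [e1, norm_mul, Complex.norm_real, Real.norm_of_nonneg (by positivity)]
    refine (mul_le_mul_of_nonneg_left hfres (by positivity)).trans ?_
    have e2 : Real.sqrt (m / 2) ≤ Real.sqrt (ψ Y) := by
      refine le_trans ?_ (hsqrt Y (by linarith))
      exact le_mul_of_one_le_right (Real.sqrt_nonneg _) hY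
    have e3 : 0 < Real.sqrt (m / 2) := Real.sqrt_pos.2 (by positivity)
    have e4 : b ≤ Real.sqrt (2 / m) := Real.sqrt_le_sqrt (div_le_div_of_nonneg_left (by norm_num) hm hkm)
    have e5 : Real.sqrt (2 / m) = 2 / m * Real.sqrt (m / 2) := by
      rw [← Real.sqrt_sq (by positivity : 0 ≤ 2 / m), ← Real.sqrt_mul (by positivity)]
      congr 1; rw [Real.sqrt_sq (by positivity)]; field_simp
    have e6 : b * s * (1 / (Real.sqrt lam * Real.sqrt (ψ Y))) = b / Real.sqrt (ψ Y) * (s * s) := by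
      rw [hss]; field_simp
    have e7 : s * s = lam ^ (-1 : ℝ) := by rw [hs, ← Real.rpow_add hlam0]; norm_num
    have e8 : b / Real.sqrt (ψ Y) ≤ 2 / m := by
      rw [div_le_iff₀ (e3.trans_le e2)]
      refine e4.trans (e5.le.trans (mul_le_mul_of_nonneg_left e2 (by positivity)))
    rw [e6, e7]
    refine mul_le_mul e8 (Real.rpow_le_rpow_of_exponent_le hlam (by linarith)) (by positivity) (by positivity)
  rw [add_sub_assoc]
  refine (norm_add_le _ _).trans ((add_le_add hmain hlast).trans_eq ?_)
  ring

end IsCurve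

namespace IsCurve

/-- The weight is split as `V 0 + (V - V 0)`. The second part vanishes at the stationary point to
first order, but the bound for vanishing amplitudes requires an order `α < 1`. The Lipschitz bound
`B * y` is therefore weakened to a multiple of `y ^ α` on the bounded range `y ≤ Y`. -/
theorem exists_half_stationary_phase_weighted {m M L θ α Y : ℝ} (hm : 0 < m) (hmM : m ≤ M) (hL : 0 ≤ L)
    (hθ : 0 < θ) (hθ1 : θ < 1) (hα : 0 < α) (hα1 : α < 1) (hY : 1 ≤ Y) :
    ∃ C : ℝ, 0 < C ∧ ∃ Γ : ℂ, ∀ ψ ψ₁ ψ₂ : ℝ → ℝ, IsCurve m M L θ ψ ψ₁ ψ₂ → ψ 0 = 0 → ψ₁ 0 = 0 →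
      ∀ (V V' : ℝ → ℝ) (B : ℝ), (∀ y, HasDerivAt V (V' y) y) → Continuous V' → (∀ y, |V y| ≤ 1) →
      (∀ y, |V' y| ≤ B) → ∀ lam : ℝ, 1 ≤ lam →
      ‖(∫ y in (0:ℝ)..Y, expTau (lam * ψ y) * (V y : ℂ)) -
          (V 0 * (Real.sqrt (2 / ψ₂ 0) * lam ^ (-(1 / 2) : ℝ)) : ℝ) * Γ‖ ≤
        C * (lam ^ (-(1 + θ) / 2) + B * lam ^ (-(1 + α) / 2)) := by
  obtain ⟨C, hC, Γ, H⟩ := exists_half_stationary_phase hm hmM hL hθ hθ1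
  have h1α : 0 < 1 - α := by linarith
  have hM : 0 < M := hm.trans_le hmM
  set D := (1 + 2 / m + (1 / m + M / m ^ 2) / (1 - α)) * Y ^ (1 - α) with hD
  have hD0 : 0 < D := by
    have : 0 < Y ^ (1 - α) := Real.rpow_pos_of_pos (by linarith) _
    positivity
  refine ⟨C + D, by positivity, Γ, ?_⟩
  intro ψ ψ₁ ψ₂ h h0 h1 V V' B hV hV'c hV1 hV'B lam hlam
  have hB : 0 ≤ B := (abs_nonneg _).trans (hV'B 0)
  have hlam0 : 0 < lam := by linarith
  have hVc : Continuous V := continuous_iff_continuousAt.2 fun y => (hV y).continuousAt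
  have hψc : Continuous ψ := continuous_iff_continuousAt.2 fun y => (h.hasDerivAt y).continuousAt
  have hec : Continuous fun y => expTau (lam * ψ y) := continuous_expTau.comp (continuous_const.mul hψc)
  have hlip : ∀ y, 0 < y → |V y - V 0| ≤ B * y := by
    intro y hy
    have := (convex_Icc (0:ℝ) y).norm_image_sub_le_of_norm_hasDerivWithin_le
      (f := V) (f' := V') (C := B) (fun t _ => (hV t).hasDerivWithinAt)
      (fun t _ => hV'B t) (Set.left_mem_Icc.2 hy.le) (Set.right_mem_Icc.2 hy.le)
    simpa [abs_of_pos hy] using this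
  have hYy : ∀ y, 0 < y → y ≤ Y → y ^ (1 - α) ≤ Y ^ (1 - α) := fun y hy hyY =>
    Real.rpow_le_rpow hy.le hyY h1α.le
  have hmain := h.norm_integral_le_of_vanishing h1 (E := B * Y ^ (1 - α)) hα hα1 (by positivity) hlam0
    (by linarith : 0 ≤ Y) (w := fun y => V y - V 0) (w' := V') (fun y _ => (hV y).sub_const _) hV'c.continuousOn
    (fun y hy hyY => by
      refine (hlip y hy).trans ?_
      rw [mul_assoc]
      refine mul_le_mul_of_nonneg_left ?_ hB
      have : y = y ^ (1 - α) * y ^ α := by rw [← Real.rpow_add hy]; simp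
      nth_rewrite 1 [this]
      exact mul_le_mul_of_nonneg_right (hYy y hy hyY) (by positivity))
    (fun y hy hyY => by
      refine (hV'B y).trans ?_
      rw [mul_assoc]
      refine le_mul_of_one_le_right hB ?_
      have : (1 : ℝ) = y ^ (1 - α) * y ^ (α - 1) := by rw [← Real.rpow_add hy]; simp
      exact this.trans_le (mul_le_mul_of_nonneg_right (hYy y hy hyY) (by positivity)))
  have hsplit : ∫ y in (0:ℝ)..Y, expTau (lam * ψ y) * (V y : ℂ) =
      (∫ y in (0:ℝ)..Y, expTau (lam * ψ y) * ((V y - V 0 : ℝ) : ℂ)) +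
        V 0 * ∫ y in (0:ℝ)..Y, expTau (lam * ψ y) := by
    rw [← intervalIntegral.integral_const_mul, ← intervalIntegral.integral_add]
    · congr 1; ext y; push_cast; ring
    · exact (hec.mul (Complex.continuous_ofReal.comp (hVc.sub continuous_const))).intervalIntegrable _ _
    · exact (hec.intervalIntegrable _ _).const_mul _
  rw [hsplit]
  have hH := H ψ ψ₁ ψ₂ h h0 h1 lam Y hlam hY
  set K : ℝ := Real.sqrt (2 / ψ₂ 0) * lam ^ (-(1 / 2) : ℝ)
  have e1 : (∫ y in (0:ℝ)..Y, expTau (lam * ψ y) * ((V y - V 0 : ℝ) : ℂ)) +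
        V 0 * (∫ y in (0:ℝ)..Y, expTau (lam * ψ y)) - ((V 0 * K : ℝ) : ℂ) * Γ =
      (∫ y in (0:ℝ)..Y, expTau (lam * ψ y) * ((V y - V 0 : ℝ) : ℂ)) +
        V 0 * ((∫ y in (0:ℝ)..Y, expTau (lam * ψ y)) - (K : ℂ) * Γ) := by push_cast; ring
  rw [e1]
  have e2 : ‖(V 0 : ℂ) * ((∫ y in (0:ℝ)..Y, expTau (lam * ψ y)) - (K : ℂ) * Γ)‖ ≤ C * lam ^ (-(1 + θ) / 2) := by
    rw [norm_mul, Complex.norm_real, Real.norm_eq_abs]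
    exact (mul_le_of_le_one_left (norm_nonneg _) (hV1 0)).trans hH
  refine (norm_add_le _ _).trans ((add_le_add hmain e2).trans ?_)
  have p1 : 0 ≤ lam ^ (-(1 + θ) / 2) := Real.rpow_nonneg hlam0.le _
  have p2 : 0 ≤ B * lam ^ (-(1 + α) / 2) := mul_nonneg hB (Real.rpow_nonneg hlam0.le _)
  have e3 : (1 + 2 / m + (1 / m + M / m ^ 2) / (1 - α)) * (B * Y ^ (1 - α)) * lam ^ (-(1 + α) / 2) =
      D * (B * lam ^ (-(1 + α) / 2)) := by rw [hD]; ring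
  rw [e3]
  have : 0 ≤ D * lam ^ (-(1 + θ) / 2) := by positivity
  have : 0 ≤ C * (B * lam ^ (-(1 + α) / 2)) := by positivity
  linarith

/-- Stationary phase for a smooth weight. -/
theorem exists_stationary_phase {m M L θ α : ℝ} (R : ℝ) (hm : 0 < m) (hmM : m ≤ M) (hL : 0 ≤ L)
    (hθ : 0 < θ) (hθ1 : θ < 1) (hα : 0 < α) (hα1 : α < 1) :
    ∃ C : ℝ, 0 < C ∧ ∃ Γ : ℂ, ∀ F F₁ F₂ : ℝ → ℝ, IsCurve m M L θ F F₁ F₂ →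
      ∀ (W W' : ℝ → ℝ) (B : ℝ), (∀ x, HasDerivAt W (W' x) x) → Continuous W' → (∀ x, |W x| ≤ 1) →
      (∀ x, |W' x| ≤ B) → (∀ x, R < |x| → W x = 0) → ∀ x₀ : ℝ, |x₀| ≤ R → ∀ lam : ℝ, 1 ≤ lam →
      ‖(∫ x, expTau (lam * (F x - F₁ x₀ * x)) * (W x : ℂ)) -
          (W x₀ * (Real.sqrt (2 / F₂ x₀) * lam ^ (-(1 / 2) : ℝ)) : ℝ) * Γ *
            expTau (lam * (F x₀ - F₁ x₀ * x₀))‖ ≤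
        C * (lam ^ (-(1 + θ) / 2) + B * lam ^ (-(1 + α) / 2)) := by
  -- With this `Y`, the interval of radius `Y` about any `x₀` with `|x₀| ≤ R` contains the support
  -- of `W`. The integrals to the left and right of `x₀` have the same main term, whence the
  -- constant `2 * Γ`.
  obtain ⟨C, hC, Γ, H⟩ := exists_half_stationary_phase_weighted (Y := 2 * |R| + 2) hm hmM hL hθ hθ1 hα hα1
    (by linarith [abs_nonneg R])
  refine ⟨2 * C, by positivity, 2 * Γ, ?_⟩
  intro F F₁ F₂ h W W' B hW hW'c hW1 hW'B hsupp x₀ hx₀ lam hlam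
  set Y := 2 * |R| + 2 with hY
  have hR : 0 ≤ R := (abs_nonneg _).trans hx₀
  rw [abs_of_nonneg hR] at hY
  have hFc : Continuous F := continuous_iff_continuousAt.2 fun y => (h.hasDerivAt y).continuousAt
  have hWc : Continuous W := continuous_iff_continuousAt.2 fun y => (hW y).continuousAt
  set φ : ℝ → ℂ := fun x => expTau (lam * (F x - F₁ x₀ * x)) * (W x : ℂ) with hφ
  have hφc : Continuous φ := (continuous_expTau.comp (by fun_prop)).mul (Complex.continuous_ofReal.comp hWc)
  have hsub : Function.support φ ⊆ Set.Ioc (x₀ - Y) (x₀ + Y) := by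
    intro x hx
    have : |x| ≤ R := by
      by_contra! hlt
      exact hx (by simp [hφ, hsupp x hlt])
    rw [abs_le] at this hx₀
    constructor <;> linarith
  rw [← intervalIntegral.integral_eq_integral_of_support_subset hsub,
    ← intervalIntegral.integral_add_adjacent_intervals (b := x₀) (hφc.intervalIntegrable _ _)
      (hφc.intervalIntegrable _ _)]
  set P := expTau (lam * (F x₀ - F₁ x₀ * x₀)) with hP
  have hright : ∫ x in x₀..(x₀ + Y), φ x =
      P * ∫ y in (0:ℝ)..Y, expTau (lam * (F (x₀ + y) - F x₀ - F₁ x₀ * y)) * (W (x₀ + y) : ℂ) := by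
    rw [← intervalIntegral.integral_const_mul]
    have := intervalIntegral.integral_comp_add_left (a := 0) (b := Y) φ x₀
    rw [add_zero] at this
    rw [← this]
    congr 1; ext y
    rw [hφ, hP]; simp only
    rw [← mul_assoc, ← expTau_add]
    congr 2; ring
  have hleft : ∫ x in (x₀ - Y)..x₀, φ x =
      P * ∫ y in (0:ℝ)..Y, expTau (lam * (F (x₀ + -y) - F x₀ - F₁ x₀ * -y)) * (W (x₀ + -y) : ℂ) := by
    rw [← intervalIntegral.integral_const_mul]
    have := intervalIntegral.integral_comp_sub_left (a := 0) (b := Y) φ x₀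
    rw [sub_zero] at this
    rw [← this]
    congr 1; ext y
    rw [hφ, hP]; simp only
    rw [← mul_assoc, ← expTau_add, sub_eq_add_neg x₀ y]
    congr 2; ring
  have hc := h.centre x₀
  have hr := H _ _ _ hc (by simp) (by simp) (fun y => W (x₀ + y)) (fun y => W' (x₀ + y)) B
    (fun y => (hW (x₀ + y)).comp_const_add x₀ y) (hW'c.comp (continuous_const.add continuous_id))
    (fun y => hW1 _) (fun y => hW'B _) lam hlam
  have hl := H _ _ _ hc.reflect (by simp) (by simp) (fun y => W (x₀ + -y)) (fun y => -W' (x₀ + -y)) B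
    (fun y => (((hW (x₀ + -y)).comp_const_add x₀ (-y)).comp y (hasDerivAt_neg y)).congr_deriv (by simp))
    (by fun_prop)
    (fun y => hW1 _) (fun y => by rw [abs_neg]; exact hW'B _) lam hlam
  simp only [add_zero, neg_zero] at hr hl
  rw [hright, hleft]
  set K : ℝ := W x₀ * (Real.sqrt (2 / F₂ x₀) * lam ^ (-(1 / 2) : ℝ))
  set I₁ := ∫ y in (0:ℝ)..Y, expTau (lam * (F (x₀ + y) - F x₀ - F₁ x₀ * y)) * (W (x₀ + y) : ℂ)
  set I₂ := ∫ y in (0:ℝ)..Y, expTau (lam * (F (x₀ + -y) - F x₀ - F₁ x₀ * -y)) * (W (x₀ + -y) : ℂ)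
  have e : P * I₂ + P * I₁ - (K : ℂ) * (2 * Γ) * P = P * ((I₂ - K * Γ) + (I₁ - K * Γ)) := by ring
  rw [e, norm_mul, hP, norm_expTau, one_mul]
  refine (norm_add_le _ _).trans ((add_le_add hl hr).trans_eq ?_)
  ring

end IsCurve

/-! ### Smooth weights and integrals without stationary point -/

/-- A smooth weight supported in `(-R, R)` whose derivatives are of size `B` and `B ^ 2`. -/
structure IsWeight (R B : ℝ) (W W₁ W₂ : ℝ → ℝ) : Prop where
  one_le : 1 ≤ B
  hasDerivAt : ∀ x, HasDerivAt W (W₁ x) x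
  hasDerivAt₁ : ∀ x, HasDerivAt W₁ (W₂ x) x
  continuous : Continuous W₂
  nonneg : ∀ x, 0 ≤ W x
  le_one : ∀ x, W x ≤ 1
  abs_le : ∀ x, |W₁ x| ≤ B
  abs_le₁ : ∀ x, |W₂ x| ≤ B ^ 2
  eq_zero : ∀ x, R ≤ |x| → W x = 0
  eq_zero₁ : ∀ x, R ≤ |x| → W₁ x = 0

/-- Integration by parts for an oscillatory integral. -/
theorem norm_integral_expTau_mul_deriv_le {φ φ₁ u u₁ : ℝ → ℝ} {a b q D : ℝ} (hab : a ≤ b) (hq : 0 < q)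
    (hφ : ∀ x ∈ Set.Icc a b, HasDerivAt φ (φ₁ x) x) (hu : ∀ x ∈ Set.Icc a b, HasDerivAt u (u₁ x) x)
    (hφc : ContinuousOn φ₁ (Set.Icc a b)) (huc : ContinuousOn u₁ (Set.Icc a b)) (hua : u a = 0) (hub : u b = 0)
    (hD : ‖∫ x in a..b, expTau (q * φ x) * (u₁ x : ℂ)‖ ≤ D) :
    ‖∫ x in a..b, expTau (q * φ x) * ((u x * φ₁ x : ℝ) : ℂ)‖ ≤ D / q := by
  have hI : Set.uIcc a b = Set.Icc a b := Set.uIcc_of_le hab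
  have hec : ContinuousOn (fun x => expTau (q * φ x)) (Set.uIcc a b) := by
    rw [hI]
    exact continuous_expTau.comp_continuousOn (continuousOn_const.mul
      fun x hx => (hφ x hx).continuousAt.continuousWithinAt)
  have hucont : ContinuousOn u (Set.uIcc a b) := by
    rw [hI]; exact fun x hx => (hu x hx).continuousAt.continuousWithinAt
  have hi1 : IntervalIntegrable (fun x => expTau (q * φ x) * ((u x * φ₁ x : ℝ) : ℂ)) MeasureTheory.volume a b :=
    (hec.mul (Complex.continuous_ofReal.comp_continuousOn (hucont.mul (by rwa [hI])))).intervalIntegrable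
  have hi2 : IntervalIntegrable (fun x => expTau (q * φ x) * (u₁ x : ℂ)) MeasureTheory.volume a b :=
    (hec.mul (Complex.continuous_ofReal.comp_continuousOn (by rwa [hI]))).intervalIntegrable
  have hd : ∀ x ∈ Set.uIcc a b, HasDerivAt (fun x => expTau (q * φ x) * (u x : ℂ))
      (2 * Real.pi * Complex.I * q * (expTau (q * φ x) * ((u x * φ₁ x : ℝ) : ℂ)) +
        expTau (q * φ x) * (u₁ x : ℂ)) x := by
    intro x hx
    rw [hI] at hx
    refine ((((hφ x hx).const_mul q).expTau_comp).mul (hu x hx).ofReal_comp).congr_deriv ?_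
    push_cast; ring
  have hFTC := intervalIntegral.integral_eq_sub_of_hasDerivAt hd ((hi1.const_mul _).add hi2)
  rw [intervalIntegral.integral_add (hi1.const_mul _) hi2, intervalIntegral.integral_const_mul, hua, hub] at hFTC
  simp only [Complex.ofReal_zero, mul_zero, sub_zero] at hFTC
  have hn := congrArg norm (eq_neg_of_add_eq_zero_left hFTC)
  rw [norm_neg, norm_mul, norm_mul, norm_two_pi_I, Complex.norm_real, Real.norm_of_nonneg hq.le] at hn
  rw [← hn] at hD
  rw [le_div_iff₀ hq]
  have hpi : 1 ≤ 2 * Real.pi := by linarith [Real.pi_gt_three]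
  have h0 : 0 ≤ q * ‖∫ x in a..b, expTau (q * φ x) * ((u x * φ₁ x : ℝ) : ℂ)‖ := by positivity
  have := le_mul_of_one_le_left h0 hpi
  linarith

namespace IsCurve

variable {m M L θ : ℝ} {F F₁ F₂ : ℝ → ℝ}

/-- Decay of the oscillatory integrals without stationary point. -/
theorem norm_integral_le_of_nonstationary (h : IsCurve m M L θ F F₁ F₂) {R R₁ B : ℝ} (hR : 0 ≤ R) (hR₁ : 1 ≤ R₁)
    (hF₁ : ∀ x, |x| ≤ R → |F₁ x| ≤ R₁) {W W₁ W₂ : ℝ → ℝ} (hW : IsWeight R B W W₁ W₂) {q j t : ℝ} (hq : 0 < q)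
    (hj : 0 < j) (ht : 2 * R₁ * j ≤ |t|) :
    ‖∫ x, expTau (q * (j * F x - t * x)) * (W x : ℂ)‖ ≤
      (16 * R * (1 + 2 * M)) * ((j / q + B ^ 2 / q ^ 2) / t ^ 2) := by
  have hM : 0 < M := h.pos.trans_le h.le_max
  have hB := hW.one_le
  have htpos : 0 < |t| := lt_of_lt_of_le (by positivity) ht
  set φ₁ : ℝ → ℝ := fun x => j * F₁ x - t with hφ₁
  have hφd : ∀ x, HasDerivAt (fun x => j * F x - t * x) (φ₁ x) x := fun x =>
    (((h.hasDerivAt x).const_mul j).sub ((hasDerivAt_id x).const_mul t)).congr_deriv (by simp [hφ₁])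
  have hφ₁d : ∀ x, HasDerivAt φ₁ (j * F₂ x) x := fun x => ((h.hasDerivAt₁ x).const_mul j).sub_const t
  -- As `|t|` is at least twice the maximum of `j * |F₁|` on the support, the linear term dominates
  -- the derivative of the phase.
  have hlow : ∀ x ∈ Set.Icc (-R) R, |t| / 2 ≤ |φ₁ x| := by
    intro x hx
    have h1 := hF₁ x (abs_le.2 hx)
    have h2 : |t| ≤ |φ₁ x| + |j * F₁ x| := by
      have := abs_sub (j * F₁ x) (φ₁ x)
      rw [hφ₁] at this ⊢
      simp only [sub_sub_cancel] at this
      linarith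
    rw [abs_mul, abs_of_pos hj] at h2
    have h3 : j * |F₁ x| ≤ j * R₁ := mul_le_mul_of_nonneg_left h1 hj.le
    linarith
  have hne : ∀ x ∈ Set.Icc (-R) R, φ₁ x ≠ 0 := fun x hx h0 => by
    have := hlow x hx; rw [h0, abs_zero] at this; linarith
  have hab : -R ≤ R := by linarith
  have hF₁c : Continuous F₁ := continuous_iff_continuousAt.2 fun y => (h.hasDerivAt₁ y).continuousAt
  have hWc : Continuous W := continuous_iff_continuousAt.2 fun y => (hW.hasDerivAt y).continuousAt
  have hW₁c : Continuous W₁ := continuous_iff_continuousAt.2 fun y => (hW.hasDerivAt₁ y).continuousAt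
  have hφ₁c : Continuous φ₁ := by fun_prop
  have hF₂c := h.continuous
  have hW₂c := hW.continuous
  have hsub : Function.support (fun x => expTau (q * (j * F x - t * x)) * (W x : ℂ)) ⊆ Set.Ioc (-R) R := by
    intro x hx
    have : |x| < R := by
      by_contra! hlt
      exact hx (by simp [hW.eq_zero x hlt])
    rw [abs_lt] at this
    exact ⟨this.1, this.2.le⟩
  rw [← intervalIntegral.integral_eq_integral_of_support_subset hsub]
  have hRR : |R| = R := abs_of_nonneg hR
  have hRR' : |-R| = R := by rw [abs_neg, hRR]
  have hFc : Continuous F := continuous_iff_continuousAt.2 fun y => (h.hasDerivAt y).continuousAt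
  have hec : Continuous fun x => expTau (q * (j * F x - t * x)) := continuous_expTau.comp (by fun_prop)
  have hφinv : ∀ n : ℕ, ContinuousOn (fun x => φ₁ x ^ n) (Set.Icc (-R) R) := fun n => (hφ₁c.pow n).continuousOn
  have hinv : ∀ (n : ℕ) x, x ∈ Set.Icc (-R) R → |1 / φ₁ x ^ n| ≤ (2 / |t|) ^ n := by
    intro n x hx
    rw [abs_div, abs_one, abs_pow, div_pow, div_le_div_iff₀ (pow_pos (abs_pos.2 (hne x hx)) n) (by positivity), one_mul,
      ← mul_pow]
    exact pow_le_pow_left₀ htpos.le (by linarith [hlow x hx]) n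
  have hjt : j / |t| ≤ 1 / 2 := by
    rw [div_le_div_iff₀ htpos (by norm_num)]
    nlinarith
  have huIcc : Set.uIcc (-R) R = Set.Icc (-R) R := Set.uIcc_of_le hab
  -- second integration by parts
  have hpart2 : ‖∫ x in (-R)..R, expTau (q * (j * F x - t * x)) * ((W₁ x / φ₁ x : ℝ) : ℂ)‖ ≤
      (4 + 8 * M) * B ^ 2 / t ^ 2 * (2 * R) / q := by
    have hu : ∀ x ∈ Set.Icc (-R) R, HasDerivAt (fun x => W₁ x / φ₁ x ^ 2)
        (W₂ x * (1 / φ₁ x ^ 2) - 2 * W₁ x * (j * F₂ x) * (1 / φ₁ x ^ 3)) x := by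
      intro x hx
      have := hne x hx
      refine ((hW.hasDerivAt₁ x).div ((hφ₁d x).pow 2) (pow_ne_zero 2 this)).congr_deriv ?_
      push_cast
      simp only [Pi.pow_apply]
      field_simp
    have huc : ContinuousOn (fun x => W₂ x * (1 / φ₁ x ^ 2) - 2 * W₁ x * (j * F₂ x) * (1 / φ₁ x ^ 3))
        (Set.Icc (-R) R) := by
      refine ContinuousOn.sub ?_ ?_
      · exact hW₂c.continuousOn.mul (continuousOn_const.div (hφinv 2) fun x hx => pow_ne_zero _ (hne x hx))
      · refine ContinuousOn.mul (by fun_prop) (continuousOn_const.div (hφinv 3) fun x hx => pow_ne_zero _ (hne x hx))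
    have hD : ‖∫ x in (-R)..R, expTau (q * (j * F x - t * x)) *
        ((W₂ x * (1 / φ₁ x ^ 2) - 2 * W₁ x * (j * F₂ x) * (1 / φ₁ x ^ 3) : ℝ) : ℂ)‖ ≤
        (4 + 8 * M) * B ^ 2 / t ^ 2 * (2 * R) := by
      refine (intervalIntegral.norm_integral_le_of_norm_le_const (C := (4 + 8 * M) * B ^ 2 / t ^ 2) ?_).trans_eq ?_
      · intro x hx
        rw [Set.uIoc_of_le hab] at hx
        have hx' : x ∈ Set.Icc (-R) R := ⟨hx.1.le, hx.2⟩
        rw [norm_mul, norm_expTau, one_mul, Complex.norm_real, Real.norm_eq_abs]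
        refine (abs_sub _ _).trans ?_
        have a1 : |W₂ x * (1 / φ₁ x ^ 2)| ≤ B ^ 2 * (2 / |t|) ^ 2 := by
          rw [abs_mul]
          exact mul_le_mul (hW.abs_le₁ x) (hinv 2 x hx') (abs_nonneg _) (by positivity)
        have a2 : |2 * W₁ x * (j * F₂ x) * (1 / φ₁ x ^ 3)| ≤ 2 * B * (j * M) * (2 / |t|) ^ 3 := by
          rw [abs_mul, abs_mul, abs_mul, abs_mul, abs_of_pos hj, abs_two, abs_of_pos (h.pos.trans_le (h.le x))]
          refine mul_le_mul ?_ (hinv 3 x hx') (abs_nonneg _) (by positivity)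
          refine mul_le_mul ?_ ?_ (mul_nonneg hj.le (h.pos.trans_le (h.le x)).le) (by positivity)
          · exact mul_le_mul_of_nonneg_left (hW.abs_le x) (by norm_num)
          · exact mul_le_mul_of_nonneg_left (h.ge x) hj.le
        have a3 : 2 * B * (j * M) * (2 / |t|) ^ 3 ≤ 8 * M * B ^ 2 / t ^ 2 := by
          have : 2 * B * (j * M) * (2 / |t|) ^ 3 = (16 * M * B / |t| ^ 2) * (j / |t|) := by field_simp; ring
          rw [this, sq_abs]
          have b1 : (16 * M * B / t ^ 2) * (j / |t|) ≤ (16 * M * B / t ^ 2) * (1 / 2) :=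
            mul_le_mul_of_nonneg_left hjt (by positivity)
          refine b1.trans ?_
          have b2 : 8 * M * B ≤ 8 * M * B ^ 2 := by
            refine mul_le_mul_of_nonneg_left ?_ (by positivity)
            nlinarith
          have b3 : (16 * M * B / t ^ 2) * (1 / 2) = 8 * M * B / t ^ 2 := by ring
          rw [b3]
          exact div_le_div_of_nonneg_right b2 (sq_nonneg _)
        have a4 : B ^ 2 * (2 / |t|) ^ 2 = 4 * B ^ 2 / t ^ 2 := by rw [div_pow, sq_abs]; ring
        have a5 : (4 + 8 * M) * B ^ 2 / t ^ 2 = 4 * B ^ 2 / t ^ 2 + 8 * M * B ^ 2 / t ^ 2 := by ring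
        linarith
      · rw [show R - -R = 2 * R by ring, abs_of_nonneg (by linarith)]
    have := norm_integral_expTau_mul_deriv_le hab hq (fun x _ => hφd x) hu hφ₁c.continuousOn huc
      (by rw [hW.eq_zero₁ _ hRR'.ge]; simp) (by rw [hW.eq_zero₁ _ hRR.ge]; simp) hD
    refine le_trans (le_of_eq ?_) this
    congr 1
    refine intervalIntegral.integral_congr fun x hx => ?_
    rw [huIcc] at hx
    have := hne x hx
    congr 2
    field_simp
  have hu : ∀ x ∈ Set.Icc (-R) R, HasDerivAt (fun x => W x / φ₁ x)
      (W₁ x / φ₁ x - W x * (j * F₂ x) * (1 / φ₁ x ^ 2)) x := by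
    intro x hx
    have := hne x hx
    refine ((hW.hasDerivAt x).div (hφ₁d x) this).congr_deriv ?_
    field_simp
  have hc1 : ContinuousOn (fun x => W₁ x / φ₁ x) (Set.Icc (-R) R) := hW₁c.continuousOn.div hφ₁c.continuousOn hne
  have hc2 : ContinuousOn (fun x => W x * (j * F₂ x) * (1 / φ₁ x ^ 2)) (Set.Icc (-R) R) :=
    ContinuousOn.mul (by fun_prop) (continuousOn_const.div (hφinv 2) fun x hx => pow_ne_zero _ (hne x hx))
  -- This term contains `F₂`, which is only continuous, so it cannot be integrated by parts again.
  -- The trivial bound already has the factor `j / t ^ 2`, and the first integration by parts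
  -- supplies `1 / q`.
  have hpart1 : ‖∫ x in (-R)..R, expTau (q * (j * F x - t * x)) * ((W x * (j * F₂ x) * (1 / φ₁ x ^ 2) : ℝ) : ℂ)‖ ≤
      4 * j * M / t ^ 2 * (2 * R) := by
    refine (intervalIntegral.norm_integral_le_of_norm_le_const (C := 4 * j * M / t ^ 2) ?_).trans_eq ?_
    · intro x hx
      rw [Set.uIoc_of_le hab] at hx
      rw [norm_mul, norm_expTau, one_mul, Complex.norm_real, Real.norm_eq_abs, abs_mul, abs_mul, abs_mul,
        abs_of_pos hj, abs_of_pos (h.pos.trans_le (h.le x)), abs_of_nonneg (hW.nonneg x)]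
      have a1 : W x * (j * F₂ x) ≤ 1 * (j * M) :=
        mul_le_mul (hW.le_one x) (mul_le_mul_of_nonneg_left (h.ge x) hj.le)
          (mul_nonneg hj.le (h.pos.trans_le (h.le x)).le) zero_le_one
      refine (mul_le_mul a1 (hinv 2 x ⟨hx.1.le, hx.2⟩) (abs_nonneg _) (by positivity)).trans_eq ?_
      rw [div_pow, sq_abs]; ring
    · rw [show R - -R = 2 * R by ring, abs_of_nonneg (by linarith)]
  have hD : ‖∫ x in (-R)..R, expTau (q * (j * F x - t * x)) *
      ((W₁ x / φ₁ x - W x * (j * F₂ x) * (1 / φ₁ x ^ 2) : ℝ) : ℂ)‖ ≤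
      (4 + 8 * M) * B ^ 2 / t ^ 2 * (2 * R) / q + 4 * j * M / t ^ 2 * (2 * R) := by
    have i1 : IntervalIntegrable (fun x => expTau (q * (j * F x - t * x)) * ((W₁ x / φ₁ x : ℝ) : ℂ))
        MeasureTheory.volume (-R) R :=
      (hec.continuousOn.mul (Complex.continuous_ofReal.comp_continuousOn (by rwa [huIcc]))).intervalIntegrable
    have i2 : IntervalIntegrable (fun x => expTau (q * (j * F x - t * x)) *
        ((W x * (j * F₂ x) * (1 / φ₁ x ^ 2) : ℝ) : ℂ)) MeasureTheory.volume (-R) R :=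
      (hec.continuousOn.mul (Complex.continuous_ofReal.comp_continuousOn (by rwa [huIcc]))).intervalIntegrable
    have : ∫ x in (-R)..R, expTau (q * (j * F x - t * x)) *
      ((W₁ x / φ₁ x - W x * (j * F₂ x) * (1 / φ₁ x ^ 2) : ℝ) : ℂ) =
      (∫ x in (-R)..R, expTau (q * (j * F x - t * x)) * ((W₁ x / φ₁ x : ℝ) : ℂ)) -
      ∫ x in (-R)..R, expTau (q * (j * F x - t * x)) * ((W x * (j * F₂ x) * (1 / φ₁ x ^ 2) : ℝ) : ℂ) := by
      rw [← intervalIntegral.integral_sub i1 i2]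
      congr 1; ext x; push_cast; ring
    rw [this]
    exact (norm_sub_le _ _).trans (add_le_add hpart2 hpart1)
  have hfin := norm_integral_expTau_mul_deriv_le hab hq (fun x _ => hφd x) hu hφ₁c.continuousOn (hc1.sub hc2)
      (by rw [hW.eq_zero _ hRR'.ge]; simp) (by rw [hW.eq_zero _ hRR.ge]; simp) hD
  refine le_trans (le_of_eq ?_) (hfin.trans ?_)
  · congr 1
    refine intervalIntegral.integral_congr fun x hx => ?_
    rw [huIcc] at hx
    have := hne x hx
    congr 2
    field_simp
  · have ht2 : 0 < t ^ 2 := by rw [← sq_abs]; positivity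
    have : (16 * R * (1 + 2 * M)) * ((j / q + B ^ 2 / q ^ 2) / t ^ 2) -
        ((4 + 8 * M) * B ^ 2 / t ^ 2 * (2 * R) / q + 4 * j * M / t ^ 2 * (2 * R)) / q =
        (8 * R * (1 + 2 * M) * B ^ 2 / q ^ 2 + (16 * R + 24 * R * M) * (j / q)) / t ^ 2 := by
      field_simp; ring
    have : 0 ≤ (8 * R * (1 + 2 * M) * B ^ 2 / q ^ 2 + (16 * R + 24 * R * M) * (j / q)) / t ^ 2 := by positivity
    linarith

end IsCurve

/-! ### Poisson summation and passage to the dual curve -/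

theorem sum_inv_sq_int_le (H : ℕ) (hH : 1 ≤ H) (T : Finset ℤ) (hT : ∀ t ∈ T, (H : ℤ) ≤ |t|) :
    ∑ t ∈ T, ((t : ℝ) ^ 2)⁻¹ ≤ 4 / H := by
  classical
  obtain ⟨N, hN⟩ : ∃ N : ℕ, ∀ t ∈ T, t.natAbs < N := ⟨T.sup Int.natAbs + 1, fun t ht =>
    Nat.lt_succ_of_le (Finset.le_sup (f := Int.natAbs) ht)⟩
  have hnat : ∑ n ∈ Finset.Ioo (H - 1) N, ((n : ℝ) ^ 2)⁻¹ ≤ 2 / H := by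
    have := sum_Ioo_inv_sq_le (α := ℝ) (H - 1) N
    rwa [Nat.cast_sub hH, Nat.cast_one, sub_add_cancel] at this
  have key : ∀ S : Finset ℤ, S ⊆ T → Set.InjOn Int.natAbs (S : Set ℤ) → ∑ t ∈ S, ((t : ℝ) ^ 2)⁻¹ ≤ 2 / H := by
    intro S hS hinj
    have e : ∑ t ∈ S, ((t : ℝ) ^ 2)⁻¹ = ∑ n ∈ S.image Int.natAbs, ((n : ℝ) ^ 2)⁻¹ := by
      rw [Finset.sum_image hinj]
      refine Finset.sum_congr rfl fun t _ => ?_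
      rw [Nat.cast_natAbs, Int.cast_abs, sq_abs]
    rw [e]
    refine (Finset.sum_le_sum_of_subset_of_nonneg ?_ fun _ _ _ => by positivity).trans hnat
    intro n hn
    obtain ⟨t, ht, rfl⟩ := Finset.mem_image.1 hn
    have h1 := hT t (hS ht)
    have h2 := hN t (hS ht)
    rw [Int.abs_eq_natAbs] at h1
    rw [Finset.mem_Ioo]
    omega
  rw [← Finset.sum_filter_add_sum_filter_not T (fun t => 0 ≤ t)]
  have h1 := key (T.filter fun t => 0 ≤ t) (Finset.filter_subset _ _) (by
    intro a ha b hb hab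
    have := (Finset.mem_filter.1 ha).2
    have := (Finset.mem_filter.1 hb).2
    omega)
  have h2 := key (T.filter fun t => ¬ 0 ≤ t) (Finset.filter_subset _ _) (by
    intro a ha b hb hab
    have := (Finset.mem_filter.1 ha).2
    have := (Finset.mem_filter.1 hb).2
    omega)
  have : (4 : ℝ) / H = 2 / H + 2 / H := by ring
  linarith

/-- Poisson summation for a compactly supported function whose Fourier transform decays
quadratically. -/
theorem norm_tsum_sub_sum_fourier_le {f : ℝ → ℂ} (hc : Continuous f) {K : ℝ} (hK : ∀ x, K < |x| → f x = 0)
    {D : ℝ} (hD : 0 ≤ D) {H : ℕ} (hH : 1 ≤ H)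
    (hF : ∀ t : ℤ, (H : ℤ) ≤ |t| → ‖∫ x, expTau (-(t * x)) * f x‖ ≤ D * ((t : ℝ) ^ 2)⁻¹) :
    ‖∑' n : ℤ, f n - ∑ t ∈ Finset.Ioo (-(H : ℤ)) H, ∫ x, expTau (-(t * x)) * f x‖ ≤ D * (4 / H) := by
  have hfour : ∀ t : ℤ, FourierTransform.fourier f (t : ℝ) = ∫ x, expTau (-(t * x)) * f x := by
    intro t
    rw [Real.fourier_eq']
    congr 1; ext x
    rw [smul_eq_mul, expTau]
    congr 2
    simp only [RCLike.inner_apply, conj_trivial]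
    push_cast; ring
  have hsum : Summable fun t : ℤ => FourierTransform.fourier f (t : ℝ) := by
    refine Summable.of_norm_bounded_eventually (g := fun t : ℤ => D * ((t : ℝ) ^ 2)⁻¹) ?_ ?_
    · refine Summable.mul_left _ ?_
      simpa using Real.summable_one_div_int_pow (p := 2)
    · have : (Finset.Ioo (-(H : ℤ)) H : Set ℤ).Finite := Finset.finite_toSet _
      refine this.subset ?_
      intro t ht
      by_contra hnot
      apply ht
      change ‖FourierTransform.fourier f (t : ℝ)‖ ≤ _
      rw [hfour]
      refine hF t ?_
      rw [Finset.mem_coe, Finset.mem_Ioo] at hnot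
      rw [le_abs]; omega
  have hO : Asymptotics.IsBigO (Filter.cocompact ℝ) f fun x : ℝ => |x| ^ (-(2:ℝ)) := by
    refine Asymptotics.IsBigO.congr' (Asymptotics.isBigO_zero _ _) ?_ (Filter.EventuallyEq.refl _ _)
    have : {x : ℝ | K < ‖x‖} ∈ Filter.cocompact ℝ := by
      have := tendsto_norm_cocompact_atTop (E := ℝ)
      exact this.eventually (Filter.eventually_gt_atTop K)
    filter_upwards [this] with x hx
    exact (hK x hx).symm
  have hP := Real.tsum_eq_tsum_fourier_of_rpow_decay_of_summable hc (by norm_num : (1:ℝ) < 2) hO hsum 0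
  simp only [zero_add] at hP
  have hP' : ∑' n : ℤ, f n = ∑' t : ℤ, FourierTransform.fourier f (t : ℝ) := by
    rw [hP]; congr 1; ext t; simp
  rw [hP']
  set s := Finset.Ioo (-(H : ℤ)) H with hs
  have hlim := (hsum.hasSum.sub_const (∑ t ∈ s, ∫ x, expTau (-(t * x)) * f x)).norm
  refine le_of_tendsto hlim ?_
  filter_upwards [Filter.eventually_ge_atTop s] with T hT
  rw [← Finset.sum_sdiff hT, Finset.sum_congr (s₁ := s) rfl fun t _ => hfour t, add_sub_cancel_right]
  have hmem : ∀ t ∈ T \ s, (H : ℤ) ≤ |t| := by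
    intro t ht
    have := (Finset.mem_sdiff.1 ht).2
    rw [hs, Finset.mem_Ioo] at this
    rw [le_abs]; omega
  calc ‖∑ t ∈ T \ s, FourierTransform.fourier f (t : ℝ)‖ ≤ ∑ t ∈ T \ s, D * ((t : ℝ) ^ 2)⁻¹ :=
        norm_sum_le_of_le _ fun t ht => by rw [hfour]; exact hF t (hmem t ht)
    _ ≤ D * (4 / H) := by
        rw [← Finset.mul_sum]
        exact mul_le_mul_of_nonneg_left (sum_inv_sq_int_le H hH _ hmem) hD

/-- Poisson summation and stationary phase for the sum of a weight times `e(j q F(a/q))` over the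
integers `a`. -/
theorem IsCurve.exists_poisson_stationary {m M L θ α c R R₁ : ℝ} {F F₁ F₂ g G : ℝ → ℝ} (h : IsCurve m M L θ F F₁ F₂)
    (hθ : 0 < θ) (hθ1 : θ < 1) (hα : 0 < α) (hα1 : α < 1) (hL : 0 ≤ L) (hd : IsDualPair c F F₁ g G) (hR : 0 ≤ R) (hR₁ : 1 ≤ R₁)
    (hF₁ : ∀ x, |x| ≤ R → |F₁ x| ≤ R₁) :
    ∃ C > 0, ∃ Γ : ℂ, ∀ B W W₁ W₂, IsWeight R B W W₁ W₂ → ∀ q j : ℕ, 1 ≤ q → 1 ≤ j → B ^ 2 ≤ q →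
      ‖∑' a : ℤ, expTau (j * (q * F (a / q))) * (W (a / q) : ℂ) -
        ∑ t ∈ Finset.Ioo (-(⌈2 * R₁ * j⌉₊ : ℤ)) ⌈2 * R₁ * j⌉₊,
          ((W (G (t / j)) * √(2 / F₂ (G (t / j))) : ℝ) : ℂ) * Γ *
            (((q * ((q : ℝ) * j) ^ (-(1 / 2) : ℝ) : ℝ) : ℂ) * expTau (q * -(j * g (t / j))))‖ ≤
        C * (1 + ((q : ℝ) * j) ^ ((1 - θ) / 2) + B * ((q : ℝ) * j) ^ ((1 - α) / 2)) := by
  have hc := hd.one_le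
  have hM : 0 < M := h.pos.trans_le h.le_max
  -- The retained frequencies satisfy `|t / j| ≤ 2 * R₁`, so the stationary point `G (t / j)` may
  -- leave the support of the weight but stays within `3 * c * R₁` of the origin. The larger radius
  -- treats all these frequencies uniformly.
  obtain ⟨C, hC, Γ, hstat⟩ := IsCurve.exists_stationary_phase (max R (3 * c * R₁)) h.pos h.le_max hL hθ hθ1 hα hα1
  refine ⟨64 * R * (1 + 2 * M) * 2 + 6 * R₁ * C, by positivity, Γ, ?_⟩
  intro B W W₁ W₂ hW q j hq hj hBq
  have hq' : (1 : ℝ) ≤ q := by exact_mod_cast hq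
  have hj' : (1 : ℝ) ≤ j := by exact_mod_cast hj
  have hq0 : (0 : ℝ) < q := by linarith
  have hj0 : (0 : ℝ) < j := by linarith
  have hB := hW.one_le
  set H := ⌈2 * R₁ * j⌉₊ with hH
  have hHle : 2 * R₁ * j ≤ H := Nat.le_ceil _
  have hHlt : (H : ℝ) < 2 * R₁ * j + 1 := Nat.ceil_lt_add_one (by positivity)
  have hR₁j : 1 ≤ R₁ * j := one_le_mul_of_one_le_of_one_le hR₁ hj'
  have hH1 : (1 : ℝ) ≤ H := by linarith
  have hFc : Continuous F := continuous_iff_continuousAt.2 fun y => (h.hasDerivAt y).continuousAt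
  have hWc : Continuous W := continuous_iff_continuousAt.2 fun y => (hW.hasDerivAt y).continuousAt
  have hW₁c : Continuous W₁ := continuous_iff_continuousAt.2 fun y => (hW.hasDerivAt₁ y).continuousAt
  set f : ℝ → ℂ := fun x => expTau (j * (q * F (x / q))) * (W (x / q) : ℂ) with hf
  have hfc : Continuous f := (continuous_expTau.comp (by fun_prop)).mul (Complex.continuous_ofReal.comp (by fun_prop))
  have hint : ∀ t : ℤ, ∫ x, expTau (-(t * x)) * f x = q * ∫ x, expTau (q * (j * F x - t * x)) * (W x : ℂ) := by
    intro t
    have := MeasureTheory.Measure.integral_comp_div (fun x => expTau (q * (j * F x - t * x)) * (W x : ℂ)) (q : ℝ)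
    rw [abs_of_pos hq0, Complex.real_smul, Complex.ofReal_natCast] at this
    rw [← this]
    congr 1; ext x
    rw [hf]
    simp only
    rw [← mul_assoc, ← expTau_add]
    congr 2
    field_simp
    ring
  have hK : ∀ x, R * q < |x| → f x = 0 := by
    intro x hx
    have : R ≤ |x / q| := by
      rw [abs_div, abs_of_pos hq0, le_div_iff₀ hq0]; exact hx.le
    simp [hf, hW.eq_zero _ this]
  -- Here `B ^ 2 ≤ q` ensures that the roughness of the weight costs no more than the curvature
  -- term.
  have hjq : (j : ℝ) / q + B ^ 2 / q ^ 2 ≤ 2 * j / q := by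
    have : B ^ 2 / (q : ℝ) ^ 2 ≤ j / q := by
      rw [div_le_div_iff₀ (by positivity) hq0]
      calc B ^ 2 * (q : ℝ) ≤ q * q := by gcongr
        _ ≤ j * q ^ 2 := by nlinarith [mul_pos hq0 hq0]
    calc (j : ℝ) / q + B ^ 2 / q ^ 2 ≤ j / q + j / q := by gcongr
      _ = 2 * j / q := by ring
  have hP := norm_tsum_sub_sum_fourier_le hfc hK (D := q * (16 * R * (1 + 2 * M) * (2 * j / q))) (by positivity)
    (H := H) (by exact_mod_cast hH1) (by
      intro t ht
      have ht' : 2 * R₁ * j ≤ |(t : ℝ)| := hHle.trans (by exact_mod_cast ht)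
      have hn := h.norm_integral_le_of_nonstationary hR hR₁ hF₁ hW hq0 hj0 ht'
      rw [hint, norm_mul, Complex.norm_natCast]
      have : (0:ℝ) ≤ 16 * R * (1 + 2 * M) := by positivity
      calc (q : ℝ) * ‖∫ x, expTau (q * (j * F x - t * x)) * (W x : ℂ)‖
          ≤ q * ((16 * R * (1 + 2 * M)) * ((j / q + B ^ 2 / q ^ 2) / t ^ 2)) := by gcongr
        _ ≤ q * ((16 * R * (1 + 2 * M)) * ((2 * j / q) / t ^ 2)) := by gcongr
        _ = _ := by ring)
  have hD : (q * (16 * R * (1 + 2 * M) * (2 * j / q))) * (4 / (H : ℝ)) ≤ 64 * R * (1 + 2 * M) * 2 * 1 := by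
    have e1 : (q * (16 * R * (1 + 2 * M) * (2 * j / q))) * (4 / (H : ℝ)) = 64 * R * (1 + 2 * M) * 2 * (j / H) := by
      field_simp
      ring
    rw [e1]
    gcongr
    rw [div_le_one (by linarith)]
    nlinarith
  have hterm : ∀ t ∈ Finset.Ioo (-(H : ℤ)) H,
      ‖(∫ x, expTau (-(t * x)) * f x) - ((W (G (t / j)) * √(2 / F₂ (G (t / j))) : ℝ) : ℂ) * Γ *
            (((q * ((q : ℝ) * j) ^ (-(1 / 2) : ℝ) : ℝ) : ℂ) * expTau (q * -(j * g (t / j))))‖ ≤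
        q * (C * (((q : ℝ) * j) ^ (-(1 + θ) / 2) + B * ((q : ℝ) * j) ^ (-(1 + α) / 2))) := by
    intro t ht
    rw [Finset.mem_Ioo] at ht
    have htabs : |(t : ℝ)| ≤ 2 * R₁ * j := by
      have h1 : |t| < H := abs_lt.2 ht
      have h2 : (t.natAbs : ℝ) < 2 * R₁ * j := by
        refine Nat.lt_ceil.1 ?_
        rw [← hH]
        rw [Int.abs_eq_natAbs] at h1
        exact_mod_cast h1
      rw [Nat.cast_natAbs, Int.cast_abs] at h2
      exact h2.le
    have hx₀ : |G (t / j)| ≤ max R (3 * c * R₁) := by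
      refine le_max_of_le_right ?_
      have h1 := hd.abs_sub_le 0 (G (t / j))
      rw [sub_zero, hd.right_inv] at h1
      have h2 : |(t : ℝ) / j| ≤ 2 * R₁ := by
        rw [abs_div, abs_of_pos hj0, div_le_iff₀ hj0]; exact htabs
      have h3 := hF₁ 0 (by simpa using hR)
      have h4 := abs_sub ((t : ℝ) / j) (F₁ 0)
      calc |G (t / j)| ≤ c * |(t : ℝ) / j - F₁ 0| := h1
        _ ≤ c * (2 * R₁ + R₁) := by gcongr; linarith
        _ = _ := by ring
    have hlam : (1 : ℝ) ≤ (q : ℝ) * j := one_le_mul_of_one_le_of_one_le hq' hj'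
    have hs := hstat F F₁ F₂ h W W₁ B hW.hasDerivAt hW₁c
      (fun x => by rw [abs_of_nonneg (hW.nonneg x)]; exact hW.le_one x) hW.abs_le
      (fun x hx => hW.eq_zero x ((le_max_left _ _).trans hx.le)) (G (t / j)) hx₀ (q * j) hlam
    rw [hd.right_inv] at hs
    have e1 : (fun x : ℝ => expTau (q * j * (F x - t / j * x)) * (W x : ℂ)) =
        fun x => expTau (q * (j * F x - t * x)) * (W x : ℂ) := by
      ext x; congr 2; field_simp
    have e2 : (q : ℝ) * j * (F (G (t / j)) - t / j * G (t / j)) = q * -(j * g (t / j)) := by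
      rw [hd.legendre' (t / j)]; ring
    rw [e1, e2] at hs
    rw [hint]
    refine le_trans (le_of_eq ?_) (mul_le_mul_of_nonneg_left hs hq0.le)
    have hn : ∀ z : ℂ, (q : ℝ) * ‖z‖ = ‖(q : ℂ) * z‖ := fun z => by rw [norm_mul, Complex.norm_natCast]
    rw [hn]
    congr 1
    push_cast
    ring
  have hsum := norm_sum_le_of_le _ hterm
  rw [Finset.sum_const, nsmul_eq_mul, Finset.sum_sub_distrib, Int.card_Ioo] at hsum
  have hcard : (((H : ℤ) - -(H : ℤ) - 1).toNat : ℝ) ≤ 6 * R₁ * j := by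
    have : (((H : ℤ) - -(H : ℤ) - 1).toNat : ℝ) ≤ 2 * H := by
      have : ((H : ℤ) - -(H : ℤ) - 1).toNat ≤ 2 * H := by omega
      exact_mod_cast this
    linarith
  have hp : ∀ β : ℝ, ((q : ℝ) * j) * ((q : ℝ) * j) ^ (-(1 + β) / 2) = ((q : ℝ) * j) ^ ((1 - β) / 2) := by
    intro β
    nth_rewrite 1 [← Real.rpow_one ((q : ℝ) * j)]
    rw [← Real.rpow_add (by positivity)]
    congr 1; ring
  calc _ ≤ _ := norm_sub_le_norm_sub_add_norm_sub _ (∑ t ∈ Finset.Ioo (-(H : ℤ)) H, ∫ x, expTau (-(t * x)) * f x) _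
    _ ≤ 64 * R * (1 + 2 * M) * 2 * 1 +
        6 * R₁ * j * (q * (C * (((q : ℝ) * j) ^ (-(1 + θ) / 2) + B * ((q : ℝ) * j) ^ (-(1 + α) / 2)))) :=
      add_le_add (hP.trans hD) (hsum.trans (by gcongr))
    _ = 64 * R * (1 + 2 * M) * 2 * 1 +
        6 * R₁ * C * (((q : ℝ) * j) ^ ((1 - θ) / 2) + B * ((q : ℝ) * j) ^ ((1 - α) / 2)) := by
        rw [← hp, ← hp]; ring
    _ ≤ _ := by
        have a1 : 0 ≤ 64 * R * (1 + 2 * M) * 2 := by positivity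
        have a2 : 0 ≤ 6 * R₁ * C := by positivity
        have a3 : 0 ≤ ((q : ℝ) * j) ^ ((1 - θ) / 2) + B * ((q : ℝ) * j) ^ ((1 - α) / 2) := by positivity
        nlinarith

/-! ### Exponential sums over both variables -/

theorem distInt_le (x : ℝ) (n : ℤ) : distInt x ≤ |x - n| := round_le x n

theorem distInt_neg (x : ℝ) : distInt (-x) = distInt x := by
  refine le_antisymm ?_ ?_
  · refine (distInt_le (-x) (-round x)).trans_eq ?_
    rw [distInt, ← abs_neg (x - round x)]
    push_cast; ring_nf
  · refine (distInt_le x (-round (-x))).trans_eq ?_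
    rw [distInt, ← abs_neg (-x - round (-x))]
    push_cast; ring_nf

theorem four_mul_distInt_le (β : ℝ) : 4 * distInt β ≤ ‖expTau β - 1‖ := by
  have h1 : expTau β = expTau (β - round β) := by
    rw [← mul_one (expTau (β - round β)), ← expTau_int (round β), ← expTau_add, sub_add_cancel]
  have h2 : ∀ y : ℝ, ‖expTau y - 1‖ = 2 * |Real.sin (Real.pi * y)| := by
    intro y
    have := Complex.norm_exp_I_mul_ofReal_sub_one (2 * Real.pi * y)
    rw [norm_mul, Real.norm_eq_abs, Real.norm_eq_abs, abs_two] at this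
    rw [show Real.pi * y = 2 * Real.pi * y / 2 by ring, ← this, expTau]
    congr 3; push_cast; ring
  rw [h1, h2]
  have h3 := abs_sub_round β
  have h4 := Real.mul_abs_le_abs_sin (x := Real.pi * (β - round β)) (by
    rw [abs_mul, abs_of_pos Real.pi_pos]; nlinarith [Real.pi_pos])
  rw [abs_mul, abs_of_pos Real.pi_pos, ← mul_assoc, div_mul_cancel₀ _ Real.pi_ne_zero] at h4
  rw [distInt]; linarith

/-- A sum of `√q e(qβ)` over an interval. -/
theorem norm_sum_sqrt_mul_expTau_mul_distInt_le (β : ℝ) {M N : ℕ} (hMN : M ≤ N) :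
    2 * (‖∑ q ∈ Finset.Ioc M N, ((√q : ℝ) : ℂ) * expTau (q * β)‖ * distInt β) ≤ √N := by
  -- Summation by parts in inductive form: multiplying by `expTau β - 1` telescopes the sum up to a
  -- boundary term, and the increments of `√q` add up to at most `√N - √M`.
  have key : ‖(expTau β - 1) * ∑ q ∈ Finset.Ioc M N, ((√q : ℝ) : ℂ) * expTau (q * β) -
      ((√N : ℝ) : ℂ) * expTau ((N + 1) * β)‖ ≤ √N := by
    induction N, hMN using Nat.le_induction with
    | base => simp [norm_expTau, abs_of_nonneg (Real.sqrt_nonneg _)]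
    | succ N hMN ih =>
      have e : expTau ((((N + 1 : ℕ) : ℝ) + 1) * β) = expTau β * expTau (((N : ℝ) + 1) * β) := by
        rw [← expTau_add]; push_cast; ring_nf
      have hs : √(N : ℝ) ≤ √((N + 1 : ℕ) : ℝ) := Real.sqrt_le_sqrt (by push_cast; linarith)
      rw [Finset.sum_Ioc_succ_top hMN, e, show (((N + 1 : ℕ) : ℝ)) * β = ((N : ℝ) + 1) * β by push_cast; ring]
      calc _ = ‖((expTau β - 1) * ∑ q ∈ Finset.Ioc M N, ((√q : ℝ) : ℂ) * expTau (q * β) -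
            ((√N : ℝ) : ℂ) * expTau ((N + 1) * β)) -
            ((√((N + 1 : ℕ) : ℝ) - √N : ℝ) : ℂ) * expTau ((N + 1) * β)‖ := by
              congr 1; rw [Complex.ofReal_sub]; ring
        _ ≤ √N + (√((N + 1 : ℕ) : ℝ) - √N) := by
            refine (norm_sub_le _ _).trans (add_le_add ih ?_)
            rw [norm_mul, norm_expTau, Complex.norm_real, Real.norm_of_nonneg (by linarith), mul_one]
        _ = _ := by ring
  have h1 : ‖(expTau β - 1) * ∑ q ∈ Finset.Ioc M N, ((√q : ℝ) : ℂ) * expTau (q * β)‖ ≤ √N + √N := by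
    refine (norm_le_norm_sub_add _ (((√N : ℝ) : ℂ) * expTau ((N + 1) * β))).trans ?_
    refine add_le_add key ?_
    rw [norm_mul, norm_expTau, Complex.norm_real, Real.norm_of_nonneg (Real.sqrt_nonneg _), mul_one]
  rw [norm_mul] at h1
  have := mul_le_mul_of_nonneg_right (four_mul_distInt_le β)
    (norm_nonneg (∑ q ∈ Finset.Ioc M N, ((√q : ℝ) : ℂ) * expTau (q * β)))
  linarith

theorem norm_sum_sqrt_mul_expTau_le (β : ℝ) (M N : ℕ) :
    ‖∑ q ∈ Finset.Ioc M N, ((√q : ℝ) : ℂ) * expTau (q * β)‖ ≤ (N - M : ℕ) * √N := by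
  rw [← Nat.card_Ioc, ← nsmul_eq_mul]
  refine (norm_sum_le_of_le _ fun q hq => ?_).trans_eq (Finset.sum_const _)
  rw [norm_mul, norm_expTau, Complex.norm_real, Real.norm_of_nonneg (Real.sqrt_nonneg _), mul_one]
  exact Real.sqrt_le_sqrt (by exact_mod_cast (Finset.mem_Ioc.1 hq).2)

/-- The sums over `q` and `a`, on average over a dyadic block of frequencies. -/
theorem IsCurve.exists_dyadic_sum_le {m M L θ α c R R₁ e : ℝ} {F F₁ F₂ g G : ℝ → ℝ} (h : IsCurve m M L θ F F₁ F₂)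
    (hθ : 0 < θ) (hθ1 : θ < 1) (hα : 0 < α) (hα1 : α < 1) (he : 0 < e) (hL : 0 ≤ L) (hd : IsDualPair c F F₁ g G) (hR : 0 ≤ R)
    (hR₁ : 1 ≤ R₁) (hF₁ : ∀ x, |x| ≤ R → |F₁ x| ≤ R₁) :
    ∃ C > 0, ∀ B W W₁ W₂, IsWeight R B W W₁ W₂ → ∀ (Q : ℝ) (J : ℕ), 1 ≤ Q → 1 ≤ J → B ^ 2 ≤ Q →
      ∑ j ∈ Finset.Ico J (2 * J), ‖∑ q ∈ Finset.Ioc ⌊Q⌋₊ ⌊2 * Q⌋₊,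
        ∑' a : ℤ, expTau (j * (q * F (a / q))) * (W (a / q) : ℂ)‖ ≤
      C * ((J : ℝ) ^ (1 / 2 + e) * √Q * (Q + Q ^ e * J) + (Q * J) ^ ((3 - θ) / 2) + B * (Q * J) ^ ((3 - α) / 2)) := by
  classical
  obtain ⟨C, hC, Γ, hpoisson⟩ := h.exists_poisson_stationary hθ hθ1 hα hα1 hL hd hR hR₁ hF₁
  obtain ⟨A, hA, hcount⟩ := exists_sum_reciprocal_distInt_le hd.one_le he
  have hc := hd.one_le
  have hm := h.pos
  -- The relevant `t / j` fill the closed interval `[-R₁, R₁]`, and the count uses half-open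
  -- intervals; hence the extra `1`.
  set M₀ : ℕ := ⌈2 * R₁⌉₊ + 1 with hM₀
  set K := √(2 / m) * ‖Γ‖ with hK
  have hK0 : 0 ≤ K := by positivity
  refine ⟨4 * K * A * M₀ + 6 * C, by positivity, ?_⟩
  intro B W W₁ W₂ hW Q J hQ hJ hBQ
  have hB := hW.one_le
  have hJ' : (1 : ℝ) ≤ J := by exact_mod_cast hJ
  have hQ0 : 0 < Q := by linarith
  have hq : ∀ q ∈ Finset.Ioc ⌊Q⌋₊ ⌊2 * Q⌋₊, Q < q ∧ (q : ℝ) ≤ 2 * Q := by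
    intro q hq
    rw [Finset.mem_Ioc] at hq
    exact ⟨(Nat.floor_lt hQ0.le).1 hq.1, (Nat.le_floor_iff (by linarith)).1 hq.2⟩
  have hcard : ((⌊2 * Q⌋₊ - ⌊Q⌋₊ : ℕ) : ℝ) ≤ 2 * Q :=
    le_trans (by exact_mod_cast Nat.sub_le _ _) (Nat.floor_le (by linarith : 0 ≤ 2 * Q))
  have hN : √(⌊2 * Q⌋₊ : ℝ) ≤ 2 * √Q := by
    refine Real.sqrt_le_iff.2 ⟨by positivity, ?_⟩
    rw [mul_pow, Real.sq_sqrt hQ0.le]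
    linarith [Nat.floor_le (by linarith : 0 ≤ 2 * Q)]
  have hsQ : 0 < √Q := Real.sqrt_pos.2 hQ0
  -- The division by `4 * √Q` normalises the sum over `q` so that `V β ≤ Q` and `V β * distInt β ≤
  -- 1`, the two conditions of the weighted count.
  set V : ℝ → ℝ := fun β => ‖∑ q ∈ Finset.Ioc ⌊Q⌋₊ ⌊2 * Q⌋₊, ((√q : ℝ) : ℂ) * expTau (q * β)‖ / (4 * √Q) with hV
  have hV0 : ∀ β, 0 ≤ V β := fun β => by positivity
  have hV1 : ∀ β, V β ≤ Q ∧ V β * distInt β ≤ 1 := by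
    intro β
    constructor
    · rw [hV]
      simp only
      rw [div_le_iff₀ (by positivity)]
      refine (norm_sum_sqrt_mul_expTau_le _ _ _).trans ?_
      calc ((⌊2 * Q⌋₊ - ⌊Q⌋₊ : ℕ) : ℝ) * √(⌊2 * Q⌋₊ : ℝ) ≤ (2 * Q) * (2 * √Q) := by gcongr
        _ = _ := by ring
    · have := norm_sum_sqrt_mul_expTau_mul_distInt_le β (Nat.floor_le_floor (by linarith : Q ≤ 2 * Q))
      rw [hV]
      simp only
      rw [div_mul_eq_mul_div, div_le_one (by positivity)]
      linarith
  set X := (Q * J) ^ ((3 - θ) / 2) + B * (Q * J) ^ ((3 - α) / 2) with hX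
  -- a single frequency
  have hone : ∀ j ∈ Finset.Ico J (2 * J), ‖∑ q ∈ Finset.Ioc ⌊Q⌋₊ ⌊2 * Q⌋₊,
      ∑' a : ℤ, expTau (j * (q * F (a / q))) * (W (a / q) : ℂ)‖ ≤
      K * (J : ℝ) ^ (-(1 / 2) : ℝ) * (4 * √Q) *
        (∑ t ∈ (Finset.Ioo (-(⌈2 * R₁ * j⌉₊ : ℤ)) (⌈2 * R₁ * j⌉₊ : ℤ)).filter (fun t : ℤ => W (G (t / j)) ≠ 0),
          V (-(j * g (t / j)))) + 6 * C * X / J := by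
    intro j hj
    rw [Finset.mem_Ico] at hj
    have hj1 : 1 ≤ j := hJ.trans hj.1
    have hjJ : (J : ℝ) ≤ j := by exact_mod_cast hj.1
    have hjJ2 : (j : ℝ) ≤ 2 * J := by exact_mod_cast hj.2.le
    have hj0 : (0 : ℝ) < j := by exact_mod_cast hj1
    have herr : ∀ q ∈ Finset.Ioc ⌊Q⌋₊ ⌊2 * Q⌋₊, C * (1 + ((q : ℝ) * j) ^ ((1 - θ) / 2) + B * ((q : ℝ) * j) ^ ((1 - α) / 2)) ≤
        C * (3 * ((Q * J) ^ ((1 - θ) / 2) + B * (Q * J) ^ ((1 - α) / 2))) := by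
      intro q hq'
      have hp : ∀ β : ℝ, 0 < β → β < 1 → ((q : ℝ) * j) ^ ((1 - β) / 2) ≤ 2 * (Q * J) ^ ((1 - β) / 2) := by
        intro β hβ hβ1
        calc ((q : ℝ) * j) ^ ((1 - β) / 2) ≤ (4 * (Q * J)) ^ ((1 - β) / 2) := by
              refine Real.rpow_le_rpow (by positivity) ?_ (by linarith)
              calc (q : ℝ) * j ≤ (2 * Q) * (2 * J) := by gcongr; exact (hq q hq').2
                _ = _ := by ring
          _ = 4 ^ ((1 - β) / 2) * (Q * J) ^ ((1 - β) / 2) := Real.mul_rpow (by norm_num) (by positivity)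
          _ ≤ 4 ^ (1 / 2 : ℝ) * (Q * J) ^ ((1 - β) / 2) := by
              gcongr
              · norm_num
              · linarith
          _ = _ := by
              rw [← Real.sqrt_eq_rpow, show (4 : ℝ) = 2 ^ 2 by norm_num, Real.sqrt_sq (by norm_num)]
      have h1 : 1 ≤ (Q * J) ^ ((1 - θ) / 2) :=
        Real.one_le_rpow (one_le_mul_of_one_le_of_one_le hQ hJ') (by linarith)
      have h2 := hp θ hθ hθ1
      have h3 := mul_le_mul_of_nonneg_left (hp α hα hα1) (zero_le_one.trans hB)
      have h4 : 0 ≤ B * (Q * J) ^ ((1 - α) / 2) := by positivity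
      gcongr
      linarith
    have hmain : ‖∑ q ∈ Finset.Ioc ⌊Q⌋₊ ⌊2 * Q⌋₊, ∑ t ∈ Finset.Ioo (-(⌈2 * R₁ * j⌉₊ : ℤ)) (⌈2 * R₁ * j⌉₊ : ℤ),
          ((W (G (t / j)) * √(2 / F₂ (G (t / j))) : ℝ) : ℂ) * Γ *
            (((q * ((q : ℝ) * j) ^ (-(1 / 2) : ℝ) : ℝ) : ℂ) * expTau (q * -(j * g (t / j))))‖ ≤
        K * (J : ℝ) ^ (-(1 / 2) : ℝ) * (4 * √Q) *
        (∑ t ∈ (Finset.Ioo (-(⌈2 * R₁ * j⌉₊ : ℤ)) (⌈2 * R₁ * j⌉₊ : ℤ)).filter (fun t : ℤ => W (G (t / j)) ≠ 0),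
          V (-(j * g (t / j)))) := by
      -- For fixed `j` and `t` the phase is linear in `q`, so the sum over `q` is taken first.
      -- Discarding the `t` with `W (G (t / j)) = 0` keeps the stationary point in the support and
      -- thereby `t / j` in `[-R₁, R₁]`.
      rw [Finset.sum_comm, Finset.mul_sum, ← Finset.sum_filter_of_ne (p := fun t : ℤ => W (G (t / j)) ≠ 0)]
      · refine norm_sum_le_of_le _ fun t _ => ?_
        have e1 : ∀ q ∈ Finset.Ioc ⌊Q⌋₊ ⌊2 * Q⌋₊, (q : ℝ) * ((q : ℝ) * j) ^ (-(1 / 2) : ℝ) = (j : ℝ) ^ (-(1 / 2) : ℝ) * √q := by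
          intro q hq'
          have : (0:ℝ) < q := hQ0.trans (hq q hq').1
          rw [Real.mul_rpow this.le hj0.le, ← mul_assoc, Real.sqrt_eq_rpow, mul_comm]
          rw [← Real.rpow_one_add' this.le (by norm_num)]
          norm_num
        rw [← Finset.mul_sum]
        have e2 : ∑ q ∈ Finset.Ioc ⌊Q⌋₊ ⌊2 * Q⌋₊,
            (((q * ((q : ℝ) * j) ^ (-(1 / 2) : ℝ) : ℝ) : ℂ) * expTau (q * -(j * g (t / j)))) =
            (((j : ℝ) ^ (-(1 / 2) : ℝ) : ℝ) : ℂ) * ∑ q ∈ Finset.Ioc ⌊Q⌋₊ ⌊2 * Q⌋₊,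
              ((√q : ℝ) : ℂ) * expTau (q * -(j * g (t / j))) := by
          rw [Finset.mul_sum]
          refine Finset.sum_congr rfl fun q hq' => ?_
          rw [e1 q hq', Complex.ofReal_mul]; ring
        have e3 : ‖∑ q ∈ Finset.Ioc ⌊Q⌋₊ ⌊2 * Q⌋₊, ((√q : ℝ) : ℂ) * expTau (q * -(j * g (t / j)))‖ =
            4 * √Q * V (-(j * g (t / j))) := by
          exact (mul_div_cancel₀ _ (by positivity)).symm
        rw [e2, norm_mul, norm_mul, norm_mul, e3, Complex.norm_real, Complex.norm_real, norm_mul,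
          Real.norm_of_nonneg (hW.nonneg _), Real.norm_of_nonneg (Real.sqrt_nonneg _),
          Real.norm_of_nonneg (by positivity : 0 ≤ (j : ℝ) ^ (-(1 / 2) : ℝ))]
        have e4 : (j : ℝ) ^ (-(1 / 2) : ℝ) ≤ (J : ℝ) ^ (-(1 / 2) : ℝ) :=
          Real.rpow_le_rpow_of_nonpos (by linarith) hjJ (by norm_num)
        have e5 : W (G (t / j)) * √(2 / F₂ (G (t / j))) ≤ √(2 / m) := by
          rw [← one_mul √(2 / m)]
          refine mul_le_mul (hW.le_one _) (Real.sqrt_le_sqrt ?_) (Real.sqrt_nonneg _) zero_le_one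
          exact div_le_div_of_nonneg_left (by norm_num) hm (h.le _)
        have e6 := hV0 (-(j * g (t / j)))
        calc _ ≤ √(2 / m) * ‖Γ‖ * ((J : ℝ) ^ (-(1 / 2) : ℝ) * (4 * √Q * V (-(j * g (t / j))))) := by gcongr
          _ = _ := by rw [hK]; ring
      · intro t _ hne h0
        exact hne (by simp [h0])
    calc _ ≤ _ := norm_le_norm_sub_add _ (∑ q ∈ Finset.Ioc ⌊Q⌋₊ ⌊2 * Q⌋₊,
          ∑ t ∈ Finset.Ioo (-(⌈2 * R₁ * j⌉₊ : ℤ)) (⌈2 * R₁ * j⌉₊ : ℤ),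
          ((W (G (t / j)) * √(2 / F₂ (G (t / j))) : ℝ) : ℂ) * Γ *
            (((q * ((q : ℝ) * j) ^ (-(1 / 2) : ℝ) : ℝ) : ℂ) * expTau (q * -(j * g (t / j)))))
      _ ≤ 6 * C * X / J + _ := by
          refine add_le_add ?_ hmain
          rw [← Finset.sum_sub_distrib]
          refine (norm_sum_le_of_le _ fun q hq' => (hpoisson B W W₁ W₂ hW q j ?_ hj1 ?_).trans (herr q hq')).trans ?_
          · have := (hq q hq').1
            have : (1:ℝ) ≤ q := by linarith
            exact_mod_cast this
          · exact hBQ.trans (hq q hq').1.le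
          · rw [Finset.sum_const, Nat.card_Ioc, nsmul_eq_mul]
            have hp : ∀ β : ℝ, (Q * J) ^ ((3 - β) / 2) = (Q * J) * (Q * J) ^ ((1 - β) / 2) := by
              intro β
              nth_rewrite 2 [← Real.rpow_one (Q * (J : ℝ))]
              rw [← Real.rpow_add (by positivity)]
              congr 1; ring
            calc ((⌊2 * Q⌋₊ - ⌊Q⌋₊ : ℕ) : ℝ) * (C * (3 * ((Q * J) ^ ((1 - θ) / 2) + B * (Q * J) ^ ((1 - α) / 2))))
                ≤ 2 * Q * (C * (3 * ((Q * J) ^ ((1 - θ) / 2) + B * (Q * J) ^ ((1 - α) / 2)))) := by gcongr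
              _ = _ := by rw [hX, hp, hp]; field_simp; ring
      _ = _ := by rw [add_comm]
  -- the dual points
  have hdual : ∑ j ∈ Finset.Ico J (2 * J),
      ∑ t ∈ (Finset.Ioo (-(⌈2 * R₁ * j⌉₊ : ℤ)) (⌈2 * R₁ * j⌉₊ : ℤ)).filter (fun t : ℤ => W (G (t / j)) ≠ 0),
          V (-(j * g (t / j))) ≤ A * (M₀ * ((J : ℝ) ^ (1 + e) * (Q + Q ^ e * J))) := by
    rw [Finset.sum_sigma']
    set S := (Finset.Ico J (2 * J)).sigma fun j =>
      (Finset.Ioo (-(⌈2 * R₁ * j⌉₊ : ℤ)) (⌈2 * R₁ * j⌉₊ : ℤ)).filter (fun t : ℤ => W (G (t / j)) ≠ 0) with hS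
    have hinj : Set.InjOn (fun p : (_ : ℕ) × ℤ => ((p.1 : ℤ), p.2)) S := by
      rintro ⟨a, b⟩ - ⟨a', b'⟩ - hab
      simpa using hab
    -- Here the roles change: the frequency `j` becomes the denominator, the dual variable `t` the
    -- numerator, and the curve is the graph of `g`.
    have := hcount g G F F₁ hd.symm (-R₁) M₀ J Q hJ' hQ (S.image fun p => ((p.1 : ℤ), p.2))
      (fun p => V (-(p.1 * g ((p.2 : ℝ) / p.1)))) ?_ ?_
    · rw [Finset.sum_image hinj] at this
      simpa using this
    · intro p hp
      obtain ⟨⟨j, t⟩, hjt, rfl⟩ := Finset.mem_image.1 hp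
      rw [hS, Finset.mem_sigma, Finset.mem_filter, Finset.mem_Ico] at hjt
      obtain ⟨⟨h1, h2⟩, -, h3⟩ := hjt
      simp only at h1 h2 h3 ⊢
      have h4 : |G (t / j)| ≤ R := by
        by_contra! hlt
        exact h3 (hW.eq_zero _ hlt.le)
      have h5 := hF₁ _ h4
      rw [hd.right_inv, abs_le] at h5
      have h6 : 2 * R₁ < M₀ := by
        rw [hM₀]; push_cast; linarith [Nat.le_ceil (2 * R₁)]
      push_cast
      refine ⟨by exact_mod_cast h1, by exact_mod_cast h2.le, h5.1, by linarith [h5.2]⟩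
    · intro p hp
      have := hV1 (-(p.1 * g ((p.2 : ℝ) / p.1)))
      rwa [distInt_neg] at this
  calc _ ≤ _ := Finset.sum_le_sum hone
    _ = K * (J : ℝ) ^ (-(1 / 2) : ℝ) * (4 * √Q) * (∑ j ∈ Finset.Ico J (2 * J),
      ∑ t ∈ (Finset.Ioo (-(⌈2 * R₁ * j⌉₊ : ℤ)) (⌈2 * R₁ * j⌉₊ : ℤ)).filter (fun t : ℤ => W (G (t / j)) ≠ 0),
          V (-(j * g (t / j)))) + 6 * C * X := by
        rw [Finset.sum_add_distrib, ← Finset.mul_sum, Finset.sum_const, Nat.card_Ico, nsmul_eq_mul,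
          show 2 * J - J = J by omega, mul_div_cancel₀ _ (by positivity)]
    _ ≤ K * (J : ℝ) ^ (-(1 / 2) : ℝ) * (4 * √Q) * (A * (M₀ * ((J : ℝ) ^ (1 + e) * (Q + Q ^ e * J)))) + 6 * C * X := by
        gcongr
    _ = 4 * K * A * M₀ * ((J : ℝ) ^ (1 / 2 + e) * √Q * (Q + Q ^ e * J)) + 6 * C * X := by
        have : (J : ℝ) ^ (1 / 2 + e) = (J : ℝ) ^ (-(1 / 2) : ℝ) * (J : ℝ) ^ (1 + e) := by
          rw [← Real.rpow_add (by positivity)]; congr 1; ring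
        rw [this]; ring
    _ ≤ (4 * K * A * M₀ + 6 * C) * ((J : ℝ) ^ (1 / 2 + e) * √Q * (Q + Q ^ e * J) + X) := by
        have a1 : 0 ≤ 4 * K * A * M₀ := by positivity
        have a2 : 0 ≤ (J : ℝ) ^ (1 / 2 + e) * √Q * (Q + Q ^ e * J) := by positivity
        have a3 : 0 ≤ X := by positivity
        nlinarith [mul_nonneg a1 a3, mul_nonneg hC.le a2]
    _ = _ := by rw [hX]; ring

/-! ### Periodic trapezoids and their Fourier series -/

/-- The periodic function with value `y ^ 2 - y + 1 / 6` on `[0, 1)`. -/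
noncomputable def periodicB (y : ℝ) : ℝ := Int.fract y ^ 2 - Int.fract y + 1 / 6

theorem periodicB_eq {y : ℝ} (hy : |y| ≤ 1) : periodicB y = y ^ 2 - |y| + 1 / 6 := by
  rw [abs_le] at hy
  rw [periodicB]
  rcases lt_or_ge y 0 with h | h
  · rw [abs_of_neg h]
    rcases hy.1.eq_or_lt with rfl | h1
    · norm_num
    · have : Int.fract y = y + 1 := by
        rw [Int.fract_eq_iff]; exact ⟨by linarith, by linarith, -1, by push_cast; ring⟩
      rw [this]; ring
  · rw [abs_of_nonneg h]
    rcases hy.2.eq_or_lt with rfl | h1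
    · norm_num
    · rw [Int.fract_eq_self.2 ⟨h, h1⟩]

/-- The formula valid for `|y| ≤ 1` is an upper bound everywhere, since beyond that range `y ^ 2 -
|y|` is positive while the periodic function never exceeds `1 / 6`. -/
theorem periodicB_le (y : ℝ) : periodicB y ≤ y ^ 2 - |y| + 1 / 6 := by
  rcases le_or_gt |y| 1 with h | h
  · exact (periodicB_eq h).le
  · rw [periodicB, ← sq_abs y]
    nlinarith [Int.fract_nonneg y, Int.fract_lt_one y]

theorem hasSum_cos_periodicB (y : ℝ) :
    HasSum (fun n : ℕ => 1 / (n : ℝ) ^ 2 * Real.cos (2 * Real.pi * n * y)) (Real.pi ^ 2 * periodicB y) := by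
  have h := hasSum_one_div_nat_pow_mul_cos one_ne_zero (x := Int.fract y) ⟨Int.fract_nonneg y, (Int.fract_lt_one y).le⟩
  have e : ∀ n : ℕ, Real.cos (2 * Real.pi * n * Int.fract y) = Real.cos (2 * Real.pi * n * y) := by
    intro n
    have := Real.cos_sub_int_mul_two_pi (2 * Real.pi * n * y) (n * ⌊y⌋)
    rw [← this, Int.fract]
    congr 1; push_cast; ring
  simp only [e, mul_one] at h
  convert h using 1
  have : (Polynomial.map (algebraMap ℚ ℝ) (Polynomial.bernoulli 2)).eval (Int.fract y) = periodicB y := by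
    rw [periodicB, Polynomial.bernoulli]
    simp [Finset.sum_range_succ, Polynomial.eval_add]
    ring
  rw [this]
  norm_num [Nat.factorial]
  left; ring

/-- The periodic trapezoid function, of height one on `[-α, α]` and vanishing off `[-β, β]`. -/
noncomputable def trapezoid (α β x : ℝ) : ℝ :=
  α + β + (periodicB (x + α) + periodicB (x - α) - periodicB (x + β) - periodicB (x - β)) / (2 * (β - α))

theorem periodicB_add_int (y : ℝ) (n : ℤ) : periodicB (y + n) = periodicB y := by
  rw [periodicB, periodicB, Int.fract_add_intCast]

theorem trapezoid_sub_round (α β x : ℝ) : trapezoid α β (x - round x) = trapezoid α β x := by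
  have : ∀ c, periodicB (x - round x + c) = periodicB (x + c) := by
    intro c
    rw [← periodicB_add_int (x - round x + c) (round x)]; congr 1; ring
  have hsub : ∀ c, periodicB (x - round x - c) = periodicB (x - c) := fun c => this (-c)
  rw [trapezoid, trapezoid, this, this, hsub, hsub]

theorem sum_max_abs {x α : ℝ} (hα : 0 ≤ α) : |x + α| + |x - α| = 2 * max |x| α := by
  rcases le_total |x| α with h | h
  · rw [max_eq_right h]; rw [abs_le] at h
    rw [abs_of_nonneg (by linarith), abs_of_nonpos (by linarith)]; ring
  · rw [max_eq_left h]
    rcases le_abs'.1 h with h1 | h1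
    · rw [abs_of_nonpos (by linarith), abs_of_nonpos (by linarith), abs_of_nonpos (by linarith)]; ring
    · rw [abs_of_nonneg (by linarith), abs_of_nonneg (by linarith), abs_of_nonneg (by linarith)]; ring

/-- In the combination of the four parabolas the squares reduce to constants and the absolute values
to maxima. The outer width `β` may exceed `1 / 2`, and then `z ± β` may leave `[-1, 1]`. The
inequality survives because the `β` terms enter with a minus sign. Only this one-sided bound is
needed for the outer trapezoid. -/
theorem le_trapezoid {α β : ℝ} (hα : 0 ≤ α) (hα2 : α ≤ 1 / 2) (hαβ : α < β) (x : ℝ) :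
    (max (distInt x) β - max (distInt x) α) / (β - α) ≤ trapezoid α β x := by
  rw [← trapezoid_sub_round, distInt]
  have hx := abs_sub_round x
  set z := x - round x
  have h0 : 0 < β - α := by linarith
  have h1 := periodicB_eq (y := z + α) ((abs_add_le _ _).trans (by rw [abs_of_nonneg hα]; linarith))
  have h2 := periodicB_eq (y := z - α) ((abs_sub _ _).trans (by rw [abs_of_nonneg hα]; linarith))
  have h3 := periodicB_le (z + β)
  have h4 := periodicB_le (z - β)
  have h5 := sum_max_abs (x := z) hα
  have h6 := sum_max_abs (x := z) (hα.trans hαβ.le)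
  rw [trapezoid, ← sub_le_iff_le_add', div_sub' h0.ne', div_le_div_iff₀ h0 (by linarith)]
  have : 2 * (max |z| β - max |z| α - (β - α) * (α + β)) ≤
      periodicB (z + α) + periodicB (z - α) - periodicB (z + β) - periodicB (z - β) := by nlinarith
  nlinarith

theorem trapezoid_eq {α β : ℝ} (hα : 0 ≤ α) (hβ2 : β ≤ 1 / 2) (hαβ : α < β) (x : ℝ) :
    trapezoid α β x = (max (distInt x) β - max (distInt x) α) / (β - α) := by
  rw [← trapezoid_sub_round, distInt]
  have hx := abs_sub_round x
  set z := x - round x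
  have h0 : 0 < β - α := by linarith
  have h1 := periodicB_eq (y := z + α) ((abs_add_le _ _).trans (by rw [abs_of_nonneg hα]; linarith))
  have h2 := periodicB_eq (y := z - α) ((abs_sub _ _).trans (by rw [abs_of_nonneg hα]; linarith))
  have h3 := periodicB_eq (y := z + β) ((abs_add_le _ _).trans (by rw [abs_of_nonneg (hα.trans hαβ.le)]; linarith))
  have h4 := periodicB_eq (y := z - β) ((abs_sub _ _).trans (by rw [abs_of_nonneg (hα.trans hαβ.le)]; linarith))
  have h5 := sum_max_abs (x := z) hα
  have h6 := sum_max_abs (x := z) (hα.trans hαβ.le)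
  rw [trapezoid, eq_div_iff h0.ne', add_mul]
  have h7 : ∀ A : ℝ, A / (2 * (β - α)) * (β - α) = A / 2 := fun A => by field_simp
  rw [h7]
  linarith

theorem trapezoid_nonneg_of_le_half {α β : ℝ} (hα : 0 ≤ α) (hα2 : α ≤ 1 / 2) (hαβ : α < β) (x : ℝ) :
    0 ≤ trapezoid α β x :=
  (div_nonneg (sub_nonneg.2 (max_le_max le_rfl hαβ.le)) (by linarith)).trans (le_trapezoid hα hα2 hαβ x)

theorem one_le_trapezoid {α β : ℝ} (hα : 0 ≤ α) (hα2 : α ≤ 1 / 2) (hαβ : α < β) {x : ℝ} (hx : distInt x ≤ α) :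
    1 ≤ trapezoid α β x := by
  refine le_trans (le_of_eq ?_) (le_trapezoid hα hα2 hαβ x)
  rw [max_eq_right hx, max_eq_right (hx.trans hαβ.le), div_self (by linarith)]

theorem trapezoid_le_one {α β : ℝ} (hα : 0 ≤ α) (hβ2 : β ≤ 1 / 2) (hαβ : α < β) (x : ℝ) :
    trapezoid α β x ≤ 1 := by
  rw [trapezoid_eq hα hβ2 hαβ, div_le_one (by linarith)]
  rcases le_total (distInt x) β with h | h
  · rw [max_eq_right h]; linarith [le_max_right (distInt x) α]
  · rw [max_eq_left h]; linarith [le_max_left (distInt x) α]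

theorem trapezoid_eq_zero {α β : ℝ} (hα : 0 ≤ α) (hβ2 : β ≤ 1 / 2) (hαβ : α < β) {x : ℝ} (hx : β ≤ distInt x) :
    trapezoid α β x = 0 := by
  rw [trapezoid_eq hα hβ2 hαβ, max_eq_left hx, max_eq_left (hαβ.le.trans hx), sub_self, zero_div]

/-- The Fourier coefficients of the trapezoid. -/
noncomputable def trapezoidCoeff (α β : ℝ) (n : ℕ) : ℝ :=
  (Real.cos (2 * Real.pi * n * α) - Real.cos (2 * Real.pi * n * β)) / ((β - α) * Real.pi ^ 2 * n ^ 2)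

/-- The cosine series of the second Bernoulli function, with addition formulas for the four shifts;
the sine terms cancel in pairs. The mean value is `α + β`, and the term `n = 0` is zero because of
the division by zero. -/
theorem hasSum_trapezoid {α β : ℝ} (hαβ : α < β) (x : ℝ) :
    HasSum (fun n : ℕ => trapezoidCoeff α β n * Real.cos (2 * Real.pi * n * x)) (trapezoid α β x - (α + β)) := by
  have h := (((hasSum_cos_periodicB (x + α)).add (hasSum_cos_periodicB (x - α))).sub
    ((hasSum_cos_periodicB (x + β)).add (hasSum_cos_periodicB (x - β)))).mul_left (1 / (2 * (β - α) * Real.pi ^ 2))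
  have h0 : β - α ≠ 0 := by linarith
  have hpi := Real.pi_ne_zero
  have e1 : (fun n : ℕ => trapezoidCoeff α β n * Real.cos (2 * Real.pi * n * x)) = fun n : ℕ =>
      1 / (2 * (β - α) * Real.pi ^ 2) *
        (1 / (n : ℝ) ^ 2 * Real.cos (2 * Real.pi * n * (x + α)) + 1 / (n : ℝ) ^ 2 * Real.cos (2 * Real.pi * n * (x - α)) -
          (1 / (n : ℝ) ^ 2 * Real.cos (2 * Real.pi * n * (x + β)) + 1 / (n : ℝ) ^ 2 * Real.cos (2 * Real.pi * n * (x - β)))) := by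
    ext n
    have ha : ∀ a, Real.cos (2 * Real.pi * n * (x + a)) = Real.cos (2 * Real.pi * n * x) * Real.cos (2 * Real.pi * n * a) -
        Real.sin (2 * Real.pi * n * x) * Real.sin (2 * Real.pi * n * a) := fun a => by rw [mul_add, Real.cos_add]
    have hs : ∀ a, Real.cos (2 * Real.pi * n * (x - a)) = Real.cos (2 * Real.pi * n * x) * Real.cos (2 * Real.pi * n * a) +
        Real.sin (2 * Real.pi * n * x) * Real.sin (2 * Real.pi * n * a) := fun a => by rw [mul_sub, Real.cos_sub]
    rw [ha, ha, hs, hs, trapezoidCoeff]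
    rcases eq_or_ne n 0 with rfl | hn
    · simp
    · have : (n : ℝ) ≠ 0 := by exact_mod_cast hn
      field_simp
      ring
  have e2 : trapezoid α β x - (α + β) = 1 / (2 * (β - α) * Real.pi ^ 2) *
      (Real.pi ^ 2 * periodicB (x + α) + Real.pi ^ 2 * periodicB (x - α) -
        (Real.pi ^ 2 * periodicB (x + β) + Real.pi ^ 2 * periodicB (x - β))) := by
    rw [trapezoid]; field_simp; ring
  rw [e1, e2]
  exact h

/-- The first bound writes the difference of cosines as a product of sines and uses `|sin x| ≤ |x|`;
the second is trivial. They cross near `n = δ⁻¹κ^(-1/2)` when `α + β` is about `δ` and `β - α = κδ`.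
-/
theorem abs_trapezoidCoeff_le {α β : ℝ} (hα : 0 ≤ α) (hαβ : α < β) (n : ℕ) :
    |trapezoidCoeff α β n| ≤ min (2 * (α + β)) (1 / ((β - α) * n ^ 2)) := by
  have h0 : 0 < β - α := by linarith
  have hpi := Real.pi_pos
  have hαβ' : 0 ≤ α + β := by linarith
  rcases Nat.eq_zero_or_pos n with rfl | hn
  · simp [trapezoidCoeff]; linarith
  have hn' : (0 : ℝ) < n := by exact_mod_cast hn
  have hden : 0 < (β - α) * Real.pi ^ 2 * n ^ 2 := by positivity
  rw [trapezoidCoeff, abs_div, abs_of_pos hden]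
  refine le_min ?_ ?_
  · rw [div_le_iff₀ hden, Real.cos_sub_cos, abs_mul, abs_mul, abs_neg, abs_two]
    have a1 := Real.abs_sin_le_abs (x := (2 * Real.pi * n * α + 2 * Real.pi * n * β) / 2)
    have a2 := Real.abs_sin_le_abs (x := (2 * Real.pi * n * α - 2 * Real.pi * n * β) / 2)
    rw [show (2 * Real.pi * n * α + 2 * Real.pi * n * β) / 2 = Real.pi * n * (α + β) by ring] at a1 ⊢
    rw [show (2 * Real.pi * n * α - 2 * Real.pi * n * β) / 2 = -(Real.pi * n * (β - α)) by ring] at a2 ⊢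
    rw [abs_of_nonneg (by positivity : 0 ≤ Real.pi * n * (α + β))] at a1
    rw [abs_neg, abs_of_nonneg (by positivity : 0 ≤ Real.pi * n * (β - α))] at a2
    calc _ ≤ 2 * (Real.pi * n * (α + β)) * (Real.pi * n * (β - α)) := by gcongr
      _ = _ := by ring
  · rw [div_le_div_iff₀ hden (by positivity), one_mul]
    have a1 : |Real.cos (2 * Real.pi * n * α) - Real.cos (2 * Real.pi * n * β)| ≤ 2 :=
      (abs_sub _ _).trans (by linarith [Real.abs_cos_le_one (2 * Real.pi * n * α), Real.abs_cos_le_one (2 * Real.pi * n * β)])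
    have a2 : 2 ≤ Real.pi ^ 2 := by nlinarith [Real.pi_gt_three]
    calc _ ≤ Real.pi ^ 2 * ((β - α) * n ^ 2) := by gcongr; linarith
      _ = _ := by ring

/-- A weighted sum of trapezoids, in terms of exponential sums over dyadic blocks. -/
theorem abs_sum_trapezoid_sub_le {ι : Type*} (S : Finset ι) (w y : ι → ℝ) (hw : ∀ p ∈ S, 0 ≤ w p) {α β : ℝ}
    (hα : 0 ≤ α) (hαβ : α < β) (K : ℕ) (D : ℕ → ℝ)
    (hD : ∀ k < K, ∑ n ∈ (Finset.Ico (2 ^ k) (2 * 2 ^ k) : Finset ℕ), ‖∑ p ∈ S, expTau (n * y p) * (w p : ℂ)‖ ≤ D k) :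
    |∑ p ∈ S, w p * trapezoid α β (y p) - (α + β) * ∑ p ∈ S, w p| ≤
      ∑ k ∈ Finset.range K, min (2 * (α + β)) (1 / ((β - α) * (2 ^ k) ^ 2)) * D k +
        2 * (∑ p ∈ S, w p) / ((β - α) * 2 ^ K) := by
  have h0 : 0 < β - α := by linarith
  set V : ℕ → ℝ := fun n => ‖∑ p ∈ S, expTau (n * y p) * (w p : ℂ)‖ with hV
  have hVle : ∀ n, V n ≤ ∑ p ∈ S, w p := fun n => norm_sum_le_of_le _ fun p hp => by
    rw [norm_mul, norm_expTau, one_mul, Complex.norm_real, Real.norm_of_nonneg (hw p hp)]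
  have hw0 : 0 ≤ ∑ p ∈ S, w p := Finset.sum_nonneg hw
  have hsum : HasSum (fun n : ℕ => trapezoidCoeff α β n * ∑ p ∈ S, w p * Real.cos (2 * Real.pi * n * y p))
      (∑ p ∈ S, w p * trapezoid α β (y p) - (α + β) * ∑ p ∈ S, w p) := by
    have := hasSum_sum (s := S) fun p _ => (hasSum_trapezoid hαβ (y p)).mul_left (w p)
    have e1 : (fun n : ℕ => trapezoidCoeff α β n * ∑ p ∈ S, w p * Real.cos (2 * Real.pi * n * y p)) = fun n : ℕ =>
        ∑ p ∈ S, w p * (trapezoidCoeff α β n * Real.cos (2 * Real.pi * n * y p)) := by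
      ext n
      rw [Finset.mul_sum]
      exact Finset.sum_congr rfl fun p _ => by ring
    have e2 : ∑ p ∈ S, w p * trapezoid α β (y p) - (α + β) * ∑ p ∈ S, w p =
        ∑ p ∈ S, w p * (trapezoid α β (y p) - (α + β)) := by
      rw [Finset.mul_sum, ← Finset.sum_sub_distrib]
      exact Finset.sum_congr rfl fun p _ => by ring
    rw [e1, e2]
    exact this
  have hre : ∀ n : ℕ, |∑ p ∈ S, w p * Real.cos (2 * Real.pi * n * y p)| ≤ V n := by
    intro n
    refine le_trans (le_of_eq ?_) (Complex.abs_re_le_norm _)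
    rw [Complex.re_sum]
    congr 1
    refine Finset.sum_congr rfl fun p _ => ?_
    rw [Complex.re_mul_ofReal, expTau, mul_comm]
    congr 1
    rw [show (2 * Real.pi * ((n * y p : ℝ) : ℂ) * Complex.I : ℂ) = ((2 * Real.pi * n * y p : ℝ) : ℂ) * Complex.I by
      push_cast; ring, Complex.exp_ofReal_mul_I_re]
  have hterm : ∀ n : ℕ, |trapezoidCoeff α β n * ∑ p ∈ S, w p * Real.cos (2 * Real.pi * n * y p)| ≤
      min (2 * (α + β)) (1 / ((β - α) * n ^ 2)) * V n := by
    intro n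
    rw [abs_mul]
    exact mul_le_mul (abs_trapezoidCoeff_le hα hαβ n) (hre n) (abs_nonneg _) ((abs_nonneg _).trans (abs_trapezoidCoeff_le hα hαβ n))
  have hmin0 : ∀ x : ℝ, 0 ≤ min (2 * (α + β)) (1 / ((β - α) * x ^ 2)) := fun x => le_min (by linarith) (by positivity)
  -- On a dyadic block the coefficient bound is largest at the left end `2 ^ k`, so it factors out
  -- of the sum.
  have hblocks : ∀ k ≤ K, ∑ n ∈ Finset.Ico 1 (2 ^ k), |trapezoidCoeff α β n * ∑ p ∈ S, w p * Real.cos (2 * Real.pi * n * y p)| ≤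
      ∑ k ∈ Finset.range k, min (2 * (α + β)) (1 / ((β - α) * (2 ^ k) ^ 2)) * D k := by
    intro k hk
    induction k with
    | zero => simp
    | succ k ih =>
      rw [Finset.sum_range_succ, ← Finset.sum_Ico_consecutive _ Nat.one_le_two_pow (Nat.pow_le_pow_right two_pos k.le_succ)]
      refine add_le_add (ih (by omega)) ?_
      calc _ ≤ ∑ n ∈ Finset.Ico (2 ^ k) (2 ^ (k + 1)), min (2 * (α + β)) (1 / ((β - α) * (2 ^ k) ^ 2)) * V n := by
            refine Finset.sum_le_sum fun n hn => (hterm n).trans ?_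
            have : ((2 : ℝ) ^ k) ≤ n := by exact_mod_cast (Finset.mem_Ico.1 hn).1
            have hVn : 0 ≤ V n := norm_nonneg _
            gcongr
        _ ≤ _ := by
            rw [← Finset.mul_sum, pow_succ' 2 k]
            exact mul_le_mul_of_nonneg_left (hD k (by omega)) (hmin0 _)
  -- Beyond the last block the exponential sums are bounded trivially by the total weight, and the
  -- coefficients are summed as `1 / n ^ 2`.
  have htail : ∀ N, ∑ n ∈ Finset.Ico (2 ^ K) N, |trapezoidCoeff α β n * ∑ p ∈ S, w p * Real.cos (2 * Real.pi * n * y p)| ≤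
      2 * (∑ p ∈ S, w p) / ((β - α) * 2 ^ K) := by
    intro N
    have h2 : 1 ≤ 2 ^ K := Nat.one_le_two_pow
    calc _ ≤ ∑ n ∈ Finset.Ico (2 ^ K) N, ((∑ p ∈ S, w p) / (β - α)) * ((n : ℝ) ^ 2)⁻¹ := by
          refine Finset.sum_le_sum fun n hn => (hterm n).trans ?_
          refine (mul_le_mul (min_le_right _ _) (hVle n) (norm_nonneg _) (by positivity)).trans_eq ?_
          field_simp
      _ ≤ ((∑ p ∈ S, w p) / (β - α)) * (2 / 2 ^ K) := by
          rw [← Finset.mul_sum]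
          refine mul_le_mul_of_nonneg_left ?_ (by positivity)
          have := sum_Ioo_inv_sq_le (α := ℝ) (2 ^ K - 1) N
          rw [Nat.cast_sub h2, Nat.cast_one, sub_add_cancel] at this
          convert this using 2
          · ext n; rw [Finset.mem_Ico, Finset.mem_Ioo]; omega
          · push_cast; rfl
      _ = _ := by field_simp
  have hlim := hsum.tendsto_sum_nat.abs
  refine le_of_tendsto hlim ?_
  filter_upwards [Filter.eventually_ge_atTop (2 ^ K)] with N hN
  refine (Finset.abs_sum_le_sum_abs _ _).trans ?_
  have hN1 : 1 ≤ N := Nat.one_le_two_pow.trans hN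
  rw [Finset.range_eq_Ico, ← Finset.sum_Ico_consecutive _ zero_le_one hN1, ← Finset.sum_Ico_consecutive _ Nat.one_le_two_pow hN]
  have hz : ∑ n ∈ Finset.Ico 0 1, |trapezoidCoeff α β n * ∑ p ∈ S, w p * Real.cos (2 * Real.pi * n * y p)| = 0 := by
    simp [trapezoidCoeff]
  rw [hz, zero_add]
  exact add_le_add (hblocks K le_rfl) (htail N)

/-! ### Construction of the smooth weights -/

/-- Both derivatives vanish off `[0, 1]`: at points `≤ 0` or `≥ 1` the function attains its minimum
or maximum. The bounds then follow by compactness. -/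
theorem exists_smoothTransition_bounds : ∃ A : ℝ, 0 ≤ A ∧ ∃ S₁ S₂ : ℝ → ℝ,
    (∀ x, HasDerivAt Real.smoothTransition (S₁ x) x) ∧ (∀ x, HasDerivAt S₁ (S₂ x) x) ∧ Continuous S₂ ∧
    (∀ x, |S₁ x| ≤ A) ∧ (∀ x, |S₂ x| ≤ A) ∧ ∀ x ≤ 0, S₁ x = 0 := by
  have h2 : ContDiff ℝ 2 Real.smoothTransition := Real.smoothTransition.contDiff
  have h1 : ContDiff ℝ 1 (deriv Real.smoothTransition) := ((contDiff_succ_iff_deriv (n := 1)).1 h2).2.2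
  have hc2 : Continuous (deriv (deriv Real.smoothTransition)) := h1.continuous_deriv le_rfl
  have hz0 : ∀ x ≤ 0, deriv Real.smoothTransition x = 0 := by
    intro x hx
    refine IsLocalMin.deriv_eq_zero (Filter.Eventually.of_forall fun y => ?_)
    rw [Real.smoothTransition.zero_of_nonpos hx]
    exact Real.smoothTransition.nonneg y
  have hz1 : ∀ x, 1 ≤ x → deriv Real.smoothTransition x = 0 := by
    intro x hx
    refine IsLocalMax.deriv_eq_zero (Filter.Eventually.of_forall fun y => ?_)
    rw [Real.smoothTransition.one_of_one_le hx]
    exact Real.smoothTransition.le_one y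
  obtain ⟨A₁, hA₁⟩ := isCompact_Icc.exists_bound_of_continuousOn (s := Set.Icc (0 : ℝ) 1) h1.continuous.continuousOn
  obtain ⟨A₂, hA₂⟩ := isCompact_Icc.exists_bound_of_continuousOn (s := Set.Icc (0 : ℝ) 1) hc2.continuousOn
  have hA0 : 0 ≤ max A₁ A₂ := (norm_nonneg _).trans ((hA₁ 0 (by simp)).trans (le_max_left _ _))
  refine ⟨max A₁ A₂, hA0, deriv Real.smoothTransition, deriv (deriv Real.smoothTransition), fun x =>
    (h2.differentiable (by norm_num) x).hasDerivAt, fun x => (h1.differentiable (by norm_num) x).hasDerivAt, hc2, ?_, ?_, hz0⟩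
  · intro x
    rcases lt_or_ge x 0 with h | h
    · rw [hz0 x h.le, abs_zero]; exact hA0
    rcases le_or_gt x 1 with h' | h'
    · exact (hA₁ x ⟨h, h'⟩).trans (le_max_left _ _)
    · rw [hz1 x h'.le, abs_zero]; exact hA0
  · intro x
    rcases lt_or_ge x 0 with h | h
    · have : deriv Real.smoothTransition =ᶠ[nhds x] fun _ => 0 := by
        filter_upwards [Iio_mem_nhds h] with y hy using hz0 y (le_of_lt hy)
      rw [this.deriv_eq, deriv_const, abs_zero]; exact hA0
    rcases le_or_gt x 1 with h' | h'
    · exact (hA₂ x ⟨h, h'⟩).trans (le_max_right _ _)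
    · have : deriv Real.smoothTransition =ᶠ[nhds x] fun _ => 0 := by
        filter_upwards [Ioi_mem_nhds h'] with y hy using hz1 y (le_of_lt hy)
      rw [this.deriv_eq, deriv_const, abs_zero]; exact hA0

/-- Smooth weights approximating the indicator function of an interval. -/
theorem exists_isWeight : ∃ A : ℝ, 1 ≤ A ∧ ∀ κ p r R : ℝ, 0 < κ → κ ≤ 1 → |p| ≤ R → |r| ≤ R →
    ∃ W W₁ W₂ : ℝ → ℝ, IsWeight R (A / κ) W W₁ W₂ ∧ (∀ x, p + κ ≤ x → x ≤ r - κ → W x = 1) ∧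
      ∀ x, x ≤ p ∨ r ≤ x → W x = 0 := by
  obtain ⟨A, hA, S₁, S₂, hS₁, hS₂, hc, hb₁, hb₂, hz⟩ := exists_smoothTransition_bounds
  refine ⟨1 + 4 * A, by linarith, ?_⟩
  intro κ p r R hκ hκ1 hp hr
  set S := Real.smoothTransition
  have hS0 : ∀ x ≤ 0, S x = 0 := fun x hx => Real.smoothTransition.zero_of_nonpos hx
  have hSn : ∀ x, 0 ≤ S x := Real.smoothTransition.nonneg
  have hSl : ∀ x, S x ≤ 1 := Real.smoothTransition.le_one
  have hSa : ∀ x, |S x| ≤ 1 := fun x => by rw [abs_of_nonneg (hSn x)]; exact hSl x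
  have hu : ∀ x, HasDerivAt (fun x => (x - p) / κ) κ⁻¹ x := fun x =>
    (((hasDerivAt_id x).sub_const p).div_const κ).congr_deriv (one_div κ)
  have hv : ∀ x, HasDerivAt (fun x => (r - x) / κ) (-κ⁻¹) x := fun x =>
    (((hasDerivAt_id x).const_sub r).div_const κ).congr_deriv (by rw [neg_div, one_div])
  have hzero : ∀ x, x ≤ p ∨ r ≤ x → ((x - p) / κ ≤ 0 ∨ (r - x) / κ ≤ 0) := by
    rintro x (h | h)
    · exact Or.inl (div_nonpos_of_nonpos_of_nonneg (by linarith) hκ.le)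
    · exact Or.inr (div_nonpos_of_nonpos_of_nonneg (by linarith) hκ.le)
  have hout : ∀ x, R ≤ |x| → x ≤ p ∨ r ≤ x := by
    intro x hx
    rw [abs_le] at hp hr
    rcases le_abs'.1 hx with h | h
    · left; linarith
    · right; linarith
  have hκinv : 0 < κ⁻¹ := inv_pos.2 hκ
  refine ⟨fun x => S ((x - p) / κ) * S ((r - x) / κ),
    fun x => κ⁻¹ * (S₁ ((x - p) / κ) * S ((r - x) / κ) - S ((x - p) / κ) * S₁ ((r - x) / κ)),
    fun x => κ⁻¹ * (κ⁻¹ * (S₂ ((x - p) / κ) * S ((r - x) / κ) - S₁ ((x - p) / κ) * S₁ ((r - x) / κ)) -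
      κ⁻¹ * (S₁ ((x - p) / κ) * S₁ ((r - x) / κ) - S ((x - p) / κ) * S₂ ((r - x) / κ))), ?_, ?_, ?_⟩
  · refine ⟨?_, ?_, ?_, ?_, ?_, ?_, ?_, ?_, ?_, ?_⟩
    · rw [le_div_iff₀ hκ]; linarith
    · intro x
      exact (((hS₁ _).comp x (hu x)).mul ((hS₁ _).comp x (hv x))).congr_deriv (by simp only [Function.comp]; ring)
    · intro x
      exact (((((hS₂ _).comp x (hu x)).mul ((hS₁ _).comp x (hv x))).sub
        (((hS₁ _).comp x (hu x)).mul ((hS₂ _).comp x (hv x)))).const_mul κ⁻¹).congr_deriv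
          (by simp only [Function.comp]; ring)
    · have c0 : Continuous S := continuous_iff_continuousAt.2 fun x => (hS₁ x).continuousAt
      have c1 : Continuous S₁ := continuous_iff_continuousAt.2 fun x => (hS₂ x).continuousAt
      fun_prop
    · exact fun x => mul_nonneg (hSn _) (hSn _)
    · exact fun x => mul_le_one₀ (hSl _) (hSn _) (hSl _)
    · intro x
      rw [abs_mul, abs_of_pos hκinv, show (1 + 4 * A) / κ = κ⁻¹ * (1 + 4 * A) by ring]
      refine mul_le_mul_of_nonneg_left ((abs_sub _ _).trans ?_) hκinv.le
      rw [abs_mul, abs_mul]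
      have h1 := mul_le_mul (hb₁ ((x - p) / κ)) (hSa ((r - x) / κ)) (abs_nonneg _) hA
      have h2 := mul_le_mul (hSa ((x - p) / κ)) (hb₁ ((r - x) / κ)) (abs_nonneg _) zero_le_one
      linarith
    · intro x
      rw [← mul_sub, ← mul_assoc, abs_mul, abs_of_pos (by positivity),
        show ((1 + 4 * A) / κ) ^ 2 = κ⁻¹ * κ⁻¹ * (1 + 4 * A) ^ 2 by ring]
      refine mul_le_mul_of_nonneg_left ((abs_sub _ _).trans (add_le_add (abs_sub _ _) (abs_sub _ _)) |>.trans ?_) (by positivity)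
      rw [abs_mul, abs_mul, abs_mul]
      have h1 := mul_le_mul (hb₂ ((x - p) / κ)) (hSa ((r - x) / κ)) (abs_nonneg _) hA
      have h2 := mul_le_mul (hSa ((x - p) / κ)) (hb₂ ((r - x) / κ)) (abs_nonneg _) zero_le_one
      have h3 := mul_le_mul (hb₁ ((x - p) / κ)) (hb₁ ((r - x) / κ)) (abs_nonneg _) hA
      nlinarith
    · intro x hx
      rcases hzero x (hout x hx) with h | h <;> simp [hS0 _ h]
    · intro x hx
      rcases hzero x (hout x hx) with h | h <;> simp [hS0 _ h, hz _ h]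
  · intro x h1 h2
    have a1 : S ((x - p) / κ) = 1 := Real.smoothTransition.one_of_one_le (by rw [le_div_iff₀ hκ]; linarith)
    have a2 : S ((r - x) / κ) = 1 := Real.smoothTransition.one_of_one_le (by rw [le_div_iff₀ hκ]; linarith)
    simp only
    rw [a1, a2, one_mul]
  · intro x hx
    rcases hzero x hx with h | h <;> simp [hS0 _ h]

/-! ### Parameters and the size of the error terms -/

/-- The two branches of the minimum meet at `J₀ = δ⁻¹κ^(-1/2)`. To the left `J ^ ν` increases, to
the right `J ^ (ν - 2)` does not increase, so the worst frequency is `J₀`. -/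
theorem min_mul_rpow_le {δ κ J ν : ℝ} (hδ : 0 < δ) (hκ : 0 < κ) (hJ : 0 < J) (hν : 0 ≤ ν) (hν2 : ν ≤ 2) :
    min δ (1 / (κ * δ * J ^ 2)) * J ^ ν ≤ δ * (δ⁻¹ * κ ^ (-(1 / 2) : ℝ)) ^ ν := by
  set J₀ := δ⁻¹ * κ ^ (-(1 / 2) : ℝ) with hJ₀
  have hJ₀0 : 0 < J₀ := by positivity
  have hsq : J₀ ^ 2 = 1 / (δ ^ 2 * κ) := by
    rw [hJ₀, mul_pow, ← Real.rpow_natCast (κ ^ _), ← Real.rpow_mul hκ.le]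
    norm_num
    rw [Real.rpow_neg_one]
    ring
  rcases le_total J J₀ with h | h
  · refine mul_le_mul (min_le_left _ _) ?_ (by positivity) hδ.le
    exact Real.rpow_le_rpow hJ.le h hν
  · have h1 : J ^ (ν - 2) ≤ J₀ ^ (ν - 2) := Real.rpow_le_rpow_of_nonpos hJ₀0 h (by linarith)
    rw [Real.rpow_sub hJ, Real.rpow_sub hJ₀0, Real.rpow_two, Real.rpow_two, hsq] at h1
    calc min δ (1 / (κ * δ * J ^ 2)) * J ^ ν ≤ 1 / (κ * δ * J ^ 2) * J ^ ν := by gcongr; exact min_le_right _ _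
      _ = 1 / (κ * δ) * (J ^ ν / J ^ 2) := by field_simp
      _ ≤ 1 / (κ * δ) * (J₀ ^ ν / (1 / (δ ^ 2 * κ))) := by gcongr
      _ = _ := by field_simp

/-- The hypotheses on the size of `Q`, `δ` and `κ`, under which all error terms are admissible. -/
structure IsAdmissible (θ ε Q δ κ : ℝ) : Prop where
  one_le : 1 ≤ Q
  pos : 0 < δ
  le_one : δ ≤ 1
  pos' : 0 < κ
  le_one' : κ ≤ 1
  rpow_le : Q ^ ε ≤ δ * Q
  rpow_le' : Q ^ ε ≤ δ ^ (3 - θ) * Q ^ (1 + θ)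
  le : (δ * Q) ^ (-(1 / 3) : ℝ) ≤ κ
  le' : (δ ^ (3 - θ) * Q ^ (1 + θ)) ^ (-(1 / (5 - θ))) ≤ κ

namespace IsAdmissible

variable {θ ε Q δ κ : ℝ}

/-- In logarithms the hypotheses become linear in `log Q`, `log δ` and `log κ`, and so do all the
comparisons below. Each of them holds with a margin proportional to `ε * log Q`, which pays for the
factors `Q ^ (ε / 25)` and `Q ^ (ε / 100)`. -/
theorem log_bounds (h : IsAdmissible θ ε Q δ κ) (hθ : 0 < θ) (hθ1 : θ < 1) : 0 ≤ Real.log Q ∧ Real.log δ ≤ 0 ∧ Real.log κ ≤ 0 ∧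
    ε * Real.log Q ≤ Real.log δ + Real.log Q ∧
    ε * Real.log Q ≤ (3 - θ) * Real.log δ + (1 + θ) * Real.log Q ∧
    -(Real.log δ + Real.log Q) ≤ 3 * Real.log κ ∧
    -((3 - θ) * Real.log δ + (1 + θ) * Real.log Q) ≤ (5 - θ) * Real.log κ := by
  obtain ⟨h1, h2, h3, h4, h5, h6, h7, h8, h9⟩ := h
  have hQ : 0 < Q := by linarith
  refine ⟨Real.log_nonneg h1, Real.log_nonpos h2.le h3, Real.log_nonpos h4.le h5, ?_, ?_, ?_, ?_⟩
  · have := Real.log_le_log (by positivity) h6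
    rwa [Real.log_rpow hQ, Real.log_mul h2.ne' hQ.ne'] at this
  · have := Real.log_le_log (by positivity) h7
    rwa [Real.log_rpow hQ, Real.log_mul (by positivity) (by positivity), Real.log_rpow h2, Real.log_rpow hQ] at this
  · have := Real.log_le_log (by positivity) h8
    rw [Real.log_rpow (by positivity), Real.log_mul h2.ne' hQ.ne'] at this
    linarith
  · have := Real.log_le_log (by positivity) h9
    rw [Real.log_rpow (by positivity), Real.log_mul (by positivity) (by positivity), Real.log_rpow h2, Real.log_rpow hQ,
      neg_mul, div_mul_eq_mul_div, one_mul, neg_le, le_div_iff₀ (by linarith)] at this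
    linarith

theorem one_le_mul (h : IsAdmissible θ ε Q δ κ) (hθ : 0 < θ) (hθ1 : θ < 1) (hε : 0 < ε) : 1 ≤ κ * δ * Q := by
  obtain ⟨a1, a2, a3, a4, a5, a6, a7⟩ := h.log_bounds hθ hθ1
  have hQ : 0 < Q := by linarith [h.one_le]
  have hδ := h.pos
  have hκ := h.pos'
  have := mul_nonneg hε.le a1
  rw [← Real.log_nonneg_iff (by positivity), Real.log_mul (by positivity) hQ.ne', Real.log_mul hκ.ne' hδ.ne']
  linarith

theorem frequency_sqrt_le (h : IsAdmissible θ ε Q δ κ) (hθ : 0 < θ) (hθ1 : θ < 1) (hε : 0 < ε) :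
    Q ^ (ε / 25) * (Q ^ (3 / 2 : ℝ) * (δ⁻¹ * κ ^ (-(1 / 2) : ℝ)) ^ (1 / 2 : ℝ)) ≤ κ * Q ^ 2 := by
  obtain ⟨a1, a2, a3, a4, a5, a6, a7⟩ := h.log_bounds hθ hθ1
  have hQ : 0 < Q := by linarith [h.one_le]
  have hδ := h.pos
  have hκ := h.pos'
  rw [← Real.log_le_log_iff (by positivity) (by positivity)]
  rw [Real.log_mul (by positivity) (by positivity), Real.log_mul (by positivity) (by positivity), Real.log_mul (by positivity) (by positivity),
    Real.log_rpow hQ, Real.log_rpow hQ, Real.log_rpow (by positivity), Real.log_mul (by positivity) (by positivity), Real.log_inv,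
    Real.log_rpow hκ, Real.log_pow]
  push_cast
  have := mul_nonneg hε.le a1
  linarith

theorem frequency_cube_sqrt_le (h : IsAdmissible θ ε Q δ κ) (hθ : 0 < θ) (hθ1 : θ < 1) (hε : 0 < ε) :
    Q ^ (ε / 25) * (Q ^ (1 / 2 : ℝ) * (δ⁻¹ * κ ^ (-(1 / 2) : ℝ)) ^ (3 / 2 : ℝ)) ≤ κ * Q ^ 2 := by
  obtain ⟨a1, a2, a3, a4, a5, a6, a7⟩ := h.log_bounds hθ hθ1
  have hQ : 0 < Q := by linarith [h.one_le]
  have hδ := h.pos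
  have hκ := h.pos'
  rw [← Real.log_le_log_iff (by positivity) (by positivity)]
  rw [Real.log_mul (by positivity) (by positivity), Real.log_mul (by positivity) (by positivity), Real.log_mul (by positivity) (by positivity),
    Real.log_rpow hQ, Real.log_rpow hQ, Real.log_rpow (by positivity), Real.log_mul (by positivity) (by positivity), Real.log_inv,
    Real.log_rpow hκ, Real.log_pow]
  push_cast
  have := mul_nonneg hε.le a1
  linarith

theorem stationary_error_le (h : IsAdmissible θ ε Q δ κ) (hθ : 0 < θ) (hθ1 : θ < 1) (hε : 0 < ε) :
    Q ^ (ε / 100) * (Q ^ ((3 - θ) / 2) * (δ⁻¹ * κ ^ (-(1 / 2) : ℝ)) ^ ((3 - θ) / 2)) ≤ κ * Q ^ 2 := by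
  obtain ⟨a1, a2, a3, a4, a5, a6, a7⟩ := h.log_bounds hθ hθ1
  have hQ : 0 < Q := by linarith [h.one_le]
  have hδ := h.pos
  have hκ := h.pos'
  rw [← Real.log_le_log_iff (by positivity) (by positivity)]
  rw [Real.log_mul (by positivity) (by positivity), Real.log_mul (by positivity) (by positivity), Real.log_mul (by positivity) (by positivity),
    Real.log_rpow hQ, Real.log_rpow hQ, Real.log_rpow (by positivity), Real.log_mul (by positivity) (by positivity), Real.log_inv,
    Real.log_rpow hκ, Real.log_pow]
  push_cast
  have := mul_nonneg hε.le a1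
  have h1 := mul_nonneg (by linarith : 0 ≤ 5 - 3 * θ) (neg_nonneg.2 a3)
  linarith

theorem weight_error_le (h : IsAdmissible θ ε Q δ κ) (hθ : 0 < θ) (hθ1 : θ < 1) (hε : 0 < ε) (hε1 : ε ≤ 1) :
    Q ^ (ε / 100) * (κ⁻¹ * (Q ^ ((3 - (1 - ε / 100)) / 2) * (δ⁻¹ * κ ^ (-(1 / 2) : ℝ)) ^ ((3 - (1 - ε / 100)) / 2))) ≤ κ * Q ^ 2 := by
  obtain ⟨a1, a2, a3, a4, a5, a6, a7⟩ := h.log_bounds hθ hθ1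
  have hQ : 0 < Q := by linarith [h.one_le]
  have hδ := h.pos
  have hκ := h.pos'
  rw [← Real.log_le_log_iff (by positivity) (by positivity)]
  rw [Real.log_mul (by positivity) (by positivity), Real.log_mul (by positivity) (by positivity), Real.log_mul (by positivity) (by positivity),
    Real.log_mul (by positivity) (by positivity),
    Real.log_rpow hQ, Real.log_rpow hQ, Real.log_rpow (by positivity), Real.log_mul (by positivity) (by positivity), Real.log_inv,
    Real.log_inv, Real.log_rpow hκ, Real.log_pow]
  push_cast
  have h0 := mul_nonneg hε.le a1
  have h1 : -(ε * Real.log Q) ≤ ε * Real.log δ := by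
    have := mul_nonneg hε.le (by linarith : 0 ≤ Real.log δ + Real.log Q)
    linarith
  have h2 := mul_nonneg (by linarith : 0 ≤ 1 - ε) (neg_nonneg.2 a3)
  linarith

end IsAdmissible

/-- The Fourier series will be cut off at frequency about `Q ^ 2`. The number of dyadic blocks up to
there is logarithmic, hence at most a constant times `Q ^ e`. -/
theorem exists_dyadic_scale (Q : ℝ) (hQ : 1 ≤ Q) {e : ℝ} (he : 0 < e) :
    ∃ n : ℕ, (2 : ℝ) ^ n ≤ Q ^ 2 ∧ Q ^ 2 ≤ 2 ^ (n + 1) ∧ ((n + 1 : ℕ) : ℝ) ≤ (1 + 2 / (e * Real.log 2)) * Q ^ e := by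
  obtain ⟨n, h1, h2⟩ := exists_nat_pow_near (one_le_pow₀ hQ : 1 ≤ Q ^ 2) (one_lt_two : (1:ℝ) < 2)
  refine ⟨n, h1, h2.le, ?_⟩
  have hQ0 : 0 < Q := by linarith
  have h3 := Real.log_le_log (by positivity) h1
  rw [Real.log_pow, Real.log_pow] at h3
  have h4 := Real.log_le_rpow_div hQ0.le he
  have h5 : 1 ≤ Q ^ e := Real.one_le_rpow hQ he.le
  have h6 : 0 < Real.log 2 := Real.log_pos one_lt_two
  have h7 : (n : ℝ) ≤ 2 / (e * Real.log 2) * Q ^ e := by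
    rw [div_mul_eq_mul_div, le_div_iff₀ (by positivity)]
    rw [le_div_iff₀ he] at h4
    push_cast at h3
    nlinarith
  push_cast
  linarith

/-! ### The smoothed count -/

/-- A box of integers containing all pairs `(a, q)` with `Q < q ≤ 2Q` and `|a/q| ≤ R`. -/
noncomputable def pairBox (R Q : ℝ) : Finset (ℤ × ℕ) :=
  Finset.Icc (-⌈R * (2 * Q)⌉) ⌈R * (2 * Q)⌉ ×ˢ Finset.Ioc ⌊Q⌋₊ ⌊2 * Q⌋₊

theorem mem_pairBox {R Q : ℝ} (hQ : 0 ≤ Q) {p : ℤ × ℕ} (h1 : Q < p.2) (h2 : (p.2 : ℝ) ≤ 2 * Q) (h3 : |(p.1 : ℝ)| ≤ R * p.2)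
    (hR : 0 ≤ R) : p ∈ pairBox R Q := by
  have h4 : |(p.1 : ℝ)| ≤ ⌈R * (2 * Q)⌉ := (h3.trans (by gcongr)).trans (Int.le_ceil _)
  rw [pairBox, Finset.mem_product, Finset.mem_Icc, Finset.mem_Ioc, ← abs_le]
  exact ⟨by exact_mod_cast h4, (Nat.floor_lt hQ).2 h1, Nat.le_floor h2⟩

theorem pairBox_snd {R Q : ℝ} (hQ : 0 ≤ Q) {p : ℤ × ℕ} (hp : p ∈ pairBox R Q) : Q < p.2 ∧ (p.2 : ℝ) ≤ 2 * Q := by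
  rw [pairBox, Finset.mem_product, Finset.mem_Ioc] at hp
  exact ⟨(Nat.floor_lt hQ).1 hp.2.1, (Nat.le_floor_iff (by linarith)).1 hp.2.2⟩

theorem card_pairBox_le {R Q : ℝ} (hR : 0 ≤ R) (hQ : 1 ≤ Q) : ((pairBox R Q).card : ℝ) ≤ (8 * R + 6) * Q ^ 2 := by
  have hRQ : 0 ≤ R * (2 * Q) := by positivity
  have h1 : ((⌊2 * Q⌋₊ - ⌊Q⌋₊ : ℕ) : ℝ) ≤ 2 * Q :=
    le_trans (by exact_mod_cast Nat.sub_le _ _) (Nat.floor_le (by linarith : 0 ≤ 2 * Q))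
  have h2 : ((⌈R * (2 * Q)⌉ + 1 - -⌈R * (2 * Q)⌉).toNat : ℝ) ≤ 4 * R * Q + 3 := by
    have h0 : 0 ≤ ⌈R * (2 * Q)⌉ := Int.ceil_nonneg hRQ
    have e : (((⌈R * (2 * Q)⌉ + 1 - -⌈R * (2 * Q)⌉).toNat : ℤ) : ℝ) = 2 * ⌈R * (2 * Q)⌉ + 1 := by
      rw [Int.toNat_of_nonneg (by omega)]; push_cast; ring
    have e2 := Int.ceil_lt_add_one (R * (2 * Q))
    rw [Int.cast_natCast] at e
    linarith
  rw [pairBox, Finset.card_product, Int.card_Icc, Nat.card_Ioc, Nat.cast_mul]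
  calc _ ≤ (4 * R * Q + 3) * (2 * Q) := by gcongr
    _ ≤ (4 * R * Q + 3 * Q) * (2 * Q) := by gcongr; linarith
    _ = _ := by ring

/-- The weight vanishes for `|a / q| ≥ R`, so the sum over all integers `a`, as required by Poisson
summation, agrees with the finite sum over the box. -/
theorem tsum_eq_sum_pairBox {R B Q : ℝ} {W W₁ W₂ : ℝ → ℝ} (hW : IsWeight R B W W₁ W₂) (hR : 0 ≤ R) (hQ : 1 ≤ Q)
    (φ : ℤ → ℕ → ℂ) :
    ∑ p ∈ pairBox R Q, φ p.1 p.2 * (W (p.1 / p.2) : ℂ) =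
      ∑ q ∈ Finset.Ioc ⌊Q⌋₊ ⌊2 * Q⌋₊, ∑' a : ℤ, φ a q * (W (a / q) : ℂ) := by
  rw [pairBox, Finset.sum_product_right]
  refine Finset.sum_congr rfl fun q hq => ?_
  refine (tsum_eq_sum fun a ha => ?_).symm
  rw [Finset.mem_Ioc] at hq
  have h1 := (Nat.floor_lt (by linarith)).1 hq.1
  have h2 := (Nat.le_floor_iff (by linarith)).1 hq.2
  have hq0 : (0 : ℝ) < q := by linarith
  rw [hW.eq_zero, Complex.ofReal_zero, mul_zero]
  rw [Finset.mem_Icc, ← abs_le, not_le] at ha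
  have h3 : (⌈R * (2 * Q)⌉ : ℝ) < |(a : ℝ)| := by exact_mod_cast ha
  rw [abs_div, abs_of_pos hq0, le_div_iff₀ hq0]
  calc R * q ≤ R * (2 * Q) := by gcongr
    _ ≤ _ := (Int.le_ceil _).trans h3.le

namespace IsCurve

variable {m M L θ : ℝ} {F F₁ F₂ : ℝ → ℝ}

/-- The smoothed counting function, with an admissible error. -/
theorem exists_smooth_count_le (h : IsCurve m M L θ F F₁ F₂) (hθ : 0 < θ) (hθ1 : θ < 1) (hL : 0 ≤ L) {R A ε : ℝ} (hR : 0 ≤ R)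
    (hA : 1 ≤ A) (hε : 0 < ε) (hε1 : ε ≤ 1) :
    ∃ C > 0, ∀ Q δ κ, IsAdmissible θ ε Q δ κ → (A / κ) ^ 2 ≤ Q → ∀ W W₁ W₂, IsWeight R (A / κ) W W₁ W₂ →
      ∀ α β, 0 ≤ α → β - α = κ * δ → α + β ≤ 3 * δ →
        |∑ p ∈ pairBox R Q, W (p.1 / p.2) * trapezoid α β (p.2 * F (p.1 / p.2)) -
          (α + β) * ∑ p ∈ pairBox R Q, W (p.1 / p.2)| ≤ C * (κ * δ * Q ^ 2) := by
  set e := ε / 100 with he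
  have he0 : 0 < e := by positivity
  have he1 : e < 1 := by rw [he]; linarith
  obtain ⟨c, g, G, hd⟩ := h.exists_isDualPair
  have hF₁c : Continuous F₁ := continuous_iff_continuousAt.2 fun y => (h.hasDerivAt₁ y).continuousAt
  obtain ⟨R₁, hR₁⟩ := isCompact_Icc.exists_bound_of_continuousOn (s := Set.Icc (-R) R) hF₁c.continuousOn
  -- The exponent attached to the variation of the weight is taken to be `1 - e`, just below the
  -- excluded value `1`; the loss is a small power of `Q * J`.
  obtain ⟨C₁, hC₁, hdy⟩ := h.exists_dyadic_sum_le (R₁ := max 1 R₁) hθ hθ1 (by linarith : 0 < 1 - e) (by linarith : 1 - e < 1) he0 hL hd hR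
    (le_max_left _ _) (fun x hx => (hR₁ x (abs_le.1 hx)).trans (le_max_right _ _))
  have hlog2 := Real.log_pos one_lt_two
  set ce := 1 + 2 / (e * Real.log 2) with hce
  have hce0 : 0 < ce := by positivity
  refine ⟨ce * (6 * C₁) * (3 + A) + 2 * (8 * R + 6), by positivity, ?_⟩
  intro Q δ κ hadm hAκ W W₁ W₂ hW α β hα hβα hαβ3
  have hQ := hadm.one_le
  have hQ0 : 0 < Q := by linarith
  have hδ := hadm.pos
  have hκ := hadm.pos'
  have hαβ : α < β := by nlinarith [mul_pos hκ hδ]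
  have hαβ0 : 0 ≤ α + β := by linarith
  obtain ⟨n, hn1, hn2, hn3⟩ := exists_dyadic_scale Q hQ he0
  set J₀ := δ⁻¹ * κ ^ (-(1 / 2) : ℝ) with hJ₀
  have hJ₀0 : 0 < J₀ := by positivity
  -- `P` is the dyadic bound with `J` replaced by the worst frequency `J₀`. The factors `J ^ e` have
  -- been absorbed into `Q ^ (3 * e)`, which is possible because only `J ≤ Q ^ 2` occur.
  set P := Q ^ (3 * e) * (Q ^ (3 / 2 : ℝ) * J₀ ^ (1 / 2 : ℝ)) + Q ^ (3 * e) * (Q ^ (1 / 2 : ℝ) * J₀ ^ (3 / 2 : ℝ)) +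
    Q ^ ((3 - θ) / 2) * J₀ ^ ((3 - θ) / 2) +
    A * (κ⁻¹ * (Q ^ ((3 - (1 - e)) / 2) * J₀ ^ ((3 - (1 - e)) / 2))) with hP
  have hP0 : 0 ≤ P := by positivity
  have hPle : Q ^ e * P ≤ (3 + A) * (κ * Q ^ 2) := by
    have b1 := hadm.frequency_sqrt_le hθ hθ1 hε
    have b2 := hadm.frequency_cube_sqrt_le hθ hθ1 hε
    have b3 := hadm.stationary_error_le hθ hθ1 hε
    have b4 := mul_le_mul_of_nonneg_left (hadm.weight_error_le hθ hθ1 hε hε1) (by linarith : 0 ≤ A)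
    rw [show ε / 25 = e + 3 * e by rw [he]; ring, Real.rpow_add hQ0] at b1 b2
    rw [← he] at b3 b4
    rw [← hJ₀] at b1 b2 b3 b4
    rw [hP]
    linarith
  set D : ℕ → ℝ := fun k => C₁ * (((2 ^ k : ℕ) : ℝ) ^ (1 / 2 + e) * √Q * (Q + Q ^ e * ((2 ^ k : ℕ) : ℝ)) +
    (Q * ((2 ^ k : ℕ) : ℝ)) ^ ((3 - θ) / 2) + A / κ * (Q * ((2 ^ k : ℕ) : ℝ)) ^ ((3 - (1 - e)) / 2)) with hD
  have hmain := abs_sum_trapezoid_sub_le (pairBox R Q) (fun p => W (p.1 / p.2)) (fun p => p.2 * F (p.1 / p.2))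
    (fun p _ => hW.nonneg _) hα hαβ (n + 1) D (by
      intro k _
      have := hdy (A / κ) W W₁ W₂ hW Q (2 ^ k) hQ Nat.one_le_two_pow hAκ
      refine le_trans (le_of_eq ?_) this
      refine Finset.sum_congr rfl fun j _ => ?_
      rw [← tsum_eq_sum_pairBox hW hR hQ (fun a q => expTau (j * (q * F (a / q))))])
  have hterm : ∀ k ∈ Finset.range (n + 1), min (2 * (α + β)) (1 / ((β - α) * (2 ^ k) ^ 2)) * D k ≤ 6 * C₁ * (δ * P) := by
    intro k hk
    have hJ0 : (0 : ℝ) < 2 ^ k := by positivity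
    have hJQ : (2 : ℝ) ^ k ≤ Q ^ 2 :=
      (pow_le_pow_right₀ one_le_two (by rw [Finset.mem_range] at hk; omega)).trans hn1
    have hJe : ((2 : ℝ) ^ k) ^ e ≤ Q ^ (2 * e) := by
      rw [Real.rpow_mul hQ0.le, Real.rpow_two]
      exact Real.rpow_le_rpow hJ0.le hJQ he0.le
    have hmin : min (2 * (α + β)) (1 / ((β - α) * (2 ^ k) ^ 2)) ≤ 6 * min δ (1 / (κ * δ * (2 ^ k) ^ 2)) := by
      rw [hβα, mul_min_of_nonneg _ _ (by norm_num : (0:ℝ) ≤ 6)]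
      refine min_le_min (by linarith) (le_mul_of_one_le_left (by positivity) (by norm_num))
    have hν : ∀ ν : ℝ, 0 ≤ ν → ν ≤ 2 → min δ (1 / (κ * δ * (2 ^ k) ^ 2)) * ((2 : ℝ) ^ k) ^ ν ≤ δ * J₀ ^ ν :=
      fun ν h0 h2 => min_mul_rpow_le hδ hκ hJ0 h0 h2
    have hmin0 : 0 ≤ min δ (1 / (κ * δ * (2 ^ k) ^ 2)) := le_min hδ.le (by positivity)
    have hDk : D k ≤ C₁ * (Q ^ (3 * e) * (Q ^ (3 / 2 : ℝ) * ((2 : ℝ) ^ k) ^ (1 / 2 : ℝ)) +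
        Q ^ (3 * e) * (Q ^ (1 / 2 : ℝ) * ((2 : ℝ) ^ k) ^ (3 / 2 : ℝ)) +
        Q ^ ((3 - θ) / 2) * ((2 : ℝ) ^ k) ^ ((3 - θ) / 2) +
        A * (κ⁻¹ * (Q ^ ((3 - (1 - e)) / 2) * ((2 : ℝ) ^ k) ^ ((3 - (1 - e)) / 2)))) := by
      simp only [hD]
      push_cast
      refine mul_le_mul_of_nonneg_left ?_ hC₁.le
      rw [Real.mul_rpow hQ0.le hJ0.le, Real.mul_rpow hQ0.le hJ0.le]
      have c1 : ((2 : ℝ) ^ k) ^ (1 / 2 + e) * √Q * (Q + Q ^ e * 2 ^ k) ≤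
          Q ^ (3 * e) * (Q ^ (3 / 2 : ℝ) * ((2 : ℝ) ^ k) ^ (1 / 2 : ℝ)) +
          Q ^ (3 * e) * (Q ^ (1 / 2 : ℝ) * ((2 : ℝ) ^ k) ^ (3 / 2 : ℝ)) := by
        have d1 : ((2 : ℝ) ^ k) ^ (3 / 2 : ℝ) = ((2 : ℝ) ^ k) ^ (1 / 2 : ℝ) * 2 ^ k := by
          rw [← Real.rpow_add_one hJ0.ne']; norm_num
        have d2 : Q ^ (3 / 2 : ℝ) = Q ^ (1 / 2 : ℝ) * Q := by
          rw [← Real.rpow_add_one hQ0.ne']; norm_num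
        have d3 : Q ^ (3 * e) = Q ^ (2 * e) * Q ^ e := by
          rw [← Real.rpow_add hQ0]; congr 1; ring
        have d4 : 1 ≤ Q ^ e := Real.one_le_rpow hQ he0.le
        rw [Real.rpow_add hJ0, Real.sqrt_eq_rpow, d1, d2, d3]
        calc _ ≤ ((2 : ℝ) ^ k) ^ (1 / 2 : ℝ) * Q ^ (2 * e) * Q ^ (1 / 2 : ℝ) * (Q ^ e * Q + Q ^ e * 2 ^ k) := by
              gcongr
              exact le_mul_of_one_le_left hQ0.le d4
          _ = _ := by ring
      have c2 : A / κ * (Q ^ ((3 - (1 - e)) / 2) * ((2 : ℝ) ^ k) ^ ((3 - (1 - e)) / 2)) =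
        A * (κ⁻¹ * (Q ^ ((3 - (1 - e)) / 2) * ((2 : ℝ) ^ k) ^ ((3 - (1 - e)) / 2))) := by ring
      linarith
    have hD0 : 0 ≤ D k := by positivity
    have f1 := mul_le_mul_of_nonneg_left (hν (1 / 2) (by norm_num) (by norm_num)) (by positivity : 0 ≤ Q ^ (3 * e) * Q ^ (3 / 2 : ℝ))
    have f2 := mul_le_mul_of_nonneg_left (hν (3 / 2) (by norm_num) (by norm_num)) (by positivity : 0 ≤ Q ^ (3 * e) * Q ^ (1 / 2 : ℝ))
    have f3 := mul_le_mul_of_nonneg_left (hν ((3 - θ) / 2) (by linarith) (by linarith)) (by positivity : 0 ≤ Q ^ ((3 - θ) / 2))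
    have f4 := mul_le_mul_of_nonneg_left (hν ((3 - (1 - e)) / 2) (by linarith) (by linarith))
      (by positivity : 0 ≤ A * (κ⁻¹ * Q ^ ((3 - (1 - e)) / 2)))
    calc _ ≤ (6 * min δ (1 / (κ * δ * (2 ^ k) ^ 2))) * D k := mul_le_mul_of_nonneg_right hmin hD0
      _ ≤ (6 * min δ (1 / (κ * δ * (2 ^ k) ^ 2))) * _ := mul_le_mul_of_nonneg_left hDk (by positivity)
      _ ≤ _ := by
        rw [show ∀ x y : ℝ, 6 * x * (C₁ * y) = 6 * C₁ * (x * y) from fun x y => by ring]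
        refine mul_le_mul_of_nonneg_left ?_ (by positivity)
        rw [hP]
        linarith
  -- Cutting off at `Q ^ 2` leaves `O(1 / (κδ))`, which is `O(κδQ²)` because `1 ≤ κδQ`.
  have htail : 2 * (∑ p ∈ pairBox R Q, W (p.1 / p.2)) / ((β - α) * 2 ^ (n + 1)) ≤ 2 * (8 * R + 6) * (κ * δ * Q ^ 2) := by
    have hsum : ∑ p ∈ pairBox R Q, W (p.1 / p.2) ≤ (8 * R + 6) * Q ^ 2 := by
      refine le_trans ?_ (card_pairBox_le hR hQ)
      refine (Finset.sum_le_sum fun p _ => hW.le_one _).trans_eq ?_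
      rw [Finset.sum_const, nsmul_eq_mul, mul_one]
    have h1 := hadm.one_le_mul hθ hθ1 hε
    rw [hβα]
    calc _ ≤ 2 * ((8 * R + 6) * Q ^ 2) / ((κ * δ) * Q ^ 2) := by gcongr
      _ = 2 * (8 * R + 6) * (1 / (κ * δ)) := by field_simp
      _ ≤ _ := by
        refine mul_le_mul_of_nonneg_left ?_ (by positivity)
        rw [div_le_iff₀ (by positivity)]
        calc (1 : ℝ) ≤ (κ * δ * Q) ^ 2 := one_le_pow₀ h1
          _ = _ := by ring
  calc _ ≤ _ := hmain
    _ ≤ ((n + 1 : ℕ) : ℝ) * (6 * C₁ * (δ * P)) + 2 * (8 * R + 6) * (κ * δ * Q ^ 2) := by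
        refine add_le_add ?_ htail
        refine (Finset.sum_le_sum hterm).trans_eq ?_
        rw [Finset.sum_const, Finset.card_range, nsmul_eq_mul]
    _ ≤ (ce * Q ^ e) * (6 * C₁ * (δ * P)) + 2 * (8 * R + 6) * (κ * δ * Q ^ 2) := by gcongr
    _ = ce * (6 * C₁) * δ * (Q ^ e * P) + 2 * (8 * R + 6) * (κ * δ * Q ^ 2) := by ring
    _ ≤ ce * (6 * C₁) * δ * ((3 + A) * (κ * Q ^ 2)) + 2 * (8 * R + 6) * (κ * δ * Q ^ 2) := by gcongr
    _ = _ := by ring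

end IsCurve

/-! ### The main term and the sandwich -/

theorem sum_Ioc_cast {M N : ℕ} (h : M ≤ N) : ∑ q ∈ Finset.Ioc M N, (q : ℝ) = ((N : ℝ) * (N + 1) - M * (M + 1)) / 2 := by
  induction N, h using Nat.le_induction with
  | base => simp
  | succ N h ih => rw [Finset.sum_Ioc_succ_top h, ih]; push_cast; ring

theorem sum_Ioc_floor_bounds {Q : ℝ} (hQ : 1 ≤ Q) :
    3 / 2 * (Q ^ 2 - Q) ≤ ∑ q ∈ Finset.Ioc ⌊Q⌋₊ ⌊2 * Q⌋₊, (q : ℝ) ∧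
      ∑ q ∈ Finset.Ioc ⌊Q⌋₊ ⌊2 * Q⌋₊, (q : ℝ) ≤ 3 / 2 * (Q ^ 2 + Q) := by
  rw [sum_Ioc_cast (Nat.floor_le_floor (by linarith))]
  have h1 := Nat.floor_le (by linarith : 0 ≤ Q)
  have h2 := Nat.lt_floor_add_one Q
  have h3 := Nat.floor_le (by linarith : 0 ≤ 2 * Q)
  have h4 := Nat.lt_floor_add_one (2 * Q)
  constructor <;> nlinarith

theorem sum_Ioc_floor_affine {Q : ℝ} (l c : ℝ) : ∑ q ∈ Finset.Ioc ⌊Q⌋₊ ⌊2 * Q⌋₊, (l * (q : ℝ) + c) =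
    l * ∑ q ∈ Finset.Ioc ⌊Q⌋₊ ⌊2 * Q⌋₊, (q : ℝ) + (⌊2 * Q⌋₊ - ⌊Q⌋₊ : ℕ) * c := by
  rw [Finset.sum_add_distrib, Finset.mul_sum, Finset.sum_const, Nat.card_Ioc, nsmul_eq_mul]

theorem card_Icc_ceil_floor_le {x y : ℝ} (h : x ≤ y) : ((Finset.Icc ⌈x⌉ ⌊y⌋).card : ℝ) ≤ y - x + 1 := by
  rw [Int.card_Icc]
  have h1 := Int.le_ceil x
  have h2 := Int.floor_le y
  rcases le_or_gt 0 (⌊y⌋ + 1 - ⌈x⌉) with h0 | h0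
  · have : (((⌊y⌋ + 1 - ⌈x⌉).toNat : ℤ) : ℝ) = ⌊y⌋ + 1 - ⌈x⌉ := by rw [Int.toNat_of_nonneg h0]; push_cast; ring
    rw [Int.cast_natCast] at this
    linarith
  · rw [Int.toNat_of_nonpos h0.le]; push_cast; linarith

theorem le_card_Icc_ceil_floor (x y : ℝ) : y - x - 1 ≤ ((Finset.Icc ⌈x⌉ ⌊y⌋).card : ℝ) := by
  rw [Int.card_Icc]
  have h1 := Int.ceil_lt_add_one x
  have h2 := Int.lt_floor_add_one y
  have : ((⌊y⌋ + 1 - ⌈x⌉ : ℤ) : ℝ) ≤ (((⌊y⌋ + 1 - ⌈x⌉).toNat : ℤ) : ℝ) := by exact_mod_cast Int.self_le_toNat _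
  rw [Int.cast_natCast] at this
  push_cast at this
  linarith

/-- For each `q` the weight is at most the indicator of `a q ≤ t ≤ b q`, an interval containing at
most `(b - a) q + 1` integers. -/
theorem sum_weight_le {W : ℝ → ℝ} {R Q a b : ℝ} (hQ : 1 ≤ Q) (h1 : ∀ x, W x ≤ 1) (hab : a ≤ b)
    (hz : ∀ x, x ≤ a ∨ b ≤ x → W x = 0) :
    ∑ p ∈ pairBox R Q, W (p.1 / p.2) ≤ ∑ q ∈ Finset.Ioc ⌊Q⌋₊ ⌊2 * Q⌋₊, ((b - a) * (q : ℝ) + 1) := by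
  classical
  rw [pairBox, Finset.sum_product_right]
  refine Finset.sum_le_sum fun q hq => ?_
  have hq0 : (0 : ℝ) < q := by
    have := (Nat.floor_lt (by linarith)).1 (Finset.mem_Ioc.1 hq).1
    linarith
  calc ∑ t ∈ Finset.Icc (-⌈R * (2 * Q)⌉) ⌈R * (2 * Q)⌉, W (t / q)
      ≤ ∑ t ∈ Finset.Icc (-⌈R * (2 * Q)⌉) ⌈R * (2 * Q)⌉, if t ∈ Finset.Icc ⌈a * q⌉ ⌊b * q⌋ then (1 : ℝ) else 0 := by
        refine Finset.sum_le_sum fun t _ => ?_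
        split_ifs with ht
        · exact h1 _
        · refine (hz _ ?_).le
          by_contra! hcon
          rw [lt_div_iff₀ hq0, div_lt_iff₀ hq0] at hcon
          exact ht (Finset.mem_Icc.2 ⟨Int.ceil_le.2 hcon.1.le, Int.le_floor.2 hcon.2.le⟩)
    _ ≤ ((Finset.Icc ⌈a * q⌉ ⌊b * q⌋).card : ℝ) := by
        rw [Finset.sum_boole]
        exact_mod_cast Finset.card_le_card fun t ht => (Finset.mem_filter.1 ht).2
    _ ≤ b * q - a * q + 1 := card_Icc_ceil_floor_le (by gcongr)
    _ = _ := by ring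

theorem le_sum_weight {W : ℝ → ℝ} {R Q a b : ℝ} (hR : 0 ≤ R) (hQ : 1 ≤ Q) (h0 : ∀ x, 0 ≤ W x)
    (hone : ∀ x, a ≤ x → x ≤ b → W x = 1) (hab : ∀ x, a ≤ x → x ≤ b → |x| ≤ R) :
    ∑ q ∈ Finset.Ioc ⌊Q⌋₊ ⌊2 * Q⌋₊, ((b - a) * (q : ℝ) + -1) ≤ ∑ p ∈ pairBox R Q, W (p.1 / p.2) := by
  classical
  rw [pairBox, Finset.sum_product_right]
  refine Finset.sum_le_sum fun q hq => ?_
  rw [Finset.mem_Ioc] at hq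
  have hq0 : (0 : ℝ) < q := by
    have := (Nat.floor_lt (by linarith)).1 hq.1
    linarith
  have hq2 := (Nat.le_floor_iff (by linarith)).1 hq.2
  have hmem : ∀ t ∈ Finset.Icc ⌈a * q⌉ ⌊b * q⌋, a ≤ (t : ℝ) / q ∧ (t : ℝ) / q ≤ b := by
    intro t ht
    rw [Finset.mem_Icc, Int.ceil_le, Int.le_floor] at ht
    rwa [le_div_iff₀ hq0, div_le_iff₀ hq0]
  calc (b - a) * (q : ℝ) + -1 = b * q - a * q - 1 := by ring
    _ ≤ ((Finset.Icc ⌈a * q⌉ ⌊b * q⌋).card : ℝ) := le_card_Icc_ceil_floor _ _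
    _ = ∑ t ∈ Finset.Icc ⌈a * q⌉ ⌊b * q⌋, W (t / q) := by
        rw [Finset.sum_congr rfl fun t ht => hone _ (hmem t ht).1 (hmem t ht).2]
        simp
    _ ≤ ∑ t ∈ Finset.Icc (-⌈R * (2 * Q)⌉) ⌈R * (2 * Q)⌉, W (t / q) := by
        refine Finset.sum_le_sum_of_subset_of_nonneg ?_ fun _ _ _ => h0 _
        intro t ht
        have h3 := hab _ (hmem t ht).1 (hmem t ht).2
        rw [abs_div, abs_of_pos hq0, div_le_iff₀ hq0] at h3
        have h4 : |(t : ℝ)| ≤ ⌈R * (2 * Q)⌉ := (h3.trans (by gcongr)).trans (Int.le_ceil _)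
        rw [Finset.mem_Icc, ← abs_le]
        exact_mod_cast h4

/-- The main term of the inner approximation. Three losses of relative size `κ` occur: the narrower
trapezoid, the shorter interval, and the `O(Q)` boundary terms, which `Q ≤ κ * Q ^ 2` converts into
multiples of `κ * Q ^ 2`. -/
theorem sum_lower_main {l κ δ Q s N w : ℝ} (hl0 : 0 ≤ l) (hδ : 0 ≤ δ) (hκ : 0 < κ) (hκ1 : κ ≤ 1) (hsq : Q ≤ κ * Q ^ 2)
    (hs1 : 3 / 2 * (Q ^ 2 - Q) ≤ s) (hs2 : s ≤ 3 / 2 * (Q ^ 2 + Q)) (hN : N ≤ 2 * Q)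
    (h3 : (l - 2 * κ) * s + N * -1 ≤ w) :
    3 * l * δ * Q ^ 2 - (6 * l + 24) * (κ * δ * Q ^ 2) ≤ ((1 - κ) * δ + δ) * w := by
  have hQQ : κ * Q ^ 2 ≤ Q ^ 2 := mul_le_of_le_one_left (by positivity) hκ1
  have hαβ : 0 ≤ (1 - κ) * δ + δ := by
    have := mul_nonneg (sub_nonneg.2 hκ1) hδ
    linarith
  have h5 : (3 / 2 * l * (1 - κ) - 8 * κ) * Q ^ 2 ≤ w := by
    refine le_trans ?_ h3
    have e1 : l * (3 / 2 * (Q ^ 2 - κ * Q ^ 2)) ≤ l * s := by gcongr; linarith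
    have e2 : 2 * κ * s ≤ 2 * κ * (3 / 2 * (Q ^ 2 + Q ^ 2)) := by gcongr; nlinarith
    have e3 : (l - 2 * κ) * s = l * s - 2 * κ * s := by ring
    rw [e3]
    nlinarith
  have h6 : ((1 - κ) * δ + δ) * ((3 / 2 * l * (1 - κ) - 8 * κ) * Q ^ 2) ≤ ((1 - κ) * δ + δ) * w := by gcongr
  have h7 : 3 * l * δ * Q ^ 2 - (6 * l + 24) * (κ * δ * Q ^ 2) ≤ ((1 - κ) * δ + δ) * ((3 / 2 * l * (1 - κ) - 8 * κ) * Q ^ 2) := by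
    have e1 : ((1 - κ) * δ + δ) * ((3 / 2 * l * (1 - κ) - 8 * κ) * Q ^ 2) - (3 * l * δ * Q ^ 2 - (6 * l + 24) * (κ * δ * Q ^ 2)) =
      (κ * δ * Q ^ 2) * (3 / 2 * l * (1 + κ) + 8 + 8 * κ) := by ring
    have e2 : 0 ≤ (κ * δ * Q ^ 2) * (3 / 2 * l * (1 + κ) + 8 + 8 * κ) := by positivity
    linarith
  exact h7.trans h6

theorem sum_upper_main {l κ δ Q s N w : ℝ} (hl0 : 0 ≤ l) (hδ : 0 ≤ δ) (hκ : 0 < κ) (hκ1 : κ ≤ 1) (hsq : Q ≤ κ * Q ^ 2)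
    (hs2 : s ≤ 3 / 2 * (Q ^ 2 + Q)) (hN : N ≤ 2 * Q) (h3 : w ≤ (l + 2 * κ) * s + N * 1) :
    (δ + (1 + κ) * δ) * w ≤ 3 * l * δ * Q ^ 2 + (6 * l + 24) * (κ * δ * Q ^ 2) := by
  have hbig : 0 ≤ κ * δ * Q ^ 2 := by positivity
  have h5 : w ≤ (3 / 2 * (l + 2 * κ) * (1 + κ) + 2 * κ) * Q ^ 2 := by
    refine h3.trans ?_
    have e1 : (l + 2 * κ) * s ≤ (l + 2 * κ) * (3 / 2 * (Q ^ 2 + κ * Q ^ 2)) := by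
      gcongr
      linarith
    nlinarith
  have h6 : (δ + (1 + κ) * δ) * w ≤ (δ + (1 + κ) * δ) * ((3 / 2 * (l + 2 * κ) * (1 + κ) + 2 * κ) * Q ^ 2) := by gcongr
  have h7 : (δ + (1 + κ) * δ) * ((3 / 2 * (l + 2 * κ) * (1 + κ) + 2 * κ) * Q ^ 2) ≤ 3 * l * δ * Q ^ 2 + (6 * l + 24) * (κ * δ * Q ^ 2) := by
    have e1 : (3 * l * δ * Q ^ 2 + (6 * l + 24) * (κ * δ * Q ^ 2)) - (δ + (1 + κ) * δ) * ((3 / 2 * (l + 2 * κ) * (1 + κ) + 2 * κ) * Q ^ 2) =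
      (κ * δ * Q ^ 2) * (3 / 2 * l * (1 - κ) + (24 - 3 * (1 + κ) * (2 + κ) - 2 * (2 + κ))) := by ring
    have e2 : 0 ≤ 24 - 3 * (1 + κ) * (2 + κ) - 2 * (2 + κ) := by nlinarith
    have e3 : 0 ≤ 3 / 2 * l * (1 - κ) := mul_nonneg (by positivity) (by linarith)
    have e4 : 0 ≤ (κ * δ * Q ^ 2) * (3 / 2 * l * (1 - κ) + (24 - 3 * (1 + κ) * (2 + κ) - 2 * (2 + κ))) :=
      mul_nonneg hbig (by linarith)
    linarith
  exact h6.trans h7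

theorem coe_filter_pairBox {η ξ R Q δ : ℝ} (f : ℝ → ℝ) (hQ : 1 ≤ Q) (hη : |η| ≤ R) (hξ : |ξ| ≤ R)
    [DecidablePred (· ∈ nearPoints η ξ f Q δ)] :
    ((pairBox R Q).filter (· ∈ nearPoints η ξ f Q δ) : Set (ℤ × ℕ)) = nearPoints η ξ f Q δ := by
  ext p
  simp only [Finset.coe_filter, Set.mem_ofPred_eq, and_iff_right_iff_imp]
  rintro ⟨h1, h2, h3, h4, -⟩
  have hp : (0 : ℝ) ≤ p.2 := by linarith
  refine mem_pairBox (by linarith) h1 h2 ?_ ((abs_nonneg _).trans hη)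
  rw [abs_le] at hη hξ ⊢
  constructor <;> nlinarith

theorem countNear_eq_sum {η ξ R Q δ : ℝ} (f : ℝ → ℝ) (hQ : 1 ≤ Q) (hη : |η| ≤ R) (hξ : |ξ| ≤ R)
    [DecidablePred (· ∈ nearPoints η ξ f Q δ)] :
    (countNear η ξ f Q δ : ℝ) = ∑ p ∈ pairBox R Q, if p ∈ nearPoints η ξ f Q δ then (1 : ℝ) else 0 := by
  rw [Finset.sum_boole, countNear, ← Set.ncard_coe_finset, coe_filter_pairBox f hQ hη hξ]

namespace IsCurve

variable {m M L θ : ℝ} {F F₁ F₂ : ℝ → ℝ}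

/-- The sharp count lies between two smoothed counts, both approximating the main term to within
`O(κδQ²)`. -/
theorem exists_abs_errorNear_le (h : IsCurve m M L θ F F₁ F₂) (hθ : 0 < θ) (hθ1 : θ < 1) (hL : 0 ≤ L) {η ξ ε : ℝ} (hηξ : η < ξ)
    (hε : 0 < ε) (hε1 : ε ≤ 1) :
    ∃ C > 0, ∀ Q δ κ, IsAdmissible θ ε Q δ κ → δ < 1 / 2 → |errorNear η ξ F Q δ| ≤ C * (κ * δ * Q ^ 2) := by
  classical
  obtain ⟨A, hA, hweight⟩ := exists_isWeight
  set R := |η| + |ξ| + 1 with hR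
  have hη : |η| ≤ R := by linarith [abs_nonneg ξ]
  have hξ : |ξ| ≤ R := by linarith [abs_nonneg η]
  have hR0 : 0 ≤ R := (abs_nonneg _).trans hη
  obtain ⟨C, hC, hcount⟩ := h.exists_smooth_count_le hθ hθ1 hL hR0 hA hε hε1
  set l := ξ - η with hl
  have hl0 : 0 < l := by linarith
  clear_value R l
  refine ⟨C + 6 * l + 24 + (8 * R + 6 + 3 * l) * A ^ 12, by positivity, ?_⟩
  intro Q δ κ hadm hδ2
  have hQ := hadm.one_le
  have hδ := hadm.pos
  have hκ := hadm.pos'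
  have hκ1 := hadm.le_one'
  have hQ0 : 0 < Q := by linarith
  have hκδQ := hadm.one_le_mul hθ hθ1 hε
  have hκQ : 1 ≤ κ * Q := by
    refine hκδQ.trans ?_
    rw [mul_right_comm]
    exact mul_le_of_le_one_right (by positivity) hadm.le_one
  have hbig : 0 ≤ κ * δ * Q ^ 2 := by positivity
  -- The smoothed count requires the weight's derivative bound `A / κ` to be at most `√Q`. Otherwise
  -- `κ ^ 3 * Q ≥ 1` forces `Q ≤ A ^ 6`, and the trivial bound suffices.
  rcases le_or_gt ((A / κ) ^ 2) Q with hAQ | hAQ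
  · suffices |errorNear η ξ F Q δ| ≤ (C + 6 * l + 24) * (κ * δ * Q ^ 2) by
      refine this.trans (mul_le_mul_of_nonneg_right ?_ hbig)
      have : 0 ≤ (8 * R + 6 + 3 * l) * A ^ 12 := by positivity
      linarith
    have hsq : Q ≤ κ * Q ^ 2 := by nlinarith
    obtain ⟨hs1, hs2⟩ := sum_Ioc_floor_bounds hQ
    have hN : ((⌊2 * Q⌋₊ - ⌊Q⌋₊ : ℕ) : ℝ) ≤ 2 * Q :=
      le_trans (by exact_mod_cast Nat.sub_le _ _) (Nat.floor_le (by linarith : 0 ≤ 2 * Q))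
    set s := ∑ q ∈ Finset.Ioc ⌊Q⌋₊ ⌊2 * Q⌋₊, (q : ℝ) with hs
    set N : ℝ := ((⌊2 * Q⌋₊ - ⌊Q⌋₊ : ℕ) : ℝ) with hNdef
    clear_value s N
    rw [errorNear, countNear_eq_sum F hQ hη hξ, ← hl, abs_le]
    constructor
    -- Lower bound: the weight lives inside `[η, ξ]` and the trapezoid on `‖y‖ ≤ δ`, so their
    -- product is at most the indicator.
    · obtain ⟨W, W₁, W₂, hW, hone, hzero⟩ := hweight κ η ξ R hκ hκ1 hη hξ
      have h1 := hcount Q δ κ hadm hAQ W W₁ W₂ hW ((1 - κ) * δ) δ (mul_nonneg (by linarith) hδ.le) (by ring) (by nlinarith)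
      have hα0 : 0 ≤ (1 - κ) * δ := mul_nonneg (by linarith) hδ.le
      have hαβ : (1 - κ) * δ < δ := by nlinarith
      have h2 : ∑ p ∈ pairBox R Q, W (p.1 / p.2) * trapezoid ((1 - κ) * δ) δ (p.2 * F (p.1 / p.2)) ≤
          ∑ p ∈ pairBox R Q, if p ∈ nearPoints η ξ F Q δ then (1 : ℝ) else 0 := by
        refine Finset.sum_le_sum fun p hp => ?_
        have hW0 := hW.nonneg ((p.1 : ℝ) / p.2)
        have hT1 := trapezoid_le_one hα0 hδ2.le hαβ (p.2 * F (p.1 / p.2))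
        split_ifs with hmem
        · exact (mul_le_mul_of_nonneg_left hT1 hW0).trans ((mul_one _).trans_le (hW.le_one _))
        · have hp2 := pairBox_snd hQ0.le hp
          have hp0 : (0 : ℝ) < p.2 := by linarith [hp2.1]
          by_cases hin : η < (p.1 : ℝ) / p.2 ∧ (p.1 : ℝ) / p.2 < ξ
          · rw [trapezoid_eq_zero hα0 hδ2.le hαβ, mul_zero]
            by_contra! hlt
            rw [lt_div_iff₀ hp0, div_lt_iff₀ hp0] at hin
            exact hmem ⟨hp2.1, hp2.2, hin.1, hin.2.le, hlt⟩
          · rw [hzero _ (by by_contra! hcon; exact hin hcon), zero_mul]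
      have h3 := le_sum_weight (W := W) (a := η + κ) (b := ξ - κ) hR0 hQ hW.nonneg hone (fun x hx1 hx2 => by
        rw [abs_le] at hη hξ ⊢; constructor <;> linarith)
      rw [sum_Ioc_floor_affine, ← hs, ← hNdef, show ξ - κ - (η + κ) = l - 2 * κ by rw [hl]; ring] at h3
      have h4 := neg_le_of_abs_le h1
      generalize ∑ p ∈ pairBox R Q, W (p.1 / p.2) = w at h1 h3 h4
      have h7 := sum_lower_main hl0.le hδ.le hκ hκ1 hsq hs1 hs2 hN h3
      linarith
    -- Upper bound: the weight is one on `[η, ξ]` and the trapezoid at least one for `‖y‖ ≤ δ`. Its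
    -- outer width `(1 + κ) * δ` may exceed `1 / 2`.
    · obtain ⟨W, W₁, W₂, hW, hone, hzero⟩ := hweight κ (η - κ) (ξ + κ) R hκ hκ1
        (by rw [abs_le]; constructor <;> linarith [neg_abs_le η, le_abs_self η, abs_nonneg ξ])
        (by rw [abs_le]; constructor <;> linarith [neg_abs_le ξ, le_abs_self ξ, abs_nonneg η])
      have hαβ : δ < (1 + κ) * δ := by nlinarith
      have h1 := hcount Q δ κ hadm hAQ W W₁ W₂ hW δ ((1 + κ) * δ) hδ.le (by ring) (by nlinarith)
      have h2 : (∑ p ∈ pairBox R Q, if p ∈ nearPoints η ξ F Q δ then (1 : ℝ) else 0) ≤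
          ∑ p ∈ pairBox R Q, W (p.1 / p.2) * trapezoid δ ((1 + κ) * δ) (p.2 * F (p.1 / p.2)) := by
        refine Finset.sum_le_sum fun p hp => ?_
        have hW0 := hW.nonneg ((p.1 : ℝ) / p.2)
        split_ifs with hmem
        · have hp0 : (0 : ℝ) < p.2 := by linarith [hmem.1]
          rw [hone, one_mul]
          · exact one_le_trapezoid hδ.le hδ2.le hαβ hmem.2.2.2.2.le
          · rw [sub_add_cancel, le_div_iff₀ hp0]; exact hmem.2.2.1.le
          · rw [add_sub_cancel_right, div_le_iff₀ hp0]; exact hmem.2.2.2.1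
        · exact mul_nonneg hW0 (trapezoid_nonneg_of_le_half hδ.le hδ2.le hαβ _)
      have h3 := sum_weight_le (W := W) (R := R) (a := η - κ) (b := ξ + κ) hQ hW.le_one (by linarith) hzero
      rw [sum_Ioc_floor_affine, ← hs, ← hNdef, show ξ + κ - (η - κ) = l + 2 * κ by rw [hl]; ring] at h3
      have h4 := le_of_abs_le h1
      generalize ∑ p ∈ pairBox R Q, W (p.1 / p.2) = w at h1 h3 h4
      have h7 := sum_upper_main hl0.le hδ.le hκ hκ1 hsq hs2 hN h3
      linarith
  · have hQA : Q ≤ A ^ 6 := by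
      have h1 : 1 ≤ κ ^ 3 * Q := by
        obtain ⟨a1, a2, a3, a4, a5, a6, a7⟩ := hadm.log_bounds hθ hθ1
        rw [← Real.log_nonneg_iff (by positivity), Real.log_mul (by positivity) (by positivity), Real.log_pow]
        push_cast; linarith
      rw [div_pow, lt_div_iff₀ (by positivity)] at hAQ
      calc Q ≤ (κ ^ 3 * Q) ^ 2 * Q := le_mul_of_one_le_left hQ0.le (one_le_pow₀ h1)
        _ = (Q * κ ^ 2) ^ 3 := by ring
        _ ≤ (A ^ 2) ^ 3 := by gcongr
        _ = _ := by ring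
    have h1 : (countNear η ξ F Q δ : ℝ) ≤ (8 * R + 6) * Q ^ 2 := by
      rw [countNear_eq_sum F hQ hη hξ, Finset.sum_boole]
      exact (Nat.cast_le.2 (Finset.card_filter_le _ _)).trans (card_pairBox_le hR0 hQ)
    have h2 : |errorNear η ξ F Q δ| ≤ (8 * R + 6 + 3 * l) * Q ^ 2 := by
      rw [errorNear, ← hl]
      refine (abs_sub _ _).trans ?_
      rw [abs_of_nonneg (Nat.cast_nonneg _), abs_of_nonneg (by positivity)]
      have : 3 * l * δ * Q ^ 2 ≤ 3 * l * 1 * Q ^ 2 := by gcongr; linarith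
      linarith
    have h3 : Q ^ 2 ≤ A ^ 12 := by
      calc Q ^ 2 ≤ (A ^ 6) ^ 2 := by gcongr
        _ = _ := by ring
    have h4 : 1 ≤ κ * δ * Q ^ 2 := by
      calc (1 : ℝ) ≤ (κ * δ * Q) * Q := one_le_mul_of_one_le_of_one_le hκδQ hQ
        _ = _ := by ring
    calc _ ≤ (8 * R + 6 + 3 * l) * Q ^ 2 := h2
      _ ≤ (8 * R + 6 + 3 * l) * A ^ 12 := by gcongr
      _ ≤ (8 * R + 6 + 3 * l) * A ^ 12 * (κ * δ * Q ^ 2) := le_mul_of_one_le_right (by positivity) h4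
      _ ≤ _ := by
        refine mul_le_mul_of_nonneg_right ?_ hbig
        linarith

end IsCurve

/-! ### Reduction to curves on the line, and conclusion -/

/-- A convex function on an interval with Hölder continuous second derivative extends to a curve. -/
theorem exists_isCurve_extension {η ξ θ m : ℝ} (hηξ : η < ξ) (hθ : 0 < θ) {f : ℝ → ℝ} (hf : ContDiffOn ℝ 2 f (Set.Icc η ξ))
    (hm : 0 < m) (hpos : ∀ x ∈ Set.Icc η ξ, m ≤ secondDeriv η ξ f x) {L : ℝ≥0}
    (hL : HolderOnWith L θ.toNNReal (secondDeriv η ξ f) (Set.Icc η ξ)) :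
    ∃ (M : ℝ) (F F₁ F₂ : ℝ → ℝ), IsCurve m M L θ F F₁ F₂ ∧ ∀ x ∈ Set.Icc η ξ, F x = f x := by
  have hu : UniqueDiffOn ℝ (Set.Icc η ξ) := uniqueDiffOn_Icc hηξ
  have hc : ContinuousOn (secondDeriv η ξ f) (Set.Icc η ξ) := hf.continuousOn_iteratedDerivWithin (by norm_num) hu
  obtain ⟨M, hM⟩ := isCompact_Icc.exists_bound_of_continuousOn hc
  -- The second derivative is extended by its end values. Projection onto the interval does not
  -- increase distances, so the bounds and the Hölder constant persist; integrating twice from `η`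
  -- recovers `f`.
  set F₂ : ℝ → ℝ := fun x => secondDeriv η ξ f (Set.projIcc η ξ hηξ.le x) with hF₂
  have hproj : ∀ x ∈ Set.Icc η ξ, F₂ x = secondDeriv η ξ f x := fun x hx => by
    simp only [hF₂]; rw [Set.projIcc_of_mem hηξ.le hx]
  have hF₂c : Continuous F₂ :=
    (continuousOn_iff_continuous_domRestrict.1 hc).comp (continuous_projIcc (h := hηξ.le))
  set F₁ : ℝ → ℝ := fun x => derivWithin f (Set.Icc η ξ) η + ∫ t in η..x, F₂ t with hF₁
  have hF₁d : ∀ x, HasDerivAt F₁ (F₂ x) x := fun x =>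
    (intervalIntegral.integral_hasDerivAt_right (hF₂c.intervalIntegrable _ _)
      hF₂c.stronglyMeasurable.stronglyMeasurableAtFilter hF₂c.continuousAt).const_add _
  have hF₁c : Continuous F₁ := continuous_iff_continuousAt.2 fun x => (hF₁d x).continuousAt
  set F : ℝ → ℝ := fun x => f η + ∫ t in η..x, F₁ t with hF
  have hFd : ∀ x, HasDerivAt F (F₁ x) x := fun x =>
    (intervalIntegral.integral_hasDerivAt_right (hF₁c.intervalIntegrable _ _)
      hF₁c.stronglyMeasurable.stronglyMeasurableAtFilter hF₁c.continuousAt).const_add _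
  have hd1 : DifferentiableOn ℝ (derivWithin f (Set.Icc η ξ)) (Set.Icc η ξ) :=
    (hf.derivWithin hu (m := 1) (by norm_num)).differentiableOn (by norm_num)
  have hη : η ∈ Set.Icc η ξ := ⟨le_rfl, hηξ.le⟩
  have e1 : ∀ x ∈ Set.Icc η ξ, F₁ x = derivWithin f (Set.Icc η ξ) x := by
    refine eq_of_derivWithin_eq (fun x _ => (hF₁d x).differentiableAt.differentiableWithinAt) hd1 ?_ (by simp [hF₁])
    intro x hx
    have hx' := Set.Ico_subset_Icc_self hx
    rw [(hF₁d x).hasDerivWithinAt.derivWithin (hu x hx'), hproj x hx', secondDeriv, iteratedDerivWithin_succ,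
      iteratedDerivWithin_one]
  have e2 : ∀ x ∈ Set.Icc η ξ, F x = f x := by
    refine eq_of_derivWithin_eq (fun x _ => (hFd x).differentiableAt.differentiableWithinAt) (hf.differentiableOn (by norm_num)) ?_
      (by simp [hF])
    intro x hx
    have hx' := Set.Ico_subset_Icc_self hx
    rw [(hFd x).hasDerivWithinAt.derivWithin (hu x hx'), e1 x hx']
  refine ⟨M, F, F₁, F₂, ⟨hm, hFd, hF₁d, hF₂c, fun x => hpos _ (Set.projIcc η ξ hηξ.le x).2,
    fun x => (le_abs_self _).trans (hM _ (Set.projIcc η ξ hηξ.le x).2), ?_⟩, e2⟩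
  intro x y
  have h1 := hL.dist_le (Set.projIcc η ξ hηξ.le x).2 (Set.projIcc η ξ hηξ.le y).2
  rw [Real.dist_eq, Real.coe_toNNReal _ hθ.le] at h1
  refine h1.trans (mul_le_mul_of_nonneg_left (Real.rpow_le_rpow dist_nonneg ?_ hθ.le) L.2)
  exact Set.abs_projIcc_sub_projIcc hηξ.le

/-- Comparing only distances to the nearest integer allows `f` to be replaced by its extension and
also by the extension of `-f`. -/
theorem errorNear_congr {η ξ Q δ : ℝ} {f g : ℝ → ℝ} (hQ : 0 ≤ Q)
    (h : ∀ (q : ℕ), ∀ x ∈ Set.Icc η ξ, distInt (q * f x) = distInt (q * g x)) : errorNear η ξ f Q δ = errorNear η ξ g Q δ := by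
  rw [errorNear, errorNear, countNear, countNear]
  congr 3
  ext p
  refine and_congr_right fun h1 => and_congr_right fun _ => and_congr_right fun h3 => and_congr_right fun h4 => ?_
  have hp : (0 : ℝ) < p.2 := hQ.trans_lt h1
  rw [h p.2 _ ⟨by rw [le_div_iff₀ hp]; exact h3.le, by rwa [div_le_iff₀ hp]⟩]

/-- The quotient of the two bounds is the power `ν = 2/3 - 2/(5 - θ)` of `δ / threshold θ Q`. As `ν`
is nonnegative, the position of `δ` relative to `c * threshold θ Q` decides which bound dominates,
up to the constants `c ^ (-ν)` and `c ^ ν`. -/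
theorem threshold_compare {θ c Q δ : ℝ} (hθ1 : θ < 1) (hc : 0 < c) (hQ : 1 < Q) (hδ : 0 < δ) :
    (c * threshold θ Q ≤ δ → δ ^ (2 / (5 - θ)) * Q ^ (3 * (3 - θ) / (5 - θ)) ≤
      c ^ (-((4 - 2 * θ) / (3 * (5 - θ)))) * (δ ^ (2 / 3 : ℝ) * Q ^ (5 / 3 : ℝ) * Real.log Q ^ (2 / 3 : ℝ))) ∧
    (δ ≤ c * threshold θ Q → δ ^ (2 / 3 : ℝ) * Q ^ (5 / 3 : ℝ) * Real.log Q ^ (2 / 3 : ℝ) ≤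
      c ^ ((4 - 2 * θ) / (3 * (5 - θ))) * (δ ^ (2 / (5 - θ)) * Q ^ (3 * (3 - θ) / (5 - θ)))) := by
  have hQ0 : 0 < Q := by linarith
  have hl : 0 < Real.log Q := Real.log_pos hQ
  have h5 : 0 < 5 - θ := by linarith
  have h2 : 0 < 2 - θ := by linarith
  have hT : 0 < threshold θ Q := by rw [threshold]; positivity
  have hlogT : Real.log (c * threshold θ Q) = Real.log c + ((1 - 2 * θ) / (2 - θ) * Real.log Q +
      -((5 - θ) / (2 - θ)) * Real.log (Real.log Q)) := by
    rw [Real.log_mul hc.ne' hT.ne', threshold, Real.log_mul (by positivity) (by positivity), Real.log_rpow hQ0, Real.log_rpow hl]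
  set ν := (4 - 2 * θ) / (3 * (5 - θ)) with hν
  have hν0 : 0 ≤ ν := div_nonneg (by linarith) (by linarith)
  have a1 : ν * ((1 - 2 * θ) / (2 - θ)) = 3 * (3 - θ) / (5 - θ) - 5 / 3 := by
    rw [hν]; field_simp; ring
  have a2 : ν * ((5 - θ) / (2 - θ)) = 2 / 3 := by
    rw [hν]; field_simp; ring
  have a3 : 2 / (5 - θ) = 2 / 3 - ν := by
    rw [hν]; field_simp; ring
  have hM1 : Real.log (δ ^ (2 / 3 : ℝ) * Q ^ (5 / 3 : ℝ) * Real.log Q ^ (2 / 3 : ℝ)) =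
      2 / 3 * Real.log δ + 5 / 3 * Real.log Q + 2 / 3 * Real.log (Real.log Q) := by
    rw [Real.log_mul (by positivity) (by positivity), Real.log_mul (by positivity) (by positivity), Real.log_rpow hδ,
      Real.log_rpow hQ0, Real.log_rpow hl]
  have hM2 : Real.log (δ ^ (2 / (5 - θ)) * Q ^ (3 * (3 - θ) / (5 - θ))) =
      (2 / 3 - ν) * Real.log δ + (3 * (3 - θ) / (5 - θ)) * Real.log Q := by
    rw [Real.log_mul (by positivity) (by positivity), Real.log_rpow hδ, Real.log_rpow hQ0, a3]
  have hexp : ν * (Real.log c + ((1 - 2 * θ) / (2 - θ) * Real.log Q + -((5 - θ) / (2 - θ)) * Real.log (Real.log Q))) =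
      ν * Real.log c + (3 * (3 - θ) / (5 - θ) - 5 / 3) * Real.log Q - 2 / 3 * Real.log (Real.log Q) := by
    rw [← a1, ← a2]; ring
  constructor
  · intro h
    have h1 := mul_le_mul_of_nonneg_left (Real.log_le_log (by positivity) h) hν0
    rw [hlogT, hexp] at h1
    rw [← Real.log_le_log_iff (by positivity) (by positivity), Real.log_mul (x := c ^ (-ν)) (by positivity) (by positivity), hM1, hM2,
      Real.log_rpow hc]
    linarith
  · intro h
    have h1 := mul_le_mul_of_nonneg_left (Real.log_le_log hδ h) hν0
    rw [hlogT, hexp] at h1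
    rw [← Real.log_le_log_iff (by positivity) (by positivity), Real.log_mul (x := c ^ ν) (by positivity) (by positivity), hM1, hM2,
      Real.log_rpow hc]
    linarith

/-- `κ` is the larger of its two required lower bounds, and each of them times `δ * Q ^ 2` is one of
the two error terms. The hypothesis on `δ` makes `δ^(3-θ) Q^(1+θ)` and `δ Q` at least a positive
power of `Q`, so that `κ ≤ 1`. -/
theorem exists_isAdmissible {θ ε Q δ : ℝ} (hθ : 0 < θ) (hθ1 : θ < 1) (hε : 0 < ε) (hQ : 1 ≤ Q)
    (hδ : Q ^ (-((1 + θ) / (3 - θ)) + ε) ≤ δ) (hδ1 : δ ≤ 1) : ∃ κ, IsAdmissible θ (min ε 1) Q δ κ ∧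
      κ * δ * Q ^ 2 ≤ δ ^ (2 / 3 : ℝ) * Q ^ (5 / 3 : ℝ) + δ ^ (2 / (5 - θ)) * Q ^ (3 * (3 - θ) / (5 - θ)) := by
  have hQ0 : 0 < Q := by linarith
  have hδ0 : 0 < δ := lt_of_lt_of_le (by positivity) hδ
  have h3 : 0 < 3 - θ := by linarith
  have h5 : 0 < 5 - θ := by linarith
  have hmin : min ε 1 ≤ ε := min_le_left _ _
  have hmin0 : 0 ≤ min ε 1 := le_min hε.le zero_le_one
  have hY : Q ^ (min ε 1) ≤ δ * Q := by
    calc Q ^ (min ε 1) ≤ Q ^ (-((1 + θ) / (3 - θ)) + ε + 1) := by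
          refine Real.rpow_le_rpow_of_exponent_le hQ ?_
          have : (1 + θ) / (3 - θ) ≤ 1 := by rw [div_le_one h3]; linarith
          linarith
      _ = Q ^ (-((1 + θ) / (3 - θ)) + ε) * Q := Real.rpow_add_one hQ0.ne' _
      _ ≤ _ := by gcongr
  have hX : Q ^ (min ε 1) ≤ δ ^ (3 - θ) * Q ^ (1 + θ) := by
    calc Q ^ (min ε 1) ≤ Q ^ ((-((1 + θ) / (3 - θ)) + ε) * (3 - θ) + (1 + θ)) := by
          refine Real.rpow_le_rpow_of_exponent_le hQ ?_
          have : (-((1 + θ) / (3 - θ)) + ε) * (3 - θ) + (1 + θ) = ε * (3 - θ) := by field_simp; ring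
          rw [this]
          nlinarith
      _ = (Q ^ (-((1 + θ) / (3 - θ)) + ε)) ^ (3 - θ) * Q ^ (1 + θ) := by rw [Real.rpow_add hQ0, Real.rpow_mul hQ0.le]
      _ ≤ _ := by gcongr
  have h1 : 1 ≤ Q ^ (min ε 1) := Real.one_le_rpow hQ hmin0
  have hY1 : (δ * Q) ^ (-(1 / 3) : ℝ) ≤ 1 := Real.rpow_le_one_of_one_le_of_nonpos (h1.trans hY) (by norm_num)
  have hX1 : (δ ^ (3 - θ) * Q ^ (1 + θ)) ^ (-(1 / (5 - θ))) ≤ 1 :=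
    Real.rpow_le_one_of_one_le_of_nonpos (h1.trans hX) (by rw [neg_nonpos]; positivity)
  have hY0 : 0 < (δ * Q) ^ (-(1 / 3) : ℝ) := by positivity
  have hX0 : 0 < (δ ^ (3 - θ) * Q ^ (1 + θ)) ^ (-(1 / (5 - θ))) := by positivity
  refine ⟨max ((δ * Q) ^ (-(1 / 3) : ℝ)) ((δ ^ (3 - θ) * Q ^ (1 + θ)) ^ (-(1 / (5 - θ)))),
    ⟨hQ, hδ0, hδ1, lt_max_of_lt_left hY0, max_le hY1 hX1, hY, hX, le_max_left _ _, le_max_right _ _⟩, ?_⟩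
  have e1 : (δ * Q) ^ (-(1 / 3) : ℝ) * δ * Q ^ 2 = δ ^ (2 / 3 : ℝ) * Q ^ (5 / 3 : ℝ) := by
    rw [Real.mul_rpow hδ0.le hQ0.le, show (2 / 3 : ℝ) = -(1 / 3) + 1 by norm_num, show (5 / 3 : ℝ) = -(1 / 3) + 2 by norm_num,
      Real.rpow_add_one hδ0.ne', Real.rpow_add hQ0, Real.rpow_two]
    ring
  have e2 : (δ ^ (3 - θ) * Q ^ (1 + θ)) ^ (-(1 / (5 - θ))) * δ * Q ^ 2 = δ ^ (2 / (5 - θ)) * Q ^ (3 * (3 - θ) / (5 - θ)) := by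
    rw [Real.mul_rpow (by positivity) (by positivity), ← Real.rpow_mul hδ0.le, ← Real.rpow_mul hQ0.le,
      show 2 / (5 - θ) = (3 - θ) * -(1 / (5 - θ)) + 1 by field_simp; ring,
      show 3 * (3 - θ) / (5 - θ) = (1 + θ) * -(1 / (5 - θ)) + 2 by field_simp; ring,
      Real.rpow_add_one hδ0.ne', Real.rpow_add hQ0, Real.rpow_two]
    ring
  rw [← e1, ← e2, ← add_mul, ← add_mul]
  gcongr
  exact max_le (by linarith) (by linarith)

/-- A continuous second derivative bounded away from zero has constant sign. The concave case
reduces to the convex one because `‖-y‖ = ‖y‖`. -/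
theorem exists_abs_errorNear_le_of_secondDeriv {η ξ θ m ε : ℝ} (hηξ : η < ξ) (hθ0 : 0 < θ) (hθ1 : θ < 1) {f : ℝ → ℝ}
    (hf : ContDiffOn ℝ 2 f (Set.Icc η ξ)) (hm : 0 < m) (hf0 : ∀ x ∈ Set.Icc η ξ, m ≤ |secondDeriv η ξ f x|) {L : ℝ≥0}
    (hL : HolderOnWith L θ.toNNReal (secondDeriv η ξ f) (Set.Icc η ξ)) (hε : 0 < ε) (hε1 : ε ≤ 1) :
    ∃ C > 0, ∀ Q δ κ, IsAdmissible θ ε Q δ κ → δ < 1 / 2 → |errorNear η ξ f Q δ| ≤ C * (κ * δ * Q ^ 2) := by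
  have hc : ContinuousOn (secondDeriv η ξ f) (Set.Icc η ξ) :=
    hf.continuousOn_iteratedDerivWithin (by norm_num) (uniqueDiffOn_Icc hηξ)
  have hsign : (∀ x ∈ Set.Icc η ξ, 0 < secondDeriv η ξ f x) ∨ ∀ x ∈ Set.Icc η ξ, secondDeriv η ξ f x < 0 := by
    by_contra! hcon
    obtain ⟨⟨x, hx, hx0⟩, y, hy, hy0⟩ := hcon
    obtain ⟨z, hz, hz0⟩ := isPreconnected_Icc.intermediate_value hx hy hc ⟨hx0, hy0⟩
    have := hf0 z hz
    rw [hz0, abs_zero] at this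
    linarith
  rcases hsign with hs | hs
  · obtain ⟨M, F, F₁, F₂, hF, hFf⟩ := exists_isCurve_extension hηξ hθ0 hf hm
      (fun x hx => (hf0 x hx).trans_eq (abs_of_pos (hs x hx))) hL
    obtain ⟨C, hC, h⟩ := hF.exists_abs_errorNear_le hθ0 hθ1 L.2 hηξ hε hε1
    refine ⟨C, hC, fun Q δ κ hadm hδ => ?_⟩
    rw [errorNear_congr (g := F) (zero_le_one.trans hadm.one_le) fun q x hx => by rw [hFf x hx]]
    exact h Q δ κ hadm hδ
  · have hneg : secondDeriv η ξ (fun x => -f x) = fun x => -secondDeriv η ξ f x := by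
      ext x
      exact iteratedDerivWithin_fun_neg f
    obtain ⟨M, F, F₁, F₂, hF, hFf⟩ := exists_isCurve_extension (f := fun x => -f x) hηξ hθ0 hf.neg hm
      (fun x hx => by rw [hneg]; exact (hf0 x hx).trans_eq (abs_of_neg (hs x hx)))
      (L := L) (by
        rw [hneg]
        intro x hx y hy
        rw [edist_neg_neg]
        exact hL x hx y hy)
    obtain ⟨C, hC, h⟩ := hF.exists_abs_errorNear_le hθ0 hθ1 L.2 hηξ hε hε1
    refine ⟨C, hC, fun Q δ κ hadm hδ => ?_⟩
    rw [errorNear_congr (g := F) (zero_le_one.trans hadm.one_le) fun q x hx => by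
      rw [hFf x hx, mul_neg, distInt_neg]]
    exact h Q δ κ hadm hδ

theorem theorem1 (η ξ θ : ℝ) (hηξ : η < ξ) (hθ0 : 0 < θ) (hθ1 : θ < 1)
    (f : ℝ → ℝ) (hf : ContDiffOn ℝ 2 f (Set.Icc η ξ))
    (hf0 : ∃ m : ℝ, 0 < m ∧ ∀ x ∈ Set.Icc η ξ, m ≤ |secondDeriv η ξ f x|)
    (hLip : ∃ L : ℝ≥0, HolderOnWith L θ.toNNReal (secondDeriv η ξ f) (Set.Icc η ξ))
    (ε : ℝ) (hε : 0 < ε) (c : ℝ) (hc : 0 < c) :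
    ∃ C : ℝ, 0 < C ∧ ∀ Q δ : ℝ, 1 ≤ Q →
      Q ^ (-((1 + θ) / (3 - θ)) + ε) ≤ δ → δ < 1 / 2 →
        (c * threshold θ Q ≤ δ →
          |errorNear η ξ f Q δ| ≤
            C * (δ ^ (2 / 3 : ℝ) * Q ^ (5 / 3 : ℝ) * Real.log Q ^ (2 / 3 : ℝ))) ∧
        (δ ≤ c * threshold θ Q →
          |errorNear η ξ f Q δ| ≤
            C * (δ ^ (2 / (5 - θ)) * Q ^ (3 * (3 - θ) / (5 - θ)))) := by
  obtain ⟨m, hm, hf0⟩ := hf0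
  obtain ⟨L, hL⟩ := hLip
  obtain ⟨C, hC, h⟩ := exists_abs_errorNear_le_of_secondDeriv hηξ hθ0 hθ1 hf hm hf0 hL (lt_min hε one_pos) (min_le_right ε 1)
  have hlog2 : 0 < Real.log 2 := Real.log_pos one_lt_two
  set ν := (4 - 2 * θ) / (3 * (5 - θ))
  set a := Real.log 2 ^ (2 / 3 : ℝ)
  have ha : 0 < a := by positivity
  refine ⟨C * (a⁻¹ + c ^ (-ν)) + C * (c ^ ν * a⁻¹ + 1), by positivity, ?_⟩
  intro Q δ hQ hQδ hδ
  have hQ0 : 0 < Q := by linarith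
  have hδ0 : 0 < δ := lt_of_lt_of_le (by positivity) hQδ
  have hα : (1 + θ) / (3 - θ) ≤ 1 := by rw [div_le_one (by linarith)]; linarith
  -- The exponent of `Q` in the lower bound for `δ` exceeds `-1`, so `δ < 1 / 2` forces `Q > 2`.
  -- Hence `log Q` is bounded below and the factor `log Q ^ (2 / 3)` can be inserted at the cost of
  -- `a⁻¹`.
  have hlogQ : Real.log 2 ≤ Real.log Q := by
    have h1 := Real.log_le_log (by positivity) (hQδ.trans hδ.le)
    rw [Real.log_rpow hQ0, one_div, Real.log_inv] at h1
    have h2 := Real.log_nonneg hQ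
    have h3 := mul_le_mul_of_nonneg_right hα h2
    have h4 := mul_nonneg hε.le h2
    linarith
  have hQ1 : 1 < Q := (Real.log_pos_iff hQ0.le).1 (hlog2.trans_le hlogQ)
  have hℓ : a ≤ Real.log Q ^ (2 / 3 : ℝ) := Real.rpow_le_rpow hlog2.le hlogQ (by norm_num)
  obtain ⟨κ, hadm, hκ⟩ := exists_isAdmissible hθ0 hθ1 hε hQ hQδ (by linarith)
  obtain ⟨hbig, hsmall⟩ := threshold_compare hθ1 hc hQ1 hδ0
  have hE : |errorNear η ξ f Q δ| ≤ C * (δ ^ (2 / 3 : ℝ) * Q ^ (5 / 3 : ℝ) + δ ^ (2 / (5 - θ)) * Q ^ (3 * (3 - θ) / (5 - θ))) :=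
    (h Q δ κ hadm hδ).trans (by gcongr)
  have hM : δ ^ (2 / 3 : ℝ) * Q ^ (5 / 3 : ℝ) ≤ a⁻¹ * (δ ^ (2 / 3 : ℝ) * Q ^ (5 / 3 : ℝ) * Real.log Q ^ (2 / 3 : ℝ)) := by
    rw [← div_eq_inv_mul, le_div_iff₀ ha]
    gcongr
  have hl0 : 0 < Real.log Q := hlog2.trans_le hlogQ
  have hM₁ : 0 < δ ^ (2 / 3 : ℝ) * Q ^ (5 / 3 : ℝ) * Real.log Q ^ (2 / 3 : ℝ) := by positivity
  have hM₂ : 0 < δ ^ (2 / (5 - θ)) * Q ^ (3 * (3 - θ) / (5 - θ)) := by positivity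
  have hcν : 0 < c ^ ν := by positivity
  have hcν' : 0 < c ^ (-ν) := by positivity
  generalize δ ^ (2 / 3 : ℝ) * Q ^ (5 / 3 : ℝ) * Real.log Q ^ (2 / 3 : ℝ) = M₁ at *
  generalize δ ^ (2 / (5 - θ)) * Q ^ (3 * (3 - θ) / (5 - θ)) = M₂ at *
  constructor
  · intro hT
    have h1 : |errorNear η ξ f Q δ| ≤ C * (a⁻¹ * M₁ + c ^ (-ν) * M₁) :=
      hE.trans (by gcongr; exact hbig hT)
    have h2 : 0 ≤ C * (c ^ ν * a⁻¹ + 1) * M₁ := by positivity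
    linarith
  · intro hT
    have h1 : |errorNear η ξ f Q δ| ≤ C * (a⁻¹ * (c ^ ν * M₂) + M₂) :=
      hE.trans (mul_le_mul_of_nonneg_left (by linarith [mul_le_mul_of_nonneg_left (hsmall hT) (inv_nonneg.2 ha.le)]) hC.le)
    have h2 : 0 ≤ C * (a⁻¹ + c ^ (-ν)) * M₂ := by positivity
    linarith
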